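/- Let $\mathcal O=\mathbb C\{x,y\}$ be the ring of germs of analytic functions at $0\in\mathbb C^2$, and let $d\in\{4,5,6\}$. Let $\mathcal W(d)$ be a non-singular $d$-web of $(\mathbb C^2,0)$: its leaves are the level curves of $F_1,\dots,F_d\in\mathcal O$ with $F_i(0)=0$ and $dF_i(0)\wedge dF_j(0)\neq 0$ for $i\ne j$. Let $F=a_0p^d+a_1p^{d-1}+\dots+a_d\in\mathcal O[p]$, $a_0\neq0$, with $p$-resultant $R$ satisfying $R(0)\ne0$, be an implicit presentation of $\mathcal W(d)$, that is, $F$ is equal to $\prod_{i=1}^d(\partial_y(F_i)\,p+\partial_x(F_i))$ up to an invertible element of $\mathcal O$. The connection $(E,\nabla)$ associated to $F$ is defined as follows. For $r=b_3p^{d-3}+\dots+b_d$ with $b_i\in\mathcal O$, put $\omega=r\,\frac{dy-p\,dx}{\partial_pF}$ on the surface $S=\{F(x,y,p)=0\}$. There is a unique matrix $(A_{ij})$ with entries in $\mathcal O$ such that on $S$, for all $b_3,\dots,b_d$, $$\partial_pF\cdot d\omega=\Big(\sum_{e=0}^{d-2}\rho_e(b)\,p^e\Big)dx\wedge dy,\qquad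 \rho_e(b)=\partial_x(b_{d-e})+\partial_y(b_{d-e+1})+\sum_{j=1}^{d-2}A_{e+1,j}\,b_{j+2},$$ with the convention $b_2=b_{d+1}=0$. Let $p_k:J_{k+1}(\mathcal O^{d-2})\to J_k(\mathcal O^{d-1})$ be the $k$-th prolongation of the differential operator $\rho=(\rho_0,\dots,\rho_{d-2})$, and let $E=\ker p_{d-3}\subset J_{d-2}(\mathcal O^{d-2})$. Then $\nabla:E\to\Omega^1\otimes_{\mathcal O} E$ is the unique connection whose composition with the projection to $\Omega^1\otimes J_{d-3}(\mathcal O^{d-2})$ is the Spencer operator $J_{d-2}(\mathcal O^{d-2})\to\Omega^1\otimes J_{d-3}(\mathcal O^{d-2})$ restricted to $E$. Let $K=\nabla\circ\nabla$ be its curvature. The same definition with $d=3$ gives a connection associated to a presentation of a 3-web. The Blaschke curvature of a non-singular 3-web defined by $F_1,F_2,F_3$ is the 2-form $d\gamma$, where $\gamma$ is a 1-form such that $d\omega_i=\gamma\wedge\omega_i$ for $i=1,2,3$, with $\omega_i=\rho_i\,dF_i$, $\rho_i\in\mathcal O^*$ and $\omega_1+\omega_2+\omega_3=0$; it depends only on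 the 3-web. These objects are well defined, $E$ is free of rank $\pi_d=\frac12(d-1)(d-2)$, and $$\operatorname{tr}(K)=\sum_{k=1}^{\binom d3}d\gamma_k,$$ where the $d\gamma_k$ are the Blaschke curvatures of the 3-webs extracted from $\mathcal W(d)$. Equivalently, the determinant $(\det E,\det\nabla)=(\Lambda^{\pi_d}E,\Lambda^{\pi_d}\nabla)$ is isomorphic, as a line bundle with connection, to the tensor product $(\otimes_k L_k,\otimes_k\nabla_k)$, where $(L_k,\nabla_k)$ is the line bundle with connection associated to any presentation of the $k$-th extracted 3-web; both the trace formula and this isomorphism hold. -/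

import Mathlib

open Filter Topology Polynomial
open scoped TensorProduct

noncomputable section

namespace WebGeometry

/-! ### The ring `𝒪 = ℂ{x, y}` and its partial derivatives -/

/-- The ring of germs at the origin of `ℂ²` of analytic functions. -/
def analyticGerms : Subring (Germ (𝓝 (0 : ℂ × ℂ)) ℂ) where
  carrier := {φ | ∃ f : ℂ × ℂ → ℂ, AnalyticAt ℂ f 0 ∧ φ = (f : Germ (𝓝 (0 : ℂ × ℂ)) ℂ)}
  mul_mem' := by
    rintro _ _ ⟨f, hf, rfl⟩ ⟨g, hg, rfl⟩
    exact ⟨f * g, hf.mul hg, rfl⟩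
  one_mem' := ⟨fun _ => 1, analyticAt_const, rfl⟩
  add_mem' := by
    rintro _ _ ⟨f, hf, rfl⟩ ⟨g, hg, rfl⟩
    exact ⟨f + g, hf.add hg, rfl⟩
  zero_mem' := ⟨fun _ => 0, analyticAt_const, rfl⟩
  neg_mem' := by
    rintro _ ⟨f, hf, rfl⟩
    exact ⟨-f, hf.neg, rfl⟩

/-- `𝒪 = ℂ{x, y}`. -/
abbrev 𝒪 : Type := analyticGerms

/-- The value at the origin. -/
def value (φ : 𝒪) : ℂ := Germ.value (φ : Germ (𝓝 (0 : ℂ × ℂ)) ℂ)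

/-- The derivative of a germ of function in the direction `v`. -/
def germDeriv (v : ℂ × ℂ) (φ : Germ (𝓝 (0 : ℂ × ℂ)) ℂ) : Germ (𝓝 (0 : ℂ × ℂ)) ℂ :=
  φ.liftOn (fun f => ((fun z => fderiv ℂ f z v : ℂ × ℂ → ℂ) : Germ (𝓝 (0 : ℂ × ℂ)) ℂ))
    (fun f g h => Germ.coe_eq.2 <| by
      filter_upwards [(h : f =ᶠ[𝓝 0] g).fderiv (𝕜 := ℂ)] with z hz
      rw [hz])

theorem germDeriv_mem (v : ℂ × ℂ) {φ : Germ (𝓝 (0 : ℂ × ℂ)) ℂ} (hφ : φ ∈ analyticGerms) :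
    germDeriv v φ ∈ analyticGerms := by
  obtain ⟨f, hf, rfl⟩ := hφ
  refine ⟨fun z => fderiv ℂ f z v, ?_, rfl⟩
  exact ((ContinuousLinearMap.apply ℂ ℂ v).analyticAt _).comp hf.fderiv

/-- The derivative in the direction `v`, as a derivation of `𝒪`. -/
def pderiv (v : ℂ × ℂ) : Derivation ℤ 𝒪 𝒪 :=
  Derivation.mk'
    (AddMonoidHom.toIntLinearMap
      { toFun := fun φ => ⟨germDeriv v φ, germDeriv_mem v φ.2⟩
        map_zero' := by
          apply Subtype.ext
          change (((fun z => fderiv ℂ (fun _ => (0 : ℂ)) z v) : ℂ × ℂ → ℂ) :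
            Germ (𝓝 (0 : ℂ × ℂ)) ℂ) = ((fun _ => (0 : ℂ)) : ℂ × ℂ → ℂ)
          simp
        map_add' := by
          rintro ⟨_, f, hf, rfl⟩ ⟨_, g, hg, rfl⟩
          apply Subtype.ext
          change (((fun z => fderiv ℂ (f + g) z v) : ℂ × ℂ → ℂ) : Germ (𝓝 (0 : ℂ × ℂ)) ℂ) =
            ((fun z => fderiv ℂ f z v + fderiv ℂ g z v) : ℂ × ℂ → ℂ)
          refine Germ.coe_eq.2 ?_
          filter_upwards [hf.eventually_analyticAt, hg.eventually_analyticAt] with z hfz hgz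
          rw [fderiv_add hfz.differentiableAt hgz.differentiableAt]
          rfl })
    (by
      rintro ⟨_, f, hf, rfl⟩ ⟨_, g, hg, rfl⟩
      apply Subtype.ext
      change (((fun z => fderiv ℂ (f * g) z v) : ℂ × ℂ → ℂ) : Germ (𝓝 (0 : ℂ × ℂ)) ℂ) =
        ((fun z => f z * fderiv ℂ g z v + g z * fderiv ℂ f z v) : ℂ × ℂ → ℂ)
      refine Germ.coe_eq.2 ?_
      filter_upwards [hf.eventually_analyticAt, hg.eventually_analyticAt] with z hfz hgz
      rw [fderiv_mul hfz.differentiableAt hgz.differentiableAt]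
      rfl)

/-- `∂/∂x`. -/
def dx : Derivation ℤ 𝒪 𝒪 := pderiv (1, 0)

/-- `∂/∂y`. -/
def dy : Derivation ℤ 𝒪 𝒪 := pderiv (0, 1)

theorem dx_dy_comm (φ : 𝒪) : dx (dy φ) = dy (dx φ) := by
  obtain ⟨_, f, hf, rfl⟩ := φ
  apply Subtype.ext
  change (((fun z => fderiv ℂ (fun t => fderiv ℂ f t (0, 1)) z (1, 0)) : ℂ × ℂ → ℂ) :
      Germ (𝓝 (0 : ℂ × ℂ)) ℂ) =
    ((fun z => fderiv ℂ (fun t => fderiv ℂ f t (1, 0)) z (0, 1)) : ℂ × ℂ → ℂ)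
  refine Germ.coe_eq.2 ?_
  filter_upwards [hf.eventually_analyticAt] with z hz
  have hs : IsSymmSndFDerivAt ℂ f z := hz.contDiffAt.isSymmSndFDerivAt_of_omega
  have key : ∀ v w : ℂ × ℂ, fderiv ℂ (fun t => fderiv ℂ f t v) z w
      = fderiv ℂ (fderiv ℂ f) z w v := by
    intro v w
    rw [fderiv_clm_apply hz.fderiv.differentiableAt (differentiableAt_const v)]
    simp
  rw [key, key]
  exact hs _ _

/-! ### Differential forms -/

/-- A germ of analytic 1-form `cx dx + cy dy`. -/
@[ext]
structure OneForm where
  cx : 𝒪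
  cy : 𝒪

/-- The differential of a function. -/
def diff (f : 𝒪) : OneForm := ⟨dx f, dy f⟩

/-- The product of a 1-form by a function. -/
def OneForm.mulFun (f : 𝒪) (ω : OneForm) : OneForm := ⟨f * ω.cx, f * ω.cy⟩

/-- The exterior derivative of a 1-form. A 2-form is written as its coefficient on `dx ∧ dy`. -/
def OneForm.extDeriv (ω : OneForm) : 𝒪 := dx ω.cy - dy ω.cx

/-- The exterior product of two 1-forms, as its coefficient on `dx ∧ dy`. -/
def OneForm.wedge (ω η : OneForm) : 𝒪 := ω.cx * η.cy - ω.cy * η.cx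

/-! ### Webs -/

/-- A non-singular `d`-web of `(ℂ², 0)`: the leaves are the level curves of `fn i`,
and the foliations are in general position at the origin. -/
structure Web (d : ℕ) where
  fn : Fin d → 𝒪
  fn_zero : ∀ i, value (fn i) = 0
  general : ∀ i j, i ≠ j → value ((diff (fn i)).wedge (diff (fn j))) ≠ 0

/-- The three-element subsets of the set of foliations. -/
abbrev Triple (d : ℕ) : Type := {T : Finset (Fin d) // T.card = 3}

/-- The extracted 3-web of a web on a triple of foliations. -/
def Web.extract {d : ℕ} (W : Web d) (T : Triple d) : Web 3 where
  fn i := W.fn (T.1.orderEmbOfFin T.2 i)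
  fn_zero _ := W.fn_zero _
  general _ _ hij :=
    W.general _ _ fun h => hij ((T.1.orderEmbOfFin T.2).injective h)

/-- `κ dx ∧ dy` is a Blaschke curvature of the 3-web `W`: it is `dγ`, where `dωᵢ = γ ∧ ωᵢ` for
some normalisation `ωᵢ = ρᵢ dFᵢ` with `ρᵢ` invertible and `ω₁ + ω₂ + ω₃ = 0`. -/
def Web.IsBlaschkeCurvature (W : Web 3) (κ : 𝒪) : Prop :=
  ∃ (ρ : Fin 3 → 𝒪) (γ : OneForm),
    (∀ i, IsUnit (ρ i)) ∧
    (∑ i, ((diff (W.fn i)).mulFun (ρ i)).cx = 0 ∧ ∑ i, ((diff (W.fn i)).mulFun (ρ i)).cy = 0) ∧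
    (∀ i, ((diff (W.fn i)).mulFun (ρ i)).extDeriv = γ.wedge ((diff (W.fn i)).mulFun (ρ i))) ∧
    κ = γ.extDeriv

/-- The differential equation `F(x, y, y') = 0`, with `F ∈ 𝒪[p]` of degree `d` and `p`-resultant
`R` with `R(0) ≠ 0`, is an implicit presentation of the `d`-web `W`: up to an invertible factor,
`F` is the product of the `∂_y(Fᵢ) p + ∂_x(Fᵢ)`. -/
structure Web.Presents {d : ℕ} (W : Web d) (F : 𝒪[X]) : Prop where
  degree : F.natDegree = d
  resultant : value (Polynomial.resultant F (derivative F)) ≠ 0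
  factor : ∃ u : 𝒪, IsUnit u ∧ F = C u * ∏ i, (C (dy (W.fn i)) * X + C (dx (W.fn i)))

/-! ### The differential system of a web

Here `d = n + 3`. The unknown is the tuple of coefficients of a polynomial
`r = c₀ + c₁ p + ⋯ + cₙ pⁿ` (so `c_l = b_{d-l}`), and the equations are indexed by the
powers `p^e`, `0 ≤ e ≤ n + 1`. -/

/-- The restriction of the form `r ⬝ (dy - p dx) / ∂_p F` on the surface `F(x, y, p) = 0` to the
sheet `p = p(x, y)`, where `p ∈ 𝒪` is a root of `F`, pulled back to `(ℂ², 0)`. The surface is the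
disjoint union of such sheets. -/
def sheetForm {n : ℕ} (F : 𝒪[X]) (c : Fin (n + 1) → 𝒪) (p : 𝒪) : OneForm :=
  OneForm.mulFun ((∑ l, c l * p ^ (l : ℕ)) * Ring.inverse ((derivative F).eval p)) ⟨-p, 1⟩

/-- The first order linear differential operator with matrix `A` of lower order terms, whose
`e`-th component is `∂_x(c_e) + ∂_y(c_{e-1}) + ∑_l A_{e,l} c_l`, where `c_{-1} = c_{n+1} = 0`. -/
def systemOp {n : ℕ} (A : Matrix (Fin (n + 2)) (Fin (n + 1)) 𝒪) (c : Fin (n + 1) → 𝒪) :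
    Fin (n + 2) → 𝒪 := fun e =>
  (Fin.snoc (fun l => dx (c l)) 0 : Fin (n + 2) → 𝒪) e +
    (Fin.cons 0 (fun l => dy (c l)) : Fin (n + 2) → 𝒪) e + ∑ l, A e l * c l

/-- The system with matrix `A` is the one obtained from `dω = 0` by polynomial identification:
on the surface `F = 0`, for `ω = r ⬝ (dy - p dx) / ∂_p F`, one has
`∂_p F ⬝ dω = (∑_e (systemOp A c)_e p^e) dx ∧ dy`. -/
def IsSystemMatrix {n : ℕ} (F : 𝒪[X]) (A : Matrix (Fin (n + 2)) (Fin (n + 1)) 𝒪) : Prop :=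
  ∀ (c : Fin (n + 1) → 𝒪) (p : 𝒪), F.IsRoot p →
    (derivative F).eval p * (sheetForm F c p).extDeriv = ∑ e, systemOp A c e * p ^ (e : ℕ)

/-! ### Jets, prolongations and the Spencer operator -/

/-- The multi-indices of order at most `k`. -/
abbrev JetIndex (k : ℕ) : Type := {α : ℕ × ℕ // α.1 + α.2 ≤ k}

/-- Sections of the bundle `J_k(𝒪^m)` of jets of order `k`; the component of index `(i, j)`
stands for `∂_x^i ∂_y^j`. -/
abbrev Jet (k m : ℕ) : Type := JetIndex k → Fin m → 𝒪

/-- The index `(i, j)` of order at most `k`, seen at order `k + 1`. -/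
def JetIndex.lift {k : ℕ} (α : JetIndex k) : JetIndex (k + 1) := ⟨α.1, by have := α.2; omega⟩

/-- `(i, j) ↦ (i + 1, j)`. -/
def JetIndex.sx {k : ℕ} (α : JetIndex k) : JetIndex (k + 1) :=
  ⟨(α.1.1 + 1, α.1.2), by have := α.2; dsimp only; omega⟩

/-- `(i, j) ↦ (i, j + 1)`. -/
def JetIndex.sy {k : ℕ} (α : JetIndex k) : JetIndex (k + 1) :=
  ⟨(α.1.1, α.1.2 + 1), by have := α.2; dsimp only; omega⟩

/-- The index `(i', j')` below `(i, j)`, at order `k + 1`. -/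
def JetIndex.below {k : ℕ} (α : JetIndex k) (i : Fin (α.1.1 + 1)) (j : Fin (α.1.2 + 1)) :
    JetIndex (k + 1) :=
  ⟨((i : ℕ), (j : ℕ)), by have := α.2; have := i.2; have := j.2; dsimp only; omega⟩

/-- The `k`-th prolongation `p_k : J_{k+1}(𝒪^{n+1}) → J_k(𝒪^{n+2})` of `systemOp A`, given by the
Leibniz rule: it is the `𝒪`-linear map that sends the jet of `c` to the jet of `systemOp A c`. -/
def prolongation {n : ℕ} (A : Matrix (Fin (n + 2)) (Fin (n + 1)) 𝒪) (k : ℕ) :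
    Jet (k + 1) (n + 1) →ₗ[𝒪] Jet k (n + 2) where
  toFun u α e :=
    (Fin.snoc (u α.sx) 0 : Fin (n + 2) → 𝒪) e + (Fin.cons 0 (u α.sy) : Fin (n + 2) → 𝒪) e +
      ∑ l, ∑ i : Fin (α.1.1 + 1), ∑ j : Fin (α.1.2 + 1),
        ((α.1.1.choose i * α.1.2.choose j : ℕ) : 𝒪) *
          dx^[α.1.1 - i] (dy^[α.1.2 - j] (A e l)) * u (α.below i j) l
  map_add' u v := by
    funext α e
    have h1 : (Fin.snoc ((u + v) α.sx) 0 : Fin (n + 2) → 𝒪) e =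
        (Fin.snoc (u α.sx) 0 : Fin (n + 2) → 𝒪) e +
          (Fin.snoc (v α.sx) 0 : Fin (n + 2) → 𝒪) e := by
      refine Fin.lastCases ?_ (fun l => ?_) e <;> simp
    have h2 : (Fin.cons 0 ((u + v) α.sy) : Fin (n + 2) → 𝒪) e =
        (Fin.cons 0 (u α.sy) : Fin (n + 2) → 𝒪) e +
          (Fin.cons 0 (v α.sy) : Fin (n + 2) → 𝒪) e := by
      refine Fin.cases ?_ (fun l => ?_) e <;> simp
    rw [h1, h2]
    simp only [Pi.add_apply, mul_add, Finset.sum_add_distrib]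
    ring
  map_smul' a u := by
    funext α e
    have h1 : (Fin.snoc ((a • u) α.sx) 0 : Fin (n + 2) → 𝒪) e =
        a * (Fin.snoc (u α.sx) 0 : Fin (n + 2) → 𝒪) e := by
      refine Fin.lastCases ?_ (fun l => ?_) e <;> simp
    have h2 : (Fin.cons 0 ((a • u) α.sy) : Fin (n + 2) → 𝒪) e =
        a * (Fin.cons 0 (u α.sy) : Fin (n + 2) → 𝒪) e := by
      refine Fin.cases ?_ (fun l => ?_) e <;> simp
    rw [h1, h2]
    simp only [Pi.smul_apply, smul_eq_mul, mul_add, Finset.mul_sum, RingHom.id_apply]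
    congr 1
    refine Finset.sum_congr rfl fun _ _ => Finset.sum_congr rfl fun _ _ =>
      Finset.sum_congr rfl fun _ _ => ?_
    ring

/-- The bundle `E = ker p_{d-3} ⊆ J_{d-2}(𝒪^{d-2})`, where `d = n + 3`. -/
abbrev jetBundle {n : ℕ} (A : Matrix (Fin (n + 2)) (Fin (n + 1)) 𝒪) :
    Submodule 𝒪 (Jet (n + 1) (n + 1)) :=
  LinearMap.ker (prolongation A n)

/-- The projection `J_{k+1} → J_k`. -/
def truncate {k m : ℕ} (u : Jet (k + 1) m) : Jet k m := fun α => u α.lift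

/-- The `dx` component of the Spencer operator `J_{k+1} → Ω¹ ⊗ J_k`. -/
def spencerX {k m : ℕ} (u : Jet (k + 1) m) : Jet k m := fun α l => dx (u α.lift l) - u α.sx l

/-- The `dy` component of the Spencer operator `J_{k+1} → Ω¹ ⊗ J_k`. -/
def spencerY {k m : ℕ} (u : Jet (k + 1) m) : Jet k m := fun α l => dy (u α.lift l) - u α.sy l

/-! ### Connections -/

/-- A connection `∇ s = dx ⊗ nx s + dy ⊗ ny s` on an `𝒪`-module. -/
@[ext]
structure Connection (M : Type) [AddCommGroup M] [Module 𝒪 M] where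
  nx : M →+ M
  ny : M →+ M
  leibniz_x : ∀ (f : 𝒪) (s : M), nx (f • s) = dx f • s + f • nx s
  leibniz_y : ∀ (f : 𝒪) (s : M), ny (f • s) = dy f • s + f • ny s

namespace Connection

variable {M N : Type} [AddCommGroup M] [Module 𝒪 M] [AddCommGroup N] [Module 𝒪 N]

/-- The curvature `∇ ∘ ∇ = [nx, ny] dx ∧ dy`, as the `𝒪`-linear coefficient on `dx ∧ dy`. -/
def curvature (D : Connection M) : M →ₗ[𝒪] M where
  toFun s := D.nx (D.ny s) - D.ny (D.nx s)
  map_add' s t := by simp only [map_add]; abel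
  map_smul' f s := by
    simp only [D.leibniz_x, D.leibniz_y, map_add, smul_sub, RingHom.id_apply, dx_dy_comm]
    abel

/-- `D'` is the connection induced by `D` on the exterior power of degree `r`. -/
def IsExteriorPower (D : Connection M) (r : ℕ) (D' : Connection (⋀[𝒪]^r M)) : Prop :=
  ∀ s : Fin r → M,
    D'.nx (exteriorPower.ιMulti 𝒪 r s) =
      ∑ i, exteriorPower.ιMulti 𝒪 r (Function.update s i (D.nx (s i))) ∧
    D'.ny (exteriorPower.ιMulti 𝒪 r s) =
      ∑ i, exteriorPower.ιMulti 𝒪 r (Function.update s i (D.ny (s i)))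

/-- `D'` is the tensor product of the connections `D i`. -/
def IsTensorProduct {ι : Type} [Fintype ι] [DecidableEq ι] {L : ι → Type}
    [∀ i, AddCommGroup (L i)] [∀ i, Module 𝒪 (L i)] (D : ∀ i, Connection (L i))
    (D' : Connection (⨂[𝒪] i, L i)) : Prop :=
  ∀ s : ∀ i, L i,
    D'.nx (PiTensorProduct.tprod 𝒪 s) =
      ∑ i, PiTensorProduct.tprod 𝒪 (Function.update s i ((D i).nx (s i))) ∧
    D'.ny (PiTensorProduct.tprod 𝒪 s) =
      ∑ i, PiTensorProduct.tprod 𝒪 (Function.update s i ((D i).ny (s i)))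

/-- Isomorphism of modules with connection. -/
def Isomorphic (D : Connection M) (D' : Connection N) : Prop :=
  ∃ Φ : M ≃ₗ[𝒪] N, ∀ s, Φ (D.nx s) = D'.nx (Φ s) ∧ Φ (D.ny s) = D'.ny (Φ s)

end Connection

/-- The connection `(E, ∇)` associated to `F`, a polynomial of degree `n + 3` in `p`:
`E` is the jet bundle of the system of `F`, and `∇` is the Spencer operator followed by the inverse
of the projection of `E` to jets of one order less. -/
@[ext]
structure AssociatedConnection (n : ℕ) (F : 𝒪[X]) where
  matrix : Matrix (Fin (n + 2)) (Fin (n + 1)) 𝒪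
  isSystemMatrix : IsSystemMatrix F matrix
  nabla : Connection (jetBundle matrix)
  truncate_nx : ∀ s, truncate (nabla.nx s : Jet (n + 1) (n + 1)) = spencerX s
  truncate_ny : ∀ s, truncate (nabla.ny s : Jet (n + 1) (n + 1)) = spencerY s

/-- The underlying bundle `E`. -/
abbrev AssociatedConnection.E {n : ℕ} {F : 𝒪[X]} (C : AssociatedConnection n F) : Type :=
  jetBundle C.matrix

end WebGeometry

end

open WebGeometry

/-! Write d = n + 3. On the sheet p = p_i a closed form ω is d(Φ_i ∘ F_i) with Φ_i a function of one
variable, and the Lagrange identities ∑ p_i^b / ∂_pF(p_i) = 0 for b ≤ d - 2 say that the forms on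
the sheets add up to zero. Hence the system ρ = 0 amounts to the relation d(∑ Φ_i ∘ F_i) = 0, and
sections of E can be described by formal values of the Φ_i^{(m)} ∘ F_i instead of jets of the b_j.

Let G (`Ambient`) be the free module of all values of orders 1 ≤ m ≤ n + 1, of rank d(d - 2). It
carries the operator dΦ_i^{(m)} - Φ_i^{(m+1)} dF_i, where the missing values of order n + 2 are
fixed by requiring that all n + 3 derivatives of order n + 2 of ∑ Φ_i ∘ F_i vanish. This is a square
Vandermonde system in the ratios ∂_xF_i / ∂_yF_i, whose differences are units. Sending values to the
derivatives of orders 1 to n + 1 of the sum gives an exact sequence 0 → E → G → J → 0 in which both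
maps commute with the connections (`Web.toAmbient_nabla`, `Web.toJet_nx`,
`Web.mem_range_toAmbient`). It yields the rank. As the connection of J has trace zero in the
standard basis, it also shows that the trace form of E equals that of G up to a logarithmic
differential (`exists_unit_trace_exact`).

The trace of G comes only from the coefficient of Φ_i^{(n+1)} in the solved value of Φ_i^{(n+2)}.
Put X_j = ∂_x - (∂_xF_j / ∂_yF_j) ∂_y, which kills F_j, and apply to the sum the product of the X_j,
j ≠ i, with coefficients frozen. The top-order terms of the other F_j disappear, and the first two
orders in Φ_i give, after division, the sum over pairs {k, l} of Hess F_i(X_k, X_l) / (X_kF_i ·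
X_lF_i) (`two_mul_frozenOp_subsymbol`, `Web.two_mul_topPart_single`). Each term involves only the
foliations i, k, l. The trace form is therefore a sum over triples (`Web.sum_traceCoeff`), and the
term of a triple is the form given by the same computation for d = 3. That form satisfies the
structure equations of Blaschke (`Web.structureForm_wedge`).

Thus the trace form of E and the sum of the trace forms of the 3-webs differ by a logarithmic
differential. Taking exterior derivatives gives the trace formula; the unit whose logarithmic
differential occurs gives the isomorphism of line bundles. -/

noncomputable section

namespace WebGeometry

/-! ### The local ring of germs -/

/-- The value at the origin, as a ring homomorphism. -/
def valueHom : 𝒪 →+* ℂ where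
  toFun := value
  map_one' := rfl
  map_zero' := rfl
  map_mul' := by
    rintro ⟨_, f, hf, rfl⟩ ⟨_, g, hg, rfl⟩
    rfl
  map_add' := by
    rintro ⟨_, f, hf, rfl⟩ ⟨_, g, hg, rfl⟩
    rfl

theorem isUnit_iff_value_ne_zero (φ : 𝒪) : IsUnit φ ↔ value φ ≠ 0 := by
  constructor
  · intro h
    exact (h.map valueHom).ne_zero
  · obtain ⟨_, f, hf, rfl⟩ := φ
    intro h
    have h0 : f 0 ≠ 0 := h
    refine IsUnit.of_mul_eq_one ⟨_, fun z => (f z)⁻¹, hf.inv h0, rfl⟩ ?_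
    apply Subtype.ext
    change (((fun z => f z * (f z)⁻¹) : ℂ × ℂ → ℂ) : Germ (𝓝 (0 : ℂ × ℂ)) ℂ)
      = ((fun _ => (1 : ℂ)) : ℂ × ℂ → ℂ)
    refine Germ.coe_eq.2 ?_
    filter_upwards [hf.continuousAt.eventually_ne h0] with z hz
    exact mul_inv_cancel₀ hz

instance : Nontrivial 𝒪 := valueHom.domain_nontrivial

instance : IsLocalRing 𝒪 := by
  refine IsLocalRing.of_nonunits_add fun a b ha hb => ?_
  simp only [mem_nonunits_iff, isUnit_iff_value_ne_zero, not_not] at *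
  exact ((valueHom.map_add a b).trans (congrArg₂ (· + ·) ha hb)).trans (add_zero 0)

theorem isUnit_natCast {k : ℕ} (hk : k ≠ 0) : IsUnit (k : 𝒪) := by
  rw [isUnit_iff_value_ne_zero]
  have : value (k : 𝒪) = (k : ℂ) := map_natCast valueHom k
  rw [this]
  exact_mod_cast hk

end WebGeometry

/-! ### Traces of connection forms -/

section Trace

open Module

variable {R : Type*} [CommRing R] {M : Type*} [AddCommGroup M] [Module R M]
  {ι : Type*} [Fintype ι]

/-- The trace of the matrix of an additive endomorphism on the vectors of a basis. -/
def basisTrace (b : Basis ι R M) (N : M →+ M) : R := ∑ i, b.repr (N (b i)) i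

theorem basisTrace_reindex {κ : Type*} [Fintype κ] (b : Basis ι R M) (e : ι ≃ κ)
    (N : M →+ M) : basisTrace (b.reindex e) N = basisTrace b N := by
  unfold basisTrace
  rw [← e.sum_comp]
  simp

variable [DecidableEq ι]

/-- Isolates the slot `k`, so that additivity and the Leibniz rule in that slot can be read off when
the defect below is shown to be multilinear. -/
theorem sum_det_update_update (b : Basis ι R M) (N : M →+ M) (v : ι → M) (k : ι) (z : M) :
    ∑ i, b.det (Function.update (Function.update v k z) i (N (Function.update v k z i))) =
      b.det (Function.update v k (N z)) +
        ∑ i ∈ Finset.univ.erase k, b.det (Function.update (Function.update v i (N (v i))) k z) := by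
  rw [← Finset.add_sum_erase _ _ (Finset.mem_univ k)]
  congr 1
  · simp
  · refine Finset.sum_congr rfl fun i hi => ?_
    have hik := Finset.ne_of_mem_erase hi
    rw [Function.update_of_ne hik, Function.update_comm hik]

/-- The failure of the Leibniz rule for `det`, when `N` obeys the Leibniz rule for `δ`. -/
def leibnizDefect (b : Basis ι R M) (δ : Derivation ℤ R R) (N : M →+ M)
    (hN : ∀ (f : R) (s : M), N (f • s) = δ f • s + f • N s) : M [⋀^ι]→ₗ[R] R where
  toMultilinearMap := MultilinearMap.mk'
    (fun v => δ (b.det v) - ∑ i, b.det (Function.update v i (N (v i))))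
    (fun v k x y => by
      simp only [sum_det_update_update, AlternatingMap.map_update_add, map_add,
        Finset.sum_add_distrib]
      ring)
    (fun v k c x => by
      simp only [sum_det_update_update, AlternatingMap.map_update_add,
        AlternatingMap.map_update_smul, hN, smul_eq_mul, Derivation.leibniz]
      simp only [← Finset.mul_sum]
      ring)
  map_eq_zero_of_eq' := by
    intro v i j hv hij
    change δ (b.det v) - ∑ i, b.det (Function.update v i (N (v i))) = 0
    rw [b.det.map_eq_zero_of_eq v hv hij, map_zero, zero_sub, neg_eq_zero,
      ← Finset.add_sum_erase _ _ (Finset.mem_univ i),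
      ← Finset.add_sum_erase _ _ (Finset.mem_erase.2 ⟨hij.symm, Finset.mem_univ j⟩), ← add_assoc]
    -- The terms of index `i` and `j` differ by a transposition and cancel; every other term keeps
    -- two equal arguments.
    have h1 : Function.update v j (N (v j)) = Function.update v i (N (v i)) ∘ Equiv.swap i j := by
      funext k
      rcases eq_or_ne k i with rfl | hki
      · simp [hij, hij.symm, hv]
      rcases eq_or_ne k j with rfl | hkj
      · simp [hv]
      · simp [Equiv.swap_apply_of_ne_of_ne hki hkj, hki, hkj]
    rw [h1, b.det.map_swap _ hij, add_neg_cancel, zero_add]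
    refine Finset.sum_eq_zero fun k hk => ?_
    simp only [Finset.mem_erase, Finset.mem_univ, and_true, ne_eq] at hk
    refine b.det.map_eq_zero_of_eq _ (i := i) (j := j) ?_ hij
    rw [Function.update_of_ne (Ne.symm hk.2), Function.update_of_ne (Ne.symm hk.1), hv]

theorem det_update_basis (b : Basis ι R M) (i : ι) (x : M) :
    b.det (Function.update b i x) = b.repr x i := by
  rw [Basis.det_apply, b.toMatrix_update, Basis.toMatrix_self, ← Matrix.cramer_apply]
  simp [Matrix.cramer_one]

/-- The terms in which `δ` hits a scalar cancel in the Leibniz defect, so the defect is an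
alternating form of top degree, hence a multiple of `b.det`. Its value on `b` is minus the trace. -/
theorem deriv_det (b : Basis ι R M) (δ : Derivation ℤ R R) (N : M →+ M)
    (hN : ∀ (f : R) (s : M), N (f • s) = δ f • s + f • N s) (v : ι → M) :
    δ (b.det v) + basisTrace b N * b.det v = ∑ i, b.det (Function.update v i (N (v i))) := by
  have h := congrArg (fun f => f v) ((leibnizDefect b δ N hN).eq_smul_basis_det b)
  have hb : leibnizDefect b δ N hN b = - basisTrace b N := by
    change δ (b.det b) - ∑ i, b.det (Function.update b i (N (b i))) = _
    simp [det_update_basis, basisTrace, Basis.det_self]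
  simp only [AlternatingMap.smul_apply, hb, smul_eq_mul] at h
  change δ (b.det v) - ∑ i, b.det (Function.update v i (N (v i))) = _ at h
  linear_combination h

theorem sum_det_update_basis (b b' : Basis ι R M) (N : M →+ M) :
    ∑ i, b.det (Function.update b' i (N (b' i))) = basisTrace b' N * b.det b' := by
  have h := b.det.eq_smul_basis_det b'
  have h2 : ∀ i, b.det (Function.update b' i (N (b' i))) = b.det b' * b'.repr (N (b' i)) i := by
    intro i
    conv_lhs => rw [h]
    rw [AlternatingMap.smul_apply, det_update_basis, smul_eq_mul]
  simp only [h2, ← Finset.mul_sum, basisTrace]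
  ring

/-- Change of basis: the trace of a connection form changes by a logarithmic derivative. -/
theorem basisTrace_change (b b' : Basis ι R M) (δ : Derivation ℤ R R) (N : M →+ M)
    (hN : ∀ (f : R) (s : M), N (f • s) = δ f • s + f • N s) :
    basisTrace b' N * b.det b' = δ (b.det b') + basisTrace b N * b.det b' := by
  rw [← sum_det_update_basis, deriv_det b δ N hN]

end Trace

namespace WebGeometry

/-! ### Traces, determinants and tensor products of connections -/

open Module

namespace Connection

variable {M N : Type} [AddCommGroup M] [Module 𝒪 M] [AddCommGroup N] [Module 𝒪 N]

/-- The curvature matrix is dθ + θ ∧ θ, and the second term is a commutator of matrices, of trace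
zero. -/
theorem trace_curvature {ι : Type*} [Fintype ι] [DecidableEq ι] (D : Connection M)
    (b : Basis ι 𝒪 M) :
    LinearMap.trace 𝒪 M D.curvature = dx (basisTrace b D.ny) - dy (basisTrace b D.nx) := by
  have expand : ∀ (δ : Derivation ℤ 𝒪 𝒪) (P : M →+ M)
      (_ : ∀ (f : 𝒪) (s : M), P (f • s) = δ f • s + f • P s) (x : M) (i : ι),
      b.repr (P x) i = δ (b.repr x i) + ∑ k, b.repr x k * b.repr (P (b k)) i := by
    intro δ P hP x i
    conv_lhs => rw [← b.sum_repr x]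
    simp only [map_sum, hP, Finset.sum_add_distrib, map_add, map_smul, Finsupp.coe_add,
      Finsupp.coe_finsetSum, Pi.add_apply, Finset.sum_apply, Finsupp.smul_apply, smul_eq_mul,
      Basis.repr_self]
    congr 1
    simp [Finsupp.single_apply]
  rw [LinearMap.trace_eq_matrix_trace 𝒪 b, Matrix.trace]
  simp only [Matrix.diag, LinearMap.toMatrix_apply]
  have h : ∀ i, b.repr (D.curvature (b i)) i =
      (dx (b.repr (D.ny (b i)) i) - dy (b.repr (D.nx (b i)) i)) +
      ((∑ k, b.repr (D.ny (b i)) k * b.repr (D.nx (b k)) i) -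
        ∑ k, b.repr (D.nx (b i)) k * b.repr (D.ny (b k)) i) := by
    intro i
    change b.repr (D.nx (D.ny (b i)) - D.ny (D.nx (b i))) i = _
    rw [map_sub, Finsupp.sub_apply, expand dx D.nx D.leibniz_x (D.ny (b i)),
      expand dy D.ny D.leibniz_y (D.nx (b i))]
    ring
  simp only [h, Finset.sum_add_distrib, Finset.sum_sub_distrib, basisTrace, map_sum]
  -- Exchanging the two summation indices matches the two halves of the commutator.
  rw [Finset.sum_comm (f := fun i k => b.repr (D.ny (b i)) k * b.repr (D.nx (b k)) i)]
  simp only [mul_comm, sub_self, add_zero]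

/-- Transport of a connection along an isomorphism. -/
def transport (e : M ≃ₗ[𝒪] N) (D : Connection M) : Connection N where
  nx := e.toLinearMap.toAddMonoidHom.comp (D.nx.comp e.symm.toLinearMap.toAddMonoidHom)
  ny := e.toLinearMap.toAddMonoidHom.comp (D.ny.comp e.symm.toLinearMap.toAddMonoidHom)
  leibniz_x f s := by simp [D.leibniz_x]
  leibniz_y f s := by simp [D.leibniz_y]

theorem transport_nx (e : M ≃ₗ[𝒪] N) (D : Connection M) (s : N) :
    (D.transport e).nx s = e (D.nx (e.symm s)) := rfl

theorem transport_ny (e : M ≃ₗ[𝒪] N) (D : Connection M) (s : N) :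
    (D.transport e).ny s = e (D.ny (e.symm s)) := rfl

/-- The connection `d + θ` on the trivial line bundle. -/
def line (θ : OneForm) : Connection 𝒪 where
  nx := dx.toLinearMap.toAddMonoidHom + AddMonoidHom.mulLeft θ.cx
  ny := dy.toLinearMap.toAddMonoidHom + AddMonoidHom.mulLeft θ.cy
  leibniz_x f s := by simp; ring
  leibniz_y f s := by simp; ring

theorem line_nx (θ : OneForm) (f : 𝒪) : (line θ).nx f = dx f + θ.cx * f := rfl

theorem line_ny (θ : OneForm) (f : 𝒪) : (line θ).ny f = dy f + θ.cy * f := rfl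

/-- The form of the trace of a connection in a basis. -/
def traceForm {ι : Type*} [Fintype ι] (D : Connection M) (b : Basis ι 𝒪 M) : OneForm :=
  ⟨basisTrace b D.nx, basisTrace b D.ny⟩

/-- The top exterior power of a free module is trivialised by a basis. -/
def topExteriorEquiv {r : ℕ} (b : Basis (Fin r) 𝒪 M) : (⋀[𝒪]^r M) ≃ₗ[𝒪] 𝒪 :=
  LinearEquiv.ofLinearMap (exteriorPower.alternatingMapLinearEquiv b.det)
    (LinearMap.toSpanSingleton 𝒪 _ (exteriorPower.ιMulti 𝒪 r b))
    (by ext; simp [Basis.det_self])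
    (by
      apply exteriorPower.linearMap_ext
      refine Basis.ext_alternating b fun v hv => ?_
      let σ : Equiv.Perm (Fin r) := Equiv.ofBijective v (Finite.injective_iff_bijective.1 hv)
      have : (fun i => b (v i)) = b ∘ σ := rfl
      rw [this]
      simp [AlternatingMap.map_perm, Basis.det_self])

theorem topExteriorEquiv_ιMulti {r : ℕ} (b : Basis (Fin r) 𝒪 M) (s : Fin r → M) :
    topExteriorEquiv b (exteriorPower.ιMulti 𝒪 r s) = b.det s := by
  simp [topExteriorEquiv]

/-- Under the trivialisation by `b.det`, the derivation rule on decomposable vectors is exactly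
`deriv_det`. -/
theorem isExteriorPower_transport_line {r : ℕ} (D : Connection M) (b : Basis (Fin r) 𝒪 M) :
    D.IsExteriorPower r ((line (D.traceForm b)).transport (topExteriorEquiv b).symm) := by
  intro s
  rw [transport_nx, transport_ny, LinearEquiv.symm_symm]
  constructor
  · rw [LinearEquiv.symm_apply_eq, map_sum, line_nx]
    simp only [topExteriorEquiv_ιMulti]
    exact deriv_det b dx D.nx D.leibniz_x s
  · rw [LinearEquiv.symm_apply_eq, map_sum, line_ny]
    simp only [topExteriorEquiv_ιMulti]
    exact deriv_det b dy D.ny D.leibniz_y s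

/-- A basis with one element, as an isomorphism with `𝒪`. -/
def basisEquiv (b : Basis (Fin 1) 𝒪 M) : M ≃ₗ[𝒪] 𝒪 := b.equivFun.trans (LinearEquiv.funUnique _ _ _)

theorem basisEquiv_apply (b : Basis (Fin 1) 𝒪 M) (x : M) : basisEquiv b x = b.repr x 0 := rfl

theorem basisEquiv_leibniz (b : Basis (Fin 1) 𝒪 M) (δ : Derivation ℤ 𝒪 𝒪) (P : M →+ M)
    (hP : ∀ (f : 𝒪) (s : M), P (f • s) = δ f • s + f • P s) (x : M) :
    basisEquiv b (P x) = δ (basisEquiv b x) + basisTrace b P * basisEquiv b x := by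
  simp only [basisEquiv_apply, basisTrace, Fin.sum_univ_one]
  conv_lhs => rw [← b.sum_repr x, Fin.sum_univ_one, hP]
  simp [mul_comm]

/-! ### Tensor products of line bundles with connection -/

section Tensor

theorem derivation_prod {κ : Type*} [DecidableEq κ] (δ : Derivation ℤ 𝒪 𝒪) (s : Finset κ) (f : κ → 𝒪) :
    δ (∏ i ∈ s, f i) = ∑ i ∈ s, (∏ j ∈ s.erase i, f j) * δ (f i) := by
  induction s using Finset.induction_on with
  | empty => simp
  | insert a s ha ih =>
    rw [Finset.prod_insert ha, Derivation.leibniz, Finset.sum_insert ha, Finset.erase_insert ha, ih,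
      smul_eq_mul, smul_eq_mul, Finset.mul_sum, add_comm]
    congr 1
    refine Finset.sum_congr rfl fun i hi => ?_
    have hai : a ≠ i := fun h => ha (h ▸ hi)
    rw [Finset.erase_insert_of_ne hai, Finset.prod_insert (fun h => ha (Finset.mem_of_mem_erase h))]
    ring

variable {κ : Type} [Fintype κ] {L : κ → Type}
  [∀ i, AddCommGroup (L i)] [∀ i, Module 𝒪 (L i)]

/-- A tensor product of trivialised line bundles is trivialised. -/
def tensorEquiv (b : ∀ i, Basis (Fin 1) 𝒪 (L i)) : (⨂[𝒪] i, L i) ≃ₗ[𝒪] 𝒪 :=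
  (PiTensorProduct.congr fun i => basisEquiv (b i)).trans
    (PiTensorProduct.constantBaseRingEquiv κ 𝒪).toLinearEquiv

theorem tensorEquiv_tprod (b : ∀ i, Basis (Fin 1) 𝒪 (L i)) (s : ∀ i, L i) :
    tensorEquiv b (PiTensorProduct.tprod 𝒪 s) = ∏ i, basisEquiv (b i) (s i) := by
  simp [tensorEquiv]

variable [DecidableEq κ]

theorem tensorEquiv_leibniz (b : ∀ i, Basis (Fin 1) 𝒪 (L i)) (δ : Derivation ℤ 𝒪 𝒪)
    (P : ∀ i, L i →+ L i)
    (hP : ∀ i (f : 𝒪) (s : L i), P i (f • s) = δ f • s + f • P i s) (s : ∀ i, L i) :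
    δ (∏ i, basisEquiv (b i) (s i)) +
      (∑ i, basisTrace (b i) (P i)) * ∏ i, basisEquiv (b i) (s i) =
    ∑ i, tensorEquiv b (PiTensorProduct.tprod 𝒪 (Function.update s i (P i (s i)))) := by
  rw [derivation_prod, Finset.sum_mul, ← Finset.sum_add_distrib]
  refine Finset.sum_congr rfl fun i _ => ?_
  rw [tensorEquiv_tprod, ← Finset.mul_prod_erase _ _ (Finset.mem_univ i),
    ← Finset.mul_prod_erase _ _ (Finset.mem_univ i)]
  have : ∏ x ∈ Finset.univ.erase i, basisEquiv (b x) (Function.update s i (P i (s i)) x) =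
      ∏ x ∈ Finset.univ.erase i, basisEquiv (b x) (s x) :=
    Finset.prod_congr rfl fun x hx => by rw [Function.update_of_ne (Finset.ne_of_mem_erase hx)]
  rw [this, Function.update_self, basisEquiv_leibniz (b i) δ (P i) (hP i)]
  ring

theorem isTensorProduct_transport_line (D : ∀ i, Connection (L i))
    (b : ∀ i, Basis (Fin 1) 𝒪 (L i)) :
    IsTensorProduct D ((line ⟨∑ i, basisTrace (b i) (D i).nx, ∑ i, basisTrace (b i) (D i).ny⟩).transport
      (tensorEquiv b).symm) := by
  intro s
  rw [transport_nx, transport_ny, LinearEquiv.symm_symm]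
  constructor
  · rw [LinearEquiv.symm_apply_eq, map_sum, line_nx, tensorEquiv_tprod]
    exact tensorEquiv_leibniz b dx (fun i => (D i).nx) (fun i => (D i).leibniz_x) s
  · rw [LinearEquiv.symm_apply_eq, map_sum, line_ny, tensorEquiv_tprod]
    exact tensorEquiv_leibniz b dy (fun i => (D i).ny) (fun i => (D i).leibniz_y) s

end Tensor

/-- Multiplication by `g` is the gauge transformation: the hypotheses say θ = dg / g + θ', which is
what makes it commute with the two connections. -/
theorem isomorphic_transport_line {θ θ' : OneForm} (e : M ≃ₗ[𝒪] 𝒪) (e' : N ≃ₗ[𝒪] 𝒪) (g : 𝒪ˣ)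
    (hx : θ.cx * g = dx (g : 𝒪) + θ'.cx * g) (hy : θ.cy * g = dy (g : 𝒪) + θ'.cy * g) :
    ((line θ).transport e.symm).Isomorphic ((line θ').transport e'.symm) := by
  refine ⟨(e.trans (LinearEquiv.smulOfUnit g)).trans e'.symm, fun s => ⟨?_, ?_⟩⟩
  · simp only [transport_nx, line_nx, LinearEquiv.symm_symm, LinearEquiv.trans_apply,
      LinearEquiv.apply_symm_apply]
    congr 1
    change (g : 𝒪) * (dx (e s) + θ.cx * e s) = dx ((g : 𝒪) * e s) + θ'.cx * ((g : 𝒪) * e s)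
    rw [Derivation.leibniz, smul_eq_mul, smul_eq_mul]
    linear_combination e s * hx
  · simp only [transport_ny, line_ny, LinearEquiv.symm_symm, LinearEquiv.trans_apply,
      LinearEquiv.apply_symm_apply]
    congr 1
    change (g : 𝒪) * (dy (e s) + θ.cy * e s) = dy ((g : 𝒪) * e s) + θ'.cy * ((g : 𝒪) * e s)
    rw [Derivation.leibniz, smul_eq_mul, smul_eq_mul]
    linear_combination e s * hy

end Connection

/-! ### Exact sequences of connections -/

section Exact

variable {E G J : Type} [AddCommGroup E] [Module 𝒪 E] [AddCommGroup G] [Module 𝒪 G]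
  [AddCommGroup J] [Module 𝒪 J] {κ μ : Type}

/-- `J` is free, so the sequence splits. The splitting is only linear; it need not respect any
connection. -/
theorem exists_split_equiv (bJ : Basis μ 𝒪 J) (ι : E →ₗ[𝒪] G) (σ : G →ₗ[𝒪] J)
    (hι : Function.Injective ι) (hσ : Function.Surjective σ)
    (hex : ∀ x, σ x = 0 ↔ x ∈ Set.range ι) :
    ∃ e : (E × J) ≃ₗ[𝒪] G, (∀ x, e (x, 0) = ι x) ∧ ∀ z, σ (e z) = z.2 := by
  have : Module.Projective 𝒪 J := .of_basis bJ
  obtain ⟨s, hs⟩ := Module.projective_lifting_property σ LinearMap.id hσ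
  have hs' : ∀ y, σ (s y) = y := fun y => LinearMap.congr_fun hs y
  have hσι : ∀ x, σ (ι x) = 0 := fun x => (hex _).2 ⟨x, rfl⟩
  have hb : Function.Bijective (ι.coprod s) := by
    constructor
    · rw [injective_iff_map_eq_zero]
      rintro ⟨x, y⟩ h
      rw [LinearMap.coprod_apply] at h
      have hy : y = 0 := by
        have := congrArg σ h
        simpa [hσι, hs'] using this
      subst hy
      have : ι x = 0 := by simpa using h
      rw [hι (this.trans (map_zero ι).symm)]
      rfl
    · intro g
      obtain ⟨x, hx⟩ := (hex (g - s (σ g))).1 (by rw [map_sub, hs', sub_self])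
      exact ⟨(x, σ g), by simp [hx]⟩
  refine ⟨LinearEquiv.ofBijective _ hb, fun x => by simp, fun z => by simp [hσι, hs']⟩

variable [Fintype κ] [Fintype μ]

/-- The kernel is a finite direct summand of a free module, hence projective, and `𝒪` is local. -/
theorem free_of_exact (bG : Basis κ 𝒪 G) (bJ : Basis μ 𝒪 J) (ι : E →ₗ[𝒪] G) (σ : G →ₗ[𝒪] J)
    (hι : Function.Injective ι) (hσ : Function.Surjective σ)
    (hex : ∀ x, σ x = 0 ↔ x ∈ Set.range ι) : Module.Free 𝒪 E ∧ Module.Finite 𝒪 E ∧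
    Module.finrank 𝒪 E + Fintype.card μ = Fintype.card κ := by
  obtain ⟨e, he, he'⟩ := exists_split_equiv bJ ι σ hι hσ hex
  have : Module.Projective 𝒪 G := .of_basis bG
  have : Module.Free 𝒪 J := .of_basis bJ
  have : Module.Finite 𝒪 J := .of_basis bJ
  have : Module.Finite 𝒪 G := .of_basis bG
  have hp : Module.Projective 𝒪 E :=
    .of_split ι ((LinearMap.fst 𝒪 E J).comp e.symm.toLinearMap) (by ext x; simp [← he])
  have hfin : Module.Finite 𝒪 E :=
    .of_surjective ((LinearMap.fst 𝒪 E J).comp e.symm.toLinearMap)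
      fun x => ⟨ι x, by simp [← he]⟩
  have hfree : Module.Free 𝒪 E := Module.free_of_flat_of_isLocalRing
  refine ⟨hfree, hfin, ?_⟩
  rw [← Module.finrank_eq_card_basis bJ, ← Module.finrank_eq_card_basis bG, ← e.finrank_eq,
    Module.finrank_prod]

/-- In a basis adapted to the sequence the connection matrix of `G` is block triangular, with
diagonal blocks those of `E` and `J`. Passing to the given basis of `G` adds the logarithmic
derivative of the determinant of the change of basis. -/
theorem exists_unit_trace_exact [DecidableEq κ]
    (bG : Basis κ 𝒪 G) (bJ : Basis μ 𝒪 J) (ι : E →ₗ[𝒪] G) (σ : G →ₗ[𝒪] J)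
    (hι : Function.Injective ι) (hσ : Function.Surjective σ)
    (hex : ∀ x, σ x = 0 ↔ x ∈ Set.range ι)
    {r : ℕ} (b : Basis (Fin r) 𝒪 E)
    (DE : Connection E) (DG : Connection G) (DJ : Connection J)
    (hιx : ∀ s, ι (DE.nx s) = DG.nx (ι s)) (hιy : ∀ s, ι (DE.ny s) = DG.ny (ι s))
    (hσx : ∀ s, σ (DG.nx s) = DJ.nx (σ s)) (hσy : ∀ s, σ (DG.ny s) = DJ.ny (σ s)) :
    ∃ g : 𝒪ˣ, (basisTrace b DE.nx + basisTrace bJ DJ.nx) * g = dx (g : 𝒪) + basisTrace bG DG.nx * g ∧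
      (basisTrace b DE.ny + basisTrace bJ DJ.ny) * g = dy (g : 𝒪) + basisTrace bG DG.ny * g := by
  obtain ⟨e, he, he'⟩ := exists_split_equiv bJ ι σ hι hσ hex
  -- The failure of the splitting to be horizontal appears only in the off-diagonal block, which the
  -- trace ignores.
  let bC := (b.prod bJ).map e
  have hr : ∀ x i, bC.repr (ι x) (Sum.inl i) = b.repr x i := by
    intro x i
    simp [bC, ← he]
  have hr' : ∀ x j, bC.repr x (Sum.inr j) = bJ.repr (σ x) j := by
    intro x j
    obtain ⟨z, rfl⟩ := e.surjective x
    simp [bC, he']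
  have hC : ∀ i, bC (Sum.inl i) = ι (b i) := by
    intro i
    simp [bC, ← he]
  have hC' : ∀ j, σ (bC (Sum.inr j)) = bJ j := by
    intro j
    simp [bC, he']
  let f : Fin r ⊕ μ ≃ κ := bC.indexEquiv bG
  have key : ∀ (PE : E →+ E) (PG : G →+ G) (PJ : J →+ J), (∀ s, ι (PE s) = PG (ι s)) →
      (∀ s, σ (PG s) = PJ (σ s)) →
      basisTrace (bC.reindex f) PG = basisTrace b PE + basisTrace bJ PJ := by
    intro PE PG PJ h1 h2
    rw [basisTrace_reindex]
    simp only [basisTrace, Fintype.sum_sum_type]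
    congr 1
    · refine Finset.sum_congr rfl fun i _ => ?_
      rw [hC, ← h1, hr]
    · refine Finset.sum_congr rfl fun j _ => ?_
      rw [hr', h2, hC']
  refine ⟨(bG.isUnit_det (bC.reindex f)).unit, ?_, ?_⟩
  · rw [← key _ _ _ hιx hσx, IsUnit.unit_spec]
    exact basisTrace_change bG _ dx DG.nx DG.leibniz_x
  · rw [← key _ _ _ hιy hσy, IsUnit.unit_spec]
    exact basisTrace_change bG _ dy DG.ny DG.leibniz_y

end Exact

end WebGeometry

/-! ### Lagrange interpolation at points whose differences are invertible -/

section Lagrange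

variable {R : Type*} [CommRing R] {d : ℕ} (x : Fin d → R)

/-- The polynomial `∏_{j ≠ i} (X - x j)`. -/
def coNodal (i : Fin d) : R[X] := ∏ j ∈ Finset.univ.erase i, (X - C (x j))

theorem coNodal_monic (i : Fin d) : (coNodal x i).Monic :=
  monic_prod_of_monic _ _ fun _ _ => monic_X_sub_C _

theorem eval_coNodal_self (i : Fin d) :
    (coNodal x i).eval (x i) = ∏ j ∈ Finset.univ.erase i, (x i - x j) := by
  simp [coNodal, eval_prod]

theorem eval_coNodal_of_ne {i k : Fin d} (h : i ≠ k) : (coNodal x k).eval (x i) = 0 := by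
  rw [coNodal, eval_prod]
  exact Finset.prod_eq_zero (Finset.mem_erase.2 ⟨h, Finset.mem_univ i⟩) (by simp)

theorem natDegree_coNodal [Nontrivial R] (i : Fin d) : (coNodal x i).natDegree = d - 1 := by
  rw [coNodal, natDegree_prod_of_monic _ _ fun _ _ => monic_X_sub_C _]
  simp

theorem sum_coeff_coNodal [Nontrivial R] (y : R) (k : Fin d) :
    ∑ a : Fin d, (coNodal x k).coeff a * y ^ (a : ℕ) = (coNodal x k).eval y := by
  rw [eval_eq_sum_range' (n := d), Finset.sum_range]
  rw [natDegree_coNodal]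
  have := k.2
  omega

variable {x}

theorem isUnit_eval_coNodal (hx : ∀ i j, i ≠ j → IsUnit (x i - x j)) (i : Fin d) :
    IsUnit ((coNodal x i).eval (x i)) := by
  rw [eval_coNodal_self, IsUnit.prod_iff]
  exact fun j hj => hx i j (Finset.ne_of_mem_erase hj).symm

/-- The coefficients of the Lagrange basis polynomials form a right inverse of the Vandermonde
matrix, by evaluation at the nodes. Square matrices over a commutative ring then commute with their
one-sided inverses, which gives this dual identity. -/
theorem lagrange_dual [Nontrivial R] (hx : ∀ i j, i ≠ j → IsUnit (x i - x j)) (a b : Fin d) :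
    ∑ i, (coNodal x i).coeff a * Ring.inverse ((coNodal x i).eval (x i)) * x i ^ (b : ℕ) =
      if a = b then 1 else 0 := by
  let V : Matrix (Fin d) (Fin d) R := Matrix.of fun i a => x i ^ (a : ℕ)
  let L : Matrix (Fin d) (Fin d) R := Matrix.of fun a i =>
    (coNodal x i).coeff a * Ring.inverse ((coNodal x i).eval (x i))
  have hVL : V * L = 1 := by
    ext i k
    have h : (V * L) i k =
        (coNodal x k).eval (x i) * Ring.inverse ((coNodal x k).eval (x k)) := by
      rw [← sum_coeff_coNodal, Finset.sum_mul, Matrix.mul_apply]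
      refine Finset.sum_congr rfl fun a _ => ?_
      simp only [V, L, Matrix.of_apply]
      ring
    rw [h]
    rcases eq_or_ne i k with rfl | hik
    · rw [Matrix.one_apply_eq, Ring.mul_inverse_cancel _ (isUnit_eval_coNodal hx i)]
    · rw [Matrix.one_apply_ne hik, eval_coNodal_of_ne x hik, zero_mul]
  have hLV := mul_eq_one_comm.1 hVL
  have := congrFun (congrFun hLV a) b
  rw [Matrix.mul_apply, Matrix.one_apply] at this
  exact this

theorem coeff_coNodal_top [Nontrivial R] {n : ℕ} (x : Fin (n + 1) → R) (i : Fin (n + 1)) :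
    (coNodal x i).coeff n = 1 := by
  have h := (coNodal_monic x i).coeff_natDegree
  rwa [natDegree_coNodal] at h

theorem coeff_coNodal_pred [Nontrivial R] {n : ℕ} (x : Fin (n + 2) → R) (i : Fin (n + 2)) :
    (coNodal x i).coeff n = x i - ∑ j, x j := by
  have h := prod_X_sub_C_coeff_card_pred (Finset.univ.erase i) x (by simp)
  simp only [Finset.card_erase_of_mem (Finset.mem_univ i), Finset.card_univ, Fintype.card_fin] at h
  rw [← Finset.add_sum_erase _ _ (Finset.mem_univ i)]
  have e : n + 2 - 1 - 1 = n := rfl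
  rw [e] at h
  rw [coNodal, h]
  ring

end Lagrange

namespace WebGeometry

/-! ### Iterated covariant derivatives -/

namespace Connection

variable {M : Type} [AddCommGroup M] [Module 𝒪 M]

/-- The derivative of order `(a, b)`. -/
def iter (D : Connection M) (a b : ℕ) (s : M) : M := D.nx^[a] (D.ny^[b] s)

/-- The covariant derivatives commute. -/
def Flat (D : Connection M) : Prop := ∀ s, D.nx (D.ny s) = D.ny (D.nx s)

theorem iter_zero (D : Connection M) (s : M) : D.iter 0 0 s = s := rfl

theorem nx_iter (D : Connection M) (a b : ℕ) (s : M) : D.nx (D.iter a b s) = D.iter (a + 1) b s :=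
  (Function.iterate_succ_apply' _ _ _).symm

theorem ny_iter {D : Connection M} (hD : D.Flat) (a b : ℕ) (s : M) :
    D.ny (D.iter a b s) = D.iter a (b + 1) s := by
  have h : Function.Commute D.ny D.nx := fun s => (hD s).symm
  unfold iter
  rw [(h.iterate_right a).eq, Function.iterate_succ_apply' D.ny]

theorem iter_nx {D : Connection M} (hD : D.Flat) (a b : ℕ) (s : M) :
    D.iter a b (D.nx s) = D.iter (a + 1) b s := by
  have h : Function.Commute D.nx D.ny := fun s => hD s
  unfold iter
  rw [← (h.iterate_right b).eq, Function.iterate_succ_apply]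

theorem iter_ny (D : Connection M) (a b : ℕ) (s : M) :
    D.iter a b (D.ny s) = D.iter a (b + 1) s := by
  unfold iter
  rw [Function.iterate_succ_apply]

theorem iter_add (D : Connection M) (a b : ℕ) (s t : M) :
    D.iter a b (s + t) = D.iter a b s + D.iter a b t := by
  simp only [iter, iterate_map_add]

theorem iter_map_zero (D : Connection M) (a b : ℕ) : D.iter a b 0 = 0 := by
  simp only [iter, iterate_map_zero]

theorem iter_sum (D : Connection M) (a b : ℕ) {ι : Type*} (S : Finset ι) (f : ι → M) :
    D.iter a b (∑ i ∈ S, f i) = ∑ i ∈ S, D.iter a b (f i) := by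
  classical
  induction S using Finset.induction_on with
  | empty => simp [iter_map_zero]
  | insert i S hi ih => rw [Finset.sum_insert hi, Finset.sum_insert hi, iter_add, ih]

theorem iterate_leibniz (δ : Derivation ℤ 𝒪 𝒪) (P : M →+ M)
    (hP : ∀ (f : 𝒪) (s : M), P (f • s) = δ f • s + f • P s) (a : ℕ) (f : 𝒪) (s : M) :
    P^[a] (f • s) = ∑ i : Fin (a + 1), ((a.choose i : ℕ) : 𝒪) • δ^[a - i] f • P^[i] s := by
  have h : P^[a] (f • s) =
      ∑ ij ∈ Finset.HasAntidiagonal.antidiagonal a, a.choose ij.1 • (δ^[ij.2] f • P^[ij.1] s) := by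
    induction a with
    | zero => simp
    | succ a ih =>
      rw [Function.iterate_succ_apply', ih,
        Finset.sum_antidiagonal_choose_succ_nsmul (fun i j => δ^[j] f • P^[i] s),
        ← Finset.sum_add_distrib, map_sum]
      refine Finset.sum_congr rfl fun ij hij => ?_
      have hs : a.choose ij.2 = a.choose ij.1 := by
        rw [← Nat.choose_symm_of_eq_add (Finset.HasAntidiagonal.mem_antidiagonal.1 hij).symm]
      rw [map_nsmul, hP, hs, ← nsmul_add, Function.iterate_succ_apply',
        Function.iterate_succ_apply']
  rw [h, Finset.Nat.sum_antidiagonal_eq_sum_range_succ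
    (fun i j => a.choose i • (δ^[j] f • P^[i] s)), Finset.sum_range]
  simp only [Nat.cast_smul_eq_nsmul]

theorem iter_smul (D : Connection M) (a b : ℕ) (f : 𝒪) (s : M) :
    D.iter a b (f • s) = ∑ i : Fin (a + 1), ∑ j : Fin (b + 1),
      (((a.choose i * b.choose j : ℕ) : 𝒪) * dx^[a - i] (dy^[b - j] f)) • D.iter i j s := by
  have hsum : ∀ (a : ℕ) (m : ℕ) (g : Fin m → M), D.nx^[a] (∑ j, g j) = ∑ j, D.nx^[a] (g j) := by
    intro a m g
    exact iter_sum D a 0 _ g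
  have hnat : ∀ (a k : ℕ) (v : M), D.nx^[a] ((k : 𝒪) • v) = (k : 𝒪) • D.nx^[a] v := by
    intro a k v
    simp only [Nat.cast_smul_eq_nsmul]
    induction a with
    | zero => rfl
    | succ a ih => rw [Function.iterate_succ_apply', Function.iterate_succ_apply', ih, map_nsmul]
  unfold iter
  rw [iterate_leibniz dy D.ny D.leibniz_y, hsum, Finset.sum_comm]
  refine Finset.sum_congr rfl fun j _ => ?_
  rw [hnat, iterate_leibniz dx D.nx D.leibniz_x, Finset.smul_sum]
  refine Finset.sum_congr rfl fun i _ => ?_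
  simp only [smul_smul]
  congr 1
  push_cast
  ring

/-- The operator of the system with matrix `A`, on elements of a module with connection. -/
def system {n : ℕ} (D : Connection M) (A : Matrix (Fin (n + 2)) (Fin (n + 1)) 𝒪)
    (c : Fin (n + 1) → M) : Fin (n + 2) → M := fun e =>
  (Fin.snoc (fun l => D.nx (c l)) 0 : Fin (n + 2) → M) e +
    (Fin.cons 0 (fun l => D.ny (c l)) : Fin (n + 2) → M) e + ∑ l, A e l • c l

/-- The prolongation is the Leibniz expansion of the derivatives of the system, so it may be
computed in any module with commuting derivatives. It is used twice: on universal jets, to see which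
elements a section of E annihilates, and on primitives, to check that a constructed jet lies in E.
-/
theorem prolongation_eq {D : Connection M} (hD : D.Flat) {n : ℕ}
    (A : Matrix (Fin (n + 2)) (Fin (n + 1)) 𝒪) (c : Fin (n + 1) → M) (Λ : M →ₗ[𝒪] 𝒪) {k : ℕ}
    (u : Jet (k + 1) (n + 1)) (hu : ∀ β l, u β l = Λ (D.iter β.1.1 β.1.2 (c l)))
    (α : JetIndex k) (e : Fin (n + 2)) :
    prolongation A k u α e = Λ (D.iter α.1.1 α.1.2 (D.system A c e)) := by
  change (Fin.snoc (u α.sx) 0 : Fin (n + 2) → 𝒪) e +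
    (Fin.cons 0 (u α.sy) : Fin (n + 2) → 𝒪) e + ∑ l, ∑ i : Fin (α.1.1 + 1), ∑ j : Fin (α.1.2 + 1),
        ((α.1.1.choose i * α.1.2.choose j : ℕ) : 𝒪) *
          dx^[α.1.1 - i] (dy^[α.1.2 - j] (A e l)) * u (α.below i j) l = _
  unfold system
  rw [iter_add, iter_add, map_add, map_add, iter_sum, map_sum]
  congr 1
  · congr 1
    · refine Fin.lastCases ?_ (fun l => ?_) e
      · simp [iter_map_zero]
      · simp only [Fin.snoc_castSucc, hu, JetIndex.sx, iter_nx hD]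
    · refine Fin.cases ?_ (fun l => ?_) e
      · simp [iter_map_zero]
      · simp only [Fin.cons_succ, hu, JetIndex.sy, iter_ny]
  · refine Finset.sum_congr rfl fun l _ => ?_
    rw [iter_smul, map_sum]
    refine Finset.sum_congr rfl fun i _ => ?_
    rw [map_sum]
    refine Finset.sum_congr rfl fun j _ => ?_
    rw [map_smul, hu, smul_eq_mul]
    rfl

/-! ### Connections on free modules -/

variable {ι : Type}

/-- The connection on a free module with prescribed derivatives of the basis vectors. -/
def free (X Y : ι → ι →₀ 𝒪) : Connection (ι →₀ 𝒪) where
  nx := Finsupp.mapRange.addMonoidHom dx.toLinearMap.toAddMonoidHom +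
    (Finsupp.linearCombination 𝒪 X).toAddMonoidHom
  ny := Finsupp.mapRange.addMonoidHom dy.toLinearMap.toAddMonoidHom +
    (Finsupp.linearCombination 𝒪 Y).toAddMonoidHom
  leibniz_x f s := by
    ext i
    simp
    ring
  leibniz_y f s := by
    ext i
    simp
    ring

theorem free_nx (X Y : ι → ι →₀ 𝒪) (q : ι →₀ 𝒪) (i : ι) :
    (free X Y).nx q i = dx (q i) + Finsupp.linearCombination 𝒪 X q i := rfl

theorem free_ny (X Y : ι → ι →₀ 𝒪) (q : ι →₀ 𝒪) (i : ι) :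
    (free X Y).ny q i = dy (q i) + Finsupp.linearCombination 𝒪 Y q i := rfl

theorem free_nx_single (X Y : ι → ι →₀ 𝒪) (i : ι) :
    (free X Y).nx (Finsupp.single i 1) = X i := by
  ext k
  classical
  simp [free_nx, Finsupp.single_apply]
  split_ifs <;> simp

theorem free_ny_single (X Y : ι → ι →₀ 𝒪) (i : ι) :
    (free X Y).ny (Finsupp.single i 1) = Y i := by
  ext k
  classical
  simp [free_ny, Finsupp.single_apply]
  split_ifs <;> simp

/-- The curvature is linear, so it is enough to test it on basis vectors. -/
theorem free_flat (X Y : ι → ι →₀ 𝒪) (h : ∀ i, (free X Y).nx (Y i) = (free X Y).ny (X i)) :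
    (free X Y).Flat := by
  have : (free X Y).curvature = 0 := by
    refine Finsupp.lhom_ext' fun i => LinearMap.ext_ring ?_
    change (free X Y).nx ((free X Y).ny (Finsupp.single i 1)) -
      (free X Y).ny ((free X Y).nx (Finsupp.single i 1)) = 0
    rw [free_nx_single, free_ny_single, h, sub_self]
  intro s
  exact sub_eq_zero.1 (LinearMap.congr_fun this s)

/-- Leibniz rule for the pairing of a free module with its dual. -/
theorem deriv_pairing (δ : Derivation ℤ 𝒪 𝒪) (P : (ι →₀ 𝒪) →+ (ι →₀ 𝒪))
    (hP : ∀ (f : 𝒪) (s : ι →₀ 𝒪), P (f • s) = δ f • s + f • P s) (T : ι → 𝒪) (q : ι →₀ 𝒪) :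
    δ (Finsupp.linearCombination 𝒪 T q) =
      Finsupp.linearCombination 𝒪
        (fun i => δ (T i) - Finsupp.linearCombination 𝒪 T (P (Finsupp.single i 1))) q +
      Finsupp.linearCombination 𝒪 T (P q) := by
  induction q using Finsupp.induction_linear with
  | zero => simp
  | add p q hp hq =>
    simp only [map_add, hp, hq]
    ring
  | single i a =>
    have : Finsupp.single i a = a • Finsupp.single i (1 : 𝒪) := by simp
    rw [this, hP]
    simp only [map_add, map_smul, Finsupp.linearCombination_single, smul_eq_mul, one_mul,
      Derivation.leibniz]
    ring

end Connection

end WebGeometry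

namespace WebGeometry

/-! ### Operators with frozen coefficients -/

section Frozen

variable {ι : Type*} (v : ι → 𝒪)

/-- The operator `∏_{j ∈ s} (∂_x - v j ∂_y)` with constant coefficients, on the array of
derivatives `g`. -/
def frozenOp (s : Finset ι) (g : ℕ → ℕ → 𝒪) : 𝒪 :=
  ∑ a ∈ Finset.range (s.card + 1), (∏ j ∈ s, (X - C (v j))).coeff a * g a (s.card - a)

theorem frozenOp_empty (g : ℕ → ℕ → 𝒪) : frozenOp v ∅ g = g 0 0 := by
  simp [frozenOp]

theorem frozenOp_add (s : Finset ι) (g h : ℕ → ℕ → 𝒪) :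
    frozenOp v s (fun a b => g a b + h a b) = frozenOp v s g + frozenOp v s h := by
  simp only [frozenOp, mul_add, Finset.sum_add_distrib]

theorem frozenOp_mul (s : Finset ι) (c : 𝒪) (g : ℕ → ℕ → 𝒪) :
    frozenOp v s (fun a b => c * g a b) = c * frozenOp v s g := by
  simp only [frozenOp, Finset.mul_sum]
  exact Finset.sum_congr rfl fun _ _ => by ring

variable [DecidableEq ι]

/-- Multiplying the symbol by `X - C (v k)` raises the total order by one: `X` shifts the first
index and the constant `v k` shifts the second. The coefficients are never differentiated, which
permits induction on `s`. -/
theorem frozenOp_insert {s : Finset ι} {k : ι} (hk : k ∉ s) (g : ℕ → ℕ → 𝒪) :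
    frozenOp v (insert k s) g = frozenOp v s (fun a b => g (a + 1) b - v k * g a (b + 1)) := by
  set Q := ∏ j ∈ s, (X - C (v j)) with hQ
  have hdeg : Q.natDegree = s.card := by
    rw [hQ, natDegree_prod_of_monic _ _ fun _ _ => monic_X_sub_C _]
    simp
  have hcoe : ∀ a, (X * Q - C (v k) * Q).coeff (a + 1) = Q.coeff a - v k * Q.coeff (a + 1) := by
    intro a
    simp
  have hco0 : (X * Q - C (v k) * Q).coeff 0 = - (v k * Q.coeff 0) := by
    simp
  have htop : Q.coeff (s.card + 1) = 0 := coeff_eq_zero_of_natDegree_lt (by omega)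
  unfold frozenOp
  rw [Finset.prod_insert hk, ← hQ, Finset.card_insert_of_notMem hk, sub_mul,
    Finset.sum_range_succ']
  simp only [hcoe, hco0, Nat.add_sub_add_right, Nat.sub_zero]
  have e1 : ∑ a ∈ Finset.range (s.card + 1), Q.coeff a * (v k * g a (s.card - a + 1)) =
      ∑ a ∈ Finset.range (s.card + 1), v k * Q.coeff (a + 1) * g (a + 1) (s.card - a) +
        v k * Q.coeff 0 * g 0 (s.card + 1) := by
    rw [Finset.sum_range_succ', Finset.sum_range_succ (fun a => v k * Q.coeff (a + 1) * _), htop]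
    simp only [mul_zero, zero_mul, add_zero, Nat.sub_zero]
    congr 1
    · refine Finset.sum_congr rfl fun a ha => ?_
      have : s.card - (a + 1) + 1 = s.card - a := by
        have := Finset.mem_range.1 ha
        omega
      rw [this]
      ring
    · ring
  simp only [mul_sub, sub_mul, Finset.sum_sub_distrib]
  rw [e1]
  ring

/-- The Hessian of `f` on the vectors `∂_x - u ∂_y` and `∂_x - w ∂_y`. -/
def slopeHess (f u w : 𝒪) : 𝒪 := dx (dx f) - (u + w) * dx (dy f) + u * w * dy (dy f)

variable (f : 𝒪)

theorem frozenOp_symbol (s : Finset ι) :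
    frozenOp v s (fun a b => dx f ^ a * dy f ^ b) = ∏ j ∈ s, (dx f - v j * dy f) := by
  induction s using Finset.induction_on with
  | empty => simp [frozenOp_empty]
  | insert k s hk ih =>
    rw [frozenOp_insert v hk, Finset.prod_insert hk, ← ih, ← frozenOp_mul]
    congr 1
    funext a b
    ring

/-- Differentiating the product of the X_j f along ∂_x - u ∂_y with the `v j` frozen replaces one
factor at a time by a Hessian. -/
theorem frozenOp_deriv_symbol (u : 𝒪) (s : Finset ι)
    (hs : ∀ j ∈ s, IsUnit (dx f - v j * dy f)) :
    frozenOp v s (fun a b => dx (dx f ^ a * dy f ^ b) - u * dy (dx f ^ a * dy f ^ b)) =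
      (∏ j ∈ s, (dx f - v j * dy f)) *
        ∑ k ∈ s, slopeHess f u (v k) * Ring.inverse (dx f - v k * dy f) := by
  induction s using Finset.induction_on with
  | empty => simp [frozenOp_empty]
  | insert k s hk ih =>
    have hstep : (fun a b : ℕ => (dx (dx f ^ (a + 1) * dy f ^ b) - u * dy (dx f ^ (a + 1) * dy f ^ b))
          - v k * (dx (dx f ^ a * dy f ^ (b + 1)) - u * dy (dx f ^ a * dy f ^ (b + 1)))) =
        fun a b => (dx f - v k * dy f) *
          (dx (dx f ^ a * dy f ^ b) - u * dy (dx f ^ a * dy f ^ b)) +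
          slopeHess f u (v k) * (dx f ^ a * dy f ^ b) := by
      funext a b
      have h1 : dx f ^ (a + 1) * dy f ^ b = dx f * (dx f ^ a * dy f ^ b) := by ring
      have h2 : dx f ^ a * dy f ^ (b + 1) = dy f * (dx f ^ a * dy f ^ b) := by ring
      rw [h1, h2]
      simp only [Derivation.leibniz dx (dx f), Derivation.leibniz dx (dy f),
        Derivation.leibniz dy (dx f), Derivation.leibniz dy (dy f), smul_eq_mul, slopeHess,
        dx_dy_comm]
      ring
    rw [frozenOp_insert v hk, hstep, frozenOp_add, frozenOp_mul, frozenOp_mul, frozenOp_symbol,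
      ih fun j hj => hs j (Finset.mem_insert_of_mem hj), Finset.prod_insert hk,
      Finset.sum_insert hk]
    have hc := Ring.mul_inverse_cancel _ (hs k (Finset.mem_insert_self k s))
    linear_combination (-(∏ j ∈ s, (dx f - v j * dy f)) * slopeHess f u (v k)) * hc

theorem slopeHess_comm (u w : 𝒪) : slopeHess f u w = slopeHess f w u := by
  unfold slopeHess
  ring

/-- The part of order one less than the maximal one of the composite of a function with `f`. -/
theorem two_mul_frozenOp_subsymbol (s : Finset ι) (hs : ∀ j ∈ s, IsUnit (dx f - v j * dy f))
    (r : ℕ → ℕ → 𝒪) (h0 : r 0 0 = 0)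
    (hx : ∀ a b, r (a + 1) b = dx (dx f ^ a * dy f ^ b) + dx f * r a b)
    (hy : ∀ a b, r a (b + 1) = dy (dx f ^ a * dy f ^ b) + dy f * r a b) :
    2 * frozenOp v s r = (∏ j ∈ s, (dx f - v j * dy f)) * ∑ k ∈ s, ∑ l ∈ s.erase k,
      slopeHess f (v k) (v l) * Ring.inverse (dx f - v k * dy f) *
        Ring.inverse (dx f - v l * dy f) := by
  induction s using Finset.induction_on with
  | empty => simp [frozenOp_empty, h0]
  | insert k s hk ih =>
    have hstep : (fun a b : ℕ => r (a + 1) b - v k * r a (b + 1)) =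
        fun a b => (dx f - v k * dy f) * r a b +
          (dx (dx f ^ a * dy f ^ b) - v k * dy (dx f ^ a * dy f ^ b)) := by
      funext a b
      rw [hx, hy]
      ring
    have hs' : ∀ j ∈ s, IsUnit (dx f - v j * dy f) := fun j hj => hs j (Finset.mem_insert_of_mem hj)
    set c : ι → ι → 𝒪 := fun k l => slopeHess f (v k) (v l) * Ring.inverse (dx f - v k * dy f) *
        Ring.inverse (dx f - v l * dy f) with hcdef
    -- The new index `k` forms the ordered pairs (k, l) and (l, k) with each old `l`, and the
    -- summand is symmetric. This is the source of the factor 2 in the statement.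
    have hsum : ∑ k' ∈ insert k s, ∑ l ∈ (insert k s).erase k', c k' l =
        2 * ∑ l ∈ s, c k l + ∑ k' ∈ s, ∑ l ∈ s.erase k', c k' l := by
      rw [Finset.sum_insert hk, Finset.erase_insert hk]
      have : ∑ k' ∈ s, ∑ l ∈ (insert k s).erase k', c k' l =
          ∑ k' ∈ s, (c k k' + ∑ l ∈ s.erase k', c k' l) := by
        refine Finset.sum_congr rfl fun k' hk' => ?_
        have hne : k ≠ k' := fun h => hk (h ▸ hk')
        rw [Finset.erase_insert_of_ne hne,
          Finset.sum_insert fun h => hk (Finset.mem_of_mem_erase h)]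
        congr 1
        simp only [hcdef]
        rw [slopeHess_comm]
        ring
      rw [this, Finset.sum_add_distrib]
      ring
    have hck : ∑ l ∈ s, c k l = Ring.inverse (dx f - v k * dy f) *
        ∑ l ∈ s, slopeHess f (v k) (v l) * Ring.inverse (dx f - v l * dy f) := by
      rw [Finset.mul_sum]
      exact Finset.sum_congr rfl fun _ _ => by simp only [hcdef]; ring
    change _ = _ * ∑ k' ∈ insert k s, ∑ l ∈ (insert k s).erase k', c k' l
    rw [frozenOp_insert v hk, hstep, frozenOp_add, frozenOp_mul, frozenOp_deriv_symbol v f _ s hs',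
      Finset.prod_insert hk, hsum, hck]
    have ih' := ih hs'
    change _ = _ * ∑ k' ∈ s, ∑ l ∈ s.erase k', c k' l at ih'
    have hc := Ring.mul_inverse_cancel _ (hs k (Finset.mem_insert_self k s))
    linear_combination (dx f - v k * dy f) * ih' - 2 * (∏ j ∈ s, (dx f - v j * dy f)) *
      (∑ l ∈ s, slopeHess f (v k) (v l) * Ring.inverse (dx f - v l * dy f)) * hc

end Frozen

/-! ### The module of primitives of the first integrals -/

section Primitives

variable {d : ℕ} (W : Web d)

/-- The flat connection whose basis vector of index `(i, m)` stands for the `m`-th derivative of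
an unknown function `Φᵢ` of one variable, composed with `fn i`. -/
def Web.prim : Connection (Fin d × ℕ →₀ 𝒪) :=
  Connection.free (fun s => Finsupp.single (s.1, s.2 + 1) (dx (W.fn s.1)))
    (fun s => Finsupp.single (s.1, s.2 + 1) (dy (W.fn s.1)))

theorem linearCombination_shift_zero (g : Fin d → 𝒪) (q : Fin d × ℕ →₀ 𝒪) (i : Fin d) :
    Finsupp.linearCombination 𝒪
      (fun s : Fin d × ℕ => Finsupp.single (s.1, s.2 + 1) (g s.1)) q (i, 0) = 0 := by
  induction q using Finsupp.induction_linear with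
  | zero => simp
  | add p q hp hq => simp [hp, hq]
  | single s a => simp

theorem linearCombination_shift_succ (g : Fin d → 𝒪) (q : Fin d × ℕ →₀ 𝒪) (i : Fin d) (m : ℕ) :
    Finsupp.linearCombination 𝒪
      (fun s : Fin d × ℕ => Finsupp.single (s.1, s.2 + 1) (g s.1)) q (i, m + 1) =
      g i * q (i, m) := by
  induction q using Finsupp.induction_linear with
  | zero => simp
  | add p q hp hq => simp [hp, hq, mul_add]
  | single s a =>
    obtain ⟨j, k⟩ := s
    by_cases h : j = i ∧ k = m
    · obtain ⟨rfl, rfl⟩ := h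
      simp [mul_comm]
    · have h1 : (j, k) ≠ (i, m) := by simpa [Prod.ext_iff] using h
      have h2 : (j, k + 1) ≠ (i, m + 1) := by simpa [Prod.ext_iff] using h
      simp [Finsupp.single_eq_of_ne h1.symm, Finsupp.single_eq_of_ne h2.symm]

theorem Web.prim_nx_zero (q : Fin d × ℕ →₀ 𝒪) (i : Fin d) : W.prim.nx q (i, 0) = dx (q (i, 0)) := by
  rw [Web.prim, Connection.free_nx, linearCombination_shift_zero (fun i => dx (W.fn i)), add_zero]

theorem Web.prim_ny_zero (q : Fin d × ℕ →₀ 𝒪) (i : Fin d) : W.prim.ny q (i, 0) = dy (q (i, 0)) := by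
  rw [Web.prim, Connection.free_ny, linearCombination_shift_zero (fun i => dy (W.fn i)), add_zero]

theorem Web.prim_nx_succ (q : Fin d × ℕ →₀ 𝒪) (i : Fin d) (m : ℕ) :
    W.prim.nx q (i, m + 1) = dx (q (i, m + 1)) + dx (W.fn i) * q (i, m) := by
  rw [Web.prim, Connection.free_nx, linearCombination_shift_succ (fun i => dx (W.fn i))]

theorem Web.prim_ny_succ (q : Fin d × ℕ →₀ 𝒪) (i : Fin d) (m : ℕ) :
    W.prim.ny q (i, m + 1) = dy (q (i, m + 1)) + dy (W.fn i) * q (i, m) := by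
  rw [Web.prim, Connection.free_ny, linearCombination_shift_succ (fun i => dy (W.fn i))]

theorem Web.prim_nx_single (s : Fin d × ℕ) : W.prim.nx (Finsupp.single s 1) =
    Finsupp.single (s.1, s.2 + 1) (dx (W.fn s.1)) := Connection.free_nx_single _ _ s

theorem Web.prim_ny_single (s : Fin d × ℕ) : W.prim.ny (Finsupp.single s 1) =
    Finsupp.single (s.1, s.2 + 1) (dy (W.fn s.1)) := Connection.free_ny_single _ _ s

theorem Web.prim_flat : W.prim.Flat := by
  refine Connection.free_flat _ _ fun s => ?_
  change W.prim.nx _ = W.prim.ny _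
  have h : ∀ a : 𝒪, Finsupp.single (s.1, s.2 + 1) a =
      a • (Finsupp.single (s.1, s.2 + 1) 1 : Fin d × ℕ →₀ 𝒪) := by simp
  rw [h (dx _), h (dy _), W.prim.leibniz_x, W.prim.leibniz_y, W.prim_nx_single, W.prim_ny_single,
    dx_dy_comm]
  simp [mul_comm]

/-- The derivative of order `(a, b)` of `∑ᵢ Φᵢ ∘ fn i`. -/
def Web.jetSum (a b : ℕ) : Fin d × ℕ →₀ 𝒪 :=
  W.prim.iter a b (∑ i, Finsupp.single (i, 0) 1)

theorem Web.nx_jetSum (a b : ℕ) : W.prim.nx (W.jetSum a b) = W.jetSum (a + 1) b :=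
  Connection.nx_iter _ _ _ _

theorem Web.ny_jetSum (a b : ℕ) : W.prim.ny (W.jetSum a b) = W.jetSum a (b + 1) :=
  Connection.ny_iter W.prim_flat _ _ _

/-- Induction on the order of a derivative. -/
theorem orderInduction {p : ℕ → ℕ → Prop} (h0 : p 0 0) (hx : ∀ a b, p a b → p (a + 1) b)
    (hy : ∀ a b, p a b → p a (b + 1)) (a b : ℕ) : p a b := by
  induction a with
  | zero =>
    induction b with
    | zero => exact h0
    | succ b ih => exact hy _ _ ih
  | succ a ih => exact hx _ _ ih

theorem Web.jetSum_zero_apply (i : Fin d) (m : ℕ) :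
    W.jetSum 0 0 (i, m) = if m = 0 then 1 else 0 := by
  change (∑ i : Fin d, Finsupp.single (i, 0) (1 : 𝒪)) (i, m) = _
  rw [Finsupp.finsetSum_apply, Finset.sum_eq_single i]
  · simp [Finsupp.single_apply, eq_comm]
  · intro j _ hj
    rw [Finsupp.single_eq_of_ne]
    simp [Prod.ext_iff, hj.symm]
  · simp

theorem Web.jetSum_apply_zero {a b : ℕ} (i : Fin d) (h : 0 < a + b) :
    W.jetSum a b (i, 0) = 0 := by
  have key : ∀ a b, W.jetSum a b (i, 0) = if a + b = 0 then 1 else 0 := by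
    refine orderInduction ?_ ?_ ?_
    · simp [W.jetSum_zero_apply]
    · intro a b hab
      rw [← W.nx_jetSum, W.prim_nx_zero, hab]
      split_ifs <;> simp_all
    · intro a b hab
      rw [← W.ny_jetSum, W.prim_ny_zero, hab]
      split_ifs <;> simp_all
  rw [key, if_neg h.ne']

theorem Web.jetSum_apply_of_lt (i : Fin d) : ∀ (a b m : ℕ), a + b < m → W.jetSum a b (i, m) = 0 := by
  refine orderInduction ?_ ?_ ?_
  · intro m hm
    rw [W.jetSum_zero_apply, if_neg (by omega)]
  · intro a b hab m hm
    obtain ⟨m, rfl⟩ : ∃ k, m = k + 1 := ⟨m - 1, by omega⟩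
    rw [← W.nx_jetSum, W.prim_nx_succ, hab _ (by omega), hab _ (by omega)]
    simp
  · intro a b hab m hm
    obtain ⟨m, rfl⟩ : ∃ k, m = k + 1 := ⟨m - 1, by omega⟩
    rw [← W.ny_jetSum, W.prim_ny_succ, hab _ (by omega), hab _ (by omega)]
    simp

theorem Web.jetSum_apply_top (i : Fin d) : ∀ a b : ℕ,
    W.jetSum a b (i, a + b) = dx (W.fn i) ^ a * dy (W.fn i) ^ b := by
  refine orderInduction ?_ ?_ ?_
  · simp [W.jetSum_zero_apply]
  · intro a b hab
    rw [← W.nx_jetSum, add_right_comm, W.prim_nx_succ, hab, W.jetSum_apply_of_lt i _ _ _ (by omega)]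
    simp
    ring
  · intro a b hab
    rw [← W.ny_jetSum, ← add_assoc, W.prim_ny_succ, hab, W.jetSum_apply_of_lt i _ _ _ (by omega)]
    simp
    ring

/-- The coefficients of order one less than the maximal one. -/
def Web.subsymbol (i : Fin d) (a b : ℕ) : 𝒪 :=
  if a + b = 0 then 0 else W.jetSum a b (i, a + b - 1)

theorem Web.subsymbol_zero (i : Fin d) : W.subsymbol i 0 0 = 0 := rfl

theorem Web.subsymbol_succ_left (i : Fin d) (a b : ℕ) : W.subsymbol i (a + 1) b =
    dx (dx (W.fn i) ^ a * dy (W.fn i) ^ b) + dx (W.fn i) * W.subsymbol i a b := by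
  have e : a + 1 + b - 1 = a + b := by omega
  rw [Web.subsymbol, if_neg (by omega), e, ← W.nx_jetSum, ← W.jetSum_apply_top]
  rcases Nat.eq_zero_or_pos (a + b) with h | h
  · have ha : a = 0 := by omega
    have hb : b = 0 := by omega
    subst ha hb
    rw [W.subsymbol_zero]
    simp [W.prim_nx_zero]
  · obtain ⟨k, hk⟩ : ∃ k, a + b = k + 1 := ⟨a + b - 1, by omega⟩
    rw [Web.subsymbol, if_neg (by omega), hk, W.prim_nx_succ, Nat.add_sub_cancel]

theorem Web.subsymbol_succ_right (i : Fin d) (a b : ℕ) : W.subsymbol i a (b + 1) =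
    dy (dx (W.fn i) ^ a * dy (W.fn i) ^ b) + dy (W.fn i) * W.subsymbol i a b := by
  have e : a + (b + 1) - 1 = a + b := by omega
  rw [Web.subsymbol, if_neg (by omega), e, ← W.ny_jetSum, ← W.jetSum_apply_top]
  rcases Nat.eq_zero_or_pos (a + b) with h | h
  · have ha : a = 0 := by omega
    have hb : b = 0 := by omega
    subst ha hb
    rw [W.subsymbol_zero]
    simp [W.prim_ny_zero]
  · obtain ⟨k, hk⟩ : ∃ k, a + b = k + 1 := ⟨a + b - 1, by omega⟩
    rw [Web.subsymbol, if_neg (by omega), hk, W.prim_ny_succ, Nat.add_sub_cancel]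

end Primitives

end WebGeometry

namespace WebGeometry

/-! ### Functionals on the module of primitives -/

section Pairing

variable {d : ℕ}

/-- The value of the functional with coefficients `T`. -/
abbrev pair {ι : Type} (T : ι → 𝒪) (q : ι →₀ 𝒪) : 𝒪 := Finsupp.linearCombination 𝒪 T q

theorem pair_add_left {ι : Type} (T T' : ι → 𝒪) (q : ι →₀ 𝒪) :
    pair (T + T') q = pair T q + pair T' q := by
  simp [pair, Finsupp.linearCombination_apply, Finsupp.sum, mul_add, Finset.sum_add_distrib]

theorem pair_smul_left {ι : Type} (c : 𝒪) (T : ι → 𝒪) (q : ι →₀ 𝒪) :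
    pair (c • T) q = c * pair T q := by
  simp only [pair, Finsupp.linearCombination_apply, Finsupp.sum, Pi.smul_apply, smul_eq_mul,
    Finset.mul_sum]
  exact Finset.sum_congr rfl fun _ _ => by ring

theorem pair_congr {ι : Type} {T T' : ι → 𝒪} {q : ι →₀ 𝒪} (h : ∀ s, q s ≠ 0 → T s = T' s) :
    pair T q = pair T' q := by
  simp only [pair, Finsupp.linearCombination_apply, Finsupp.sum]
  exact Finset.sum_congr rfl fun s hs => by rw [h s (Finsupp.mem_support_iff.1 hs)]

theorem pair_eq_sum {T : Fin d × ℕ → 𝒪} {k : ℕ} (hT : ∀ i m, m ≠ k → T (i, m) = 0)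
    (q : Fin d × ℕ →₀ 𝒪) : pair T q = ∑ i, q (i, k) * T (i, k) := by
  induction q using Finsupp.induction_linear with
  | zero => simp
  | add p q hp hq => simp [hp, hq, add_mul, Finset.sum_add_distrib]
  | single s a =>
    obtain ⟨j, m⟩ := s
    rw [pair, Finsupp.linearCombination_single, Finset.sum_eq_single j]
    · rcases eq_or_ne m k with rfl | h
      · simp
      · rw [hT j m h, Finsupp.single_eq_of_ne (by simp [Prod.ext_iff, h.symm])]
        simp
    · intro i _ hi
      rw [Finsupp.single_eq_of_ne (by simp [Prod.ext_iff, hi]), zero_mul]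
    · simp

theorem pair_level (k : ℕ) (t : Fin d → 𝒪) (q : Fin d × ℕ →₀ 𝒪) :
    pair (fun s : Fin d × ℕ => if s.2 = k then t s.1 else 0) q = ∑ i, q (i, k) * t i := by
  rw [pair_eq_sum (k := k) (fun i m hm => if_neg hm)]
  simp only [if_true]

variable (W : Web d)

/-- The derivative along `x` of a functional on the module of primitives. -/
def Web.dualX (T : Fin d × ℕ → 𝒪) (s : Fin d × ℕ) : 𝒪 :=
  dx (T s) - dx (W.fn s.1) * T (s.1, s.2 + 1)

/-- The derivative along `y` of a functional on the module of primitives. -/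
def Web.dualY (T : Fin d × ℕ → 𝒪) (s : Fin d × ℕ) : 𝒪 :=
  dy (T s) - dy (W.fn s.1) * T (s.1, s.2 + 1)

theorem Web.dx_pair (T : Fin d × ℕ → 𝒪) (q : Fin d × ℕ →₀ 𝒪) :
    dx (pair T q) = pair (W.dualX T) q + pair T (W.prim.nx q) := by
  rw [pair, Connection.deriv_pairing dx W.prim.nx W.prim.leibniz_x]
  simp only [W.prim_nx_single, Finsupp.linearCombination_single, smul_eq_mul]
  rfl

theorem Web.dy_pair (T : Fin d × ℕ → 𝒪) (q : Fin d × ℕ →₀ 𝒪) :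
    dy (pair T q) = pair (W.dualY T) q + pair T (W.prim.ny q) := by
  rw [pair, Connection.deriv_pairing dy W.prim.ny W.prim.leibniz_y]
  simp only [W.prim_ny_single, Finsupp.linearCombination_single, smul_eq_mul]
  rfl

/-- The quotient `∂_x / ∂_y` of a first integral. -/
def Web.ratio (i : Fin d) : 𝒪 := dx (W.fn i) * Ring.inverse (dy (W.fn i))

variable {W}

theorem Web.isUnit_wedge {i j : Fin d} (h : i ≠ j) :
    IsUnit ((diff (W.fn i)).wedge (diff (W.fn j))) :=
  (isUnit_iff_value_ne_zero _).2 (W.general i j h)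

variable (hW : ∀ i, IsUnit (dy (W.fn i)))

include hW

theorem Web.ratio_mul (i : Fin d) : W.ratio i * dy (W.fn i) = dx (W.fn i) := by
  rw [Web.ratio, mul_assoc, Ring.inverse_mul_cancel _ (hW i), mul_one]

/-- The vector field ∂_x - ratio ∂_y is tangent to the leaves of the foliation `j`, so its value on
`fn i` is the wedge product up to a unit; general position makes it invertible. -/
theorem Web.dx_sub_ratio_mul (i j : Fin d) : dx (W.fn i) - W.ratio j * dy (W.fn i) =
    (diff (W.fn i)).wedge (diff (W.fn j)) * Ring.inverse (dy (W.fn j)) := by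
  change _ = (dx (W.fn i) * dy (W.fn j) - dy (W.fn i) * dx (W.fn j)) * _
  have h := Ring.mul_inverse_cancel _ (hW j)
  rw [Web.ratio]
  linear_combination (-dx (W.fn i)) * h

theorem Web.isUnit_dx_sub {i j : Fin d} (h : i ≠ j) :
    IsUnit (dx (W.fn i) - W.ratio j * dy (W.fn i)) := by
  rw [Web.dx_sub_ratio_mul hW]
  exact (Web.isUnit_wedge h).mul (hW j).ringInverse

theorem Web.isUnit_ratio_sub (i j : Fin d) (h : i ≠ j) : IsUnit (W.ratio i - W.ratio j) := by
  have : (W.ratio i - W.ratio j) * dy (W.fn i) = dx (W.fn i) - W.ratio j * dy (W.fn i) := by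
    rw [sub_mul, Web.ratio_mul hW]
  exact isUnit_of_mul_isUnit_left (this ▸ Web.isUnit_dx_sub hW h)

theorem Web.dx_pow_mul (i : Fin d) {a k : ℕ} (h : a ≤ k) :
    dx (W.fn i) ^ a * dy (W.fn i) ^ (k - a) = dy (W.fn i) ^ k * W.ratio i ^ a := by
  rw [← Web.ratio_mul hW, mul_pow]
  have : dy (W.fn i) ^ k = dy (W.fn i) ^ a * dy (W.fn i) ^ (k - a) := by
    rw [← pow_add, Nat.add_sub_cancel' h]
  rw [this]
  ring

/-- Solution of the equations of the top order. -/
theorem Web.exists_solution (k : ℕ) (y : Fin d → 𝒪) :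
    ∃ t : Fin d → 𝒪, ∀ a : Fin d,
      ∑ i, dy (W.fn i) ^ k * W.ratio i ^ (a : ℕ) * t i = y a := by
  refine ⟨fun i => Ring.inverse (dy (W.fn i) ^ k) * ∑ a' : Fin d,
    (coNodal W.ratio i).coeff a' * Ring.inverse ((coNodal W.ratio i).eval (W.ratio i)) * y a',
    fun a => ?_⟩
  have h : ∀ i, dy (W.fn i) ^ k * W.ratio i ^ (a : ℕ) * (Ring.inverse (dy (W.fn i) ^ k) *
      ∑ a' : Fin d, (coNodal W.ratio i).coeff a' *
        Ring.inverse ((coNodal W.ratio i).eval (W.ratio i)) * y a') =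
      ∑ a' : Fin d, (coNodal W.ratio i).coeff a' *
        Ring.inverse ((coNodal W.ratio i).eval (W.ratio i)) * W.ratio i ^ (a : ℕ) * y a' := by
    intro i
    have hc := Ring.mul_inverse_cancel _ ((hW i).pow k)
    have : ∀ S : 𝒪, dy (W.fn i) ^ k * W.ratio i ^ (a : ℕ) * (Ring.inverse (dy (W.fn i) ^ k) * S)
        = W.ratio i ^ (a : ℕ) * S := by
      intro S
      linear_combination W.ratio i ^ (a : ℕ) * S * hc
    rw [this, Finset.mul_sum]
    exact Finset.sum_congr rfl fun _ _ => by ring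
  simp only [h]
  rw [Finset.sum_comm]
  simp only [← Finset.sum_mul, lagrange_dual (Web.isUnit_ratio_sub hW)]
  simp

/-- Uniqueness of the solution of the equations of the top order. -/
theorem Web.eq_zero_of_solution (k : ℕ) (t : Fin d → 𝒪)
    (ht : ∀ a : Fin d, ∑ i, dy (W.fn i) ^ k * W.ratio i ^ (a : ℕ) * t i = 0) : t = 0 := by
  funext j
  have h : ∑ a : Fin d, (coNodal W.ratio j).coeff a *
      ∑ i, dy (W.fn i) ^ k * W.ratio i ^ (a : ℕ) * t i = 0 := by simp [ht]
  simp only [Finset.mul_sum] at h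
  rw [Finset.sum_comm] at h
  have h2 : ∀ i, ∑ a : Fin d, (coNodal W.ratio j).coeff a *
      (dy (W.fn i) ^ k * W.ratio i ^ (a : ℕ) * t i) =
      (coNodal W.ratio j).eval (W.ratio i) * (dy (W.fn i) ^ k * t i) := by
    intro i
    rw [← sum_coeff_coNodal, Finset.sum_mul]
    exact Finset.sum_congr rfl fun _ _ => by ring
  simp only [h2] at h
  rw [Finset.sum_eq_single j (fun i _ hi => by rw [eval_coNodal_of_ne _ hi, zero_mul])
    (by simp)] at h
  have hu := (isUnit_eval_coNodal (Web.isUnit_ratio_sub hW) j)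
  rw [hu.mul_right_eq_zero, ((hW j).pow k).mul_right_eq_zero] at h
  exact h

end Pairing

/-! ### The ambient connection -/

section Ambient

variable {n : ℕ} (W : Web (n + 3))

/-- Functionals on the part of order between `1` and `n + 1`. -/
abbrev Ambient (n : ℕ) : Type := Fin (n + 3) × Fin (n + 1) → 𝒪

/-- Extension by zero. -/
def lowExt (n : ℕ) : Ambient n →ₗ[𝒪] (Fin (n + 3) × ℕ → 𝒪) where
  toFun T s := match s with
    | (_, 0) => 0
    | (i, m + 1) => if h : m < n + 1 then T (i, ⟨m, h⟩) else 0
  map_add' T T' := by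
    funext ⟨i, m⟩
    cases m with
    | zero => simp
    | succ m =>
      simp only [Pi.add_apply]
      split_ifs <;> simp
  map_smul' c T := by
    funext ⟨i, m⟩
    cases m with
    | zero => simp
    | succ m =>
      simp only [Pi.smul_apply, RingHom.id_apply]
      split_ifs <;> simp

theorem lowExt_zero (T : Ambient n) (i : Fin (n + 3)) : lowExt n T (i, 0) = 0 := rfl

theorem lowExt_succ (T : Ambient n) (i : Fin (n + 3)) (m : ℕ) :
    lowExt n T (i, m + 1) = if h : m < n + 1 then T (i, ⟨m, h⟩) else 0 := rfl

/-- The component of order `n + 2`, as determined by the lower ones. -/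
def Web.topPart : Ambient n →ₗ[𝒪] (Fin (n + 3) → 𝒪) where
  toFun T i := - Ring.inverse (dy (W.fn i) ^ (n + 2) * (coNodal W.ratio i).eval (W.ratio i)) *
    ∑ a : Fin (n + 3), (coNodal W.ratio i).coeff a * pair (lowExt n T) (W.jetSum a (n + 2 - a))
  map_add' T T' := by
    funext i
    simp only [map_add, pair_add_left, mul_add, Finset.sum_add_distrib, Pi.add_apply]
  map_smul' c T := by
    funext i
    simp only [map_smul, pair_smul_left, Pi.smul_apply, RingHom.id_apply, smul_eq_mul,
      mul_left_comm _ c, ← Finset.mul_sum]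

/-- The functional on the part of order between `1` and `n + 2` that extends `T` and kills the
derivatives of order `n + 2` of the sum of the primitives. -/
def Web.fullExt : Ambient n →ₗ[𝒪] (Fin (n + 3) × ℕ → 𝒪) where
  toFun T s := lowExt n T s + if s.2 = n + 2 then W.topPart T s.1 else 0
  map_add' T T' := by
    funext s
    simp only [map_add, Pi.add_apply]
    split_ifs <;> ring
  map_smul' c T := by
    funext s
    simp only [map_smul, Pi.smul_apply, RingHom.id_apply, smul_eq_mul]
    split_ifs <;> ring

theorem Web.fullExt_apply (T : Ambient n) (i : Fin (n + 3)) (m : ℕ) : W.fullExt T (i, m) =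
    lowExt n T (i, m) + if m = n + 2 then W.topPart T i else 0 := rfl

theorem Web.fullExt_of_le (T : Ambient n) (i : Fin (n + 3)) {m : ℕ} (h : m ≤ n + 1) :
    W.fullExt T (i, m) = lowExt n T (i, m) := by
  rw [W.fullExt_apply, if_neg (by omega), add_zero]

theorem Web.pair_fullExt_low (T : Ambient n) {a b : ℕ} (h : a + b ≤ n + 1) :
    pair (W.fullExt T) (W.jetSum a b) = pair (lowExt n T) (W.jetSum a b) := by
  refine pair_congr fun ⟨i, m⟩ hs => W.fullExt_of_le T i ?_
  by_contra hm
  exact hs (W.jetSum_apply_of_lt i a b m (by omega))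

/-- At order n + 2 the top components enter through a Vandermonde matrix in the ratios, and
`topPart` is its solution by Lagrange interpolation with the lower-order contribution, changed in
sign, as right-hand side. -/
theorem Web.pair_fullExt_top (hW : ∀ i, IsUnit (dy (W.fn i))) (T : Ambient n) {a b : ℕ}
    (h : a + b = n + 2) : pair (W.fullExt T) (W.jetSum a b) = 0 := by
  have hsplit : W.fullExt T = lowExt n T +
      fun s : Fin (n + 3) × ℕ => if s.2 = n + 2 then W.topPart T s.1 else 0 := rfl
  rw [hsplit, pair_add_left, pair_level]
  have hb : b = n + 2 - a := by omega
  subst hb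
  have ha : a < n + 3 := by omega
  have hterm : ∀ i, W.jetSum a (n + 2 - a) (i, n + 2) * W.topPart T i =
      - ∑ a' : Fin (n + 3), (coNodal W.ratio i).coeff a' *
        Ring.inverse ((coNodal W.ratio i).eval (W.ratio i)) * W.ratio i ^ a *
          pair (lowExt n T) (W.jetSum a' (n + 2 - a')) := by
    intro i
    have h1 := W.jetSum_apply_top i a (n + 2 - a)
    rw [h, Web.dx_pow_mul hW i (by omega)] at h1
    rw [h1]
    change _ * (- Ring.inverse (dy (W.fn i) ^ (n + 2) * (coNodal W.ratio i).eval (W.ratio i)) *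
      ∑ a : Fin (n + 3), (coNodal W.ratio i).coeff a *
        pair (lowExt n T) (W.jetSum a (n + 2 - a))) = _
    have hc := Ring.mul_inverse_cancel _ ((hW i).pow (n + 2))
    have hS : ∑ a' : Fin (n + 3), (coNodal W.ratio i).coeff a' *
        Ring.inverse ((coNodal W.ratio i).eval (W.ratio i)) * W.ratio i ^ a *
          pair (lowExt n T) (W.jetSum a' (n + 2 - a')) =
        Ring.inverse ((coNodal W.ratio i).eval (W.ratio i)) * W.ratio i ^ a *
        ∑ a : Fin (n + 3), (coNodal W.ratio i).coeff a *
          pair (lowExt n T) (W.jetSum a (n + 2 - a)) := by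
      rw [Finset.mul_sum]
      exact Finset.sum_congr rfl fun _ _ => by ring
    rw [hS, Ring.mul_inverse_rev]
    generalize (∑ a : Fin (n + 3), (coNodal W.ratio i).coeff a *
          pair (lowExt n T) (W.jetSum a (n + 2 - a))) = S
    linear_combination (-(W.ratio i ^ a) * Ring.inverse ((coNodal W.ratio i).eval (W.ratio i))
      * S) * hc
  simp only [hterm, Finset.sum_neg_distrib]
  rw [Finset.sum_comm]
  have hl := fun a' => lagrange_dual (Web.isUnit_ratio_sub hW) a' ⟨a, ha⟩
  simp only at hl
  simp only [← Finset.sum_mul, hl]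
  simp

/-- A functional that kills the derivatives of order `n + 2` is determined by its lower part. -/
theorem Web.eq_fullExt (hW : ∀ i, IsUnit (dy (W.fn i))) (T : Ambient n)
    (T' : Fin (n + 3) × ℕ → 𝒪) (h0 : ∀ i, T' (i, 0) = 0)
    (hlow : ∀ i (m : Fin (n + 1)), T' (i, (m : ℕ) + 1) = T (i, m))
    (htop : ∀ a b, a + b = n + 2 → pair T' (W.jetSum a b) = 0) (i : Fin (n + 3)) {m : ℕ}
    (hm : m ≤ n + 2) : T' (i, m) = W.fullExt T (i, m) := by
  have hle : ∀ i m, m ≤ n + 1 → T' (i, m) = W.fullExt T (i, m) := by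
    intro i m hm
    rw [W.fullExt_of_le T i hm]
    cases m with
    | zero => rw [h0, lowExt_zero]
    | succ m => rw [lowExt_succ, dif_pos (by omega), ← hlow]
  rcases Nat.lt_or_ge m (n + 2) with h | h
  · exact hle i m (by omega)
  obtain rfl : m = n + 2 := by omega
  -- The discrepancy in order n + 2 solves the homogeneous Vandermonde system.
  let t : Fin (n + 3) → 𝒪 := fun i => T' (i, n + 2) - W.fullExt T (i, n + 2)
  have ht : t = 0 := by
    refine Web.eq_zero_of_solution hW (n + 2) t fun a => ?_
    have ha : (a : ℕ) + (n + 2 - a) = n + 2 := by have := a.2; omega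
    have h1 : pair (fun s : Fin (n + 3) × ℕ => if s.2 = n + 2 then t s.1 else 0)
        (W.jetSum a (n + 2 - a)) = 0 := by
      have h2 : pair T' (W.jetSum a (n + 2 - a)) =
          pair (W.fullExt T + fun s : Fin (n + 3) × ℕ => if s.2 = n + 2 then t s.1 else 0)
            (W.jetSum a (n + 2 - a)) := by
        refine pair_congr fun ⟨j, m⟩ hs => ?_
        have hm : m ≤ n + 2 := by
          by_contra hm
          exact hs (W.jetSum_apply_of_lt j _ _ m (by omega))
        rcases eq_or_ne m (n + 2) with rfl | hne
        · simp [t]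
        · simp [hne, hle j m (by omega)]
      rw [htop _ _ ha, pair_add_left, W.pair_fullExt_top hW T ha, zero_add] at h2
      exact h2.symm
    rw [pair_level] at h1
    rw [← h1]
    refine Finset.sum_congr rfl fun i _ => ?_
    have h3 := W.jetSum_apply_top i a (n + 2 - a)
    rw [ha, Web.dx_pow_mul hW i (by omega)] at h3
    rw [h3]
  exact sub_eq_zero.1 (congrFun ht i)

/-- The connection on the ambient bundle. -/
def Web.ambient : Connection (Ambient n) where
  nx :=
    { toFun := fun T s => W.dualX (W.fullExt T) (s.1, (s.2 : ℕ) + 1)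
      map_zero' := by
        funext s
        simp [Web.dualX]
      map_add' := fun T T' => by
        funext s
        simp only [Web.dualX, map_add, Pi.add_apply]
        ring }
  ny :=
    { toFun := fun T s => W.dualY (W.fullExt T) (s.1, (s.2 : ℕ) + 1)
      map_zero' := by
        funext s
        simp [Web.dualY]
      map_add' := fun T T' => by
        funext s
        simp only [Web.dualY, map_add, Pi.add_apply]
        ring }
  leibniz_x f T := by
    funext s
    have h : W.fullExt T (s.1, (s.2 : ℕ) + 1) = T s := by
      rw [W.fullExt_of_le _ _ (by have := s.2.2; omega), lowExt_succ, dif_pos s.2.2]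
    simp only [AddMonoidHom.coe_mk, ZeroHom.coe_mk, Web.dualX, map_smul, Pi.smul_apply,
      Pi.add_apply, smul_eq_mul, Derivation.leibniz, h]
    ring
  leibniz_y f T := by
    funext s
    have h : W.fullExt T (s.1, (s.2 : ℕ) + 1) = T s := by
      rw [W.fullExt_of_le _ _ (by have := s.2.2; omega), lowExt_succ, dif_pos s.2.2]
    simp only [AddMonoidHom.coe_mk, ZeroHom.coe_mk, Web.dualY, map_smul, Pi.smul_apply,
      Pi.add_apply, smul_eq_mul, Derivation.leibniz, h]
    ring

theorem Web.ambient_nx (T : Ambient n) (s : Fin (n + 3) × Fin (n + 1)) :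
    W.ambient.nx T s = W.dualX (W.fullExt T) (s.1, (s.2 : ℕ) + 1) := rfl

theorem Web.ambient_ny (T : Ambient n) (s : Fin (n + 3) × Fin (n + 1)) :
    W.ambient.ny T s = W.dualY (W.fullExt T) (s.1, (s.2 : ℕ) + 1) := rfl

/-! ### The quotient connection -/

/-- The orders of derivation between `1` and `n + 1`. -/
def jetOrders (n : ℕ) : Finset (ℕ × ℕ) :=
  (Finset.Icc 1 (n + 1)).biUnion Finset.HasAntidiagonal.antidiagonal

theorem mem_jetOrders {α : ℕ × ℕ} : α ∈ jetOrders n ↔ 1 ≤ α.1 + α.2 ∧ α.1 + α.2 ≤ n + 1 := by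
  simp only [jetOrders, Finset.mem_biUnion, Finset.mem_Icc, Finset.HasAntidiagonal.mem_antidiagonal]
  exact ⟨fun ⟨k, hk, h⟩ => h ▸ hk, fun h => ⟨_, h, rfl⟩⟩

theorem two_mul_card_jetOrders (n : ℕ) : 2 * (jetOrders n).card = (n + 1) * (n + 4) := by
  rw [jetOrders, Finset.card_biUnion]
  · simp only [Finset.Nat.card_antidiagonal]
    induction n with
    | zero => rfl
    | succ n ih =>
      rw [Finset.sum_Icc_succ_top (by omega), mul_add, ih]
      ring
  · intro a _ b _ hab
    refine Finset.disjoint_left.2 fun x hx hx' => hab ?_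
    rw [← Finset.HasAntidiagonal.mem_antidiagonal.1 hx,
      ← Finset.HasAntidiagonal.mem_antidiagonal.1 hx']

/-- Jets of a function, without the value. -/
abbrev JetModule (n : ℕ) : Type := {α // α ∈ jetOrders n} → 𝒪

/-- The component of a jet at a given order, or zero. -/
def jetComp (α : ℕ × ℕ) : JetModule n →ₗ[𝒪] 𝒪 where
  toFun U := if h : α ∈ jetOrders n then U ⟨α, h⟩ else 0
  map_add' U V := by split_ifs <;> simp
  map_smul' c U := by split_ifs <;> simp

/-- The trivial connection on jets of a function. -/
def jetConnection (n : ℕ) : Connection (JetModule n) where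
  nx :=
    { toFun := fun U α => dx (U α) - jetComp (α.1.1 + 1, α.1.2) U
      map_zero' := by funext α; simp
      map_add' := fun U V => by funext α; simp; ring }
  ny :=
    { toFun := fun U α => dy (U α) - jetComp (α.1.1, α.1.2 + 1) U
      map_zero' := by funext α; simp
      map_add' := fun U V => by funext α; simp; ring }
  leibniz_x f U := by funext α; simp; ring
  leibniz_y f U := by funext α; simp; ring

/-- Apart from the derivative of a constant, the connection only shifts the multi-index, and a shift
has no fixed index. -/
theorem basisTrace_jetConnection_nx :
    basisTrace (Pi.basisFun 𝒪 {α // α ∈ jetOrders n}) (jetConnection n).nx = 0 := by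
  refine Finset.sum_eq_zero fun α _ => ?_
  rw [Pi.basisFun_repr, Pi.basisFun_apply]
  change dx ((Pi.single α 1 : JetModule n) α) -
    (if h : (α.1.1 + 1, α.1.2) ∈ jetOrders n then (Pi.single α 1 : JetModule n) ⟨_, h⟩ else 0) = 0
  split_ifs with h
  · rw [Pi.single_eq_same, Pi.single_apply, if_neg fun he => ?_]
    · simp
    · have := congrArg (fun β => β.1.1) he
      simp at this
  · simp

theorem basisTrace_jetConnection_ny :
    basisTrace (Pi.basisFun 𝒪 {α // α ∈ jetOrders n}) (jetConnection n).ny = 0 := by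
  refine Finset.sum_eq_zero fun α _ => ?_
  rw [Pi.basisFun_repr, Pi.basisFun_apply]
  change dy ((Pi.single α 1 : JetModule n) α) -
    (if h : (α.1.1, α.1.2 + 1) ∈ jetOrders n then (Pi.single α 1 : JetModule n) ⟨_, h⟩ else 0) = 0
  split_ifs with h
  · rw [Pi.single_eq_same, Pi.single_apply, if_neg fun he => ?_]
    · simp
    · have := congrArg (fun β => β.1.2) he
      simp at this
  · simp

/-- The jet of the sum of the primitives. -/
def Web.toJet : Ambient n →ₗ[𝒪] JetModule n where
  toFun T α := pair (lowExt n T) (W.jetSum α.1.1 α.1.2)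
  map_add' T T' := by
    funext α
    simp only [map_add, pair_add_left, Pi.add_apply]
  map_smul' c T := by
    funext α
    simp only [map_smul, pair_smul_left, Pi.smul_apply, RingHom.id_apply, smul_eq_mul]

theorem Web.toJet_apply (T : Ambient n) (α : {α // α ∈ jetOrders n}) :
    W.toJet T α = pair (lowExt n T) (W.jetSum α.1.1 α.1.2) := rfl

/-- Orders up to n + 1 do not see the top components; at order n + 2 both sides vanish. The
truncation by zero in the connection on jets therefore agrees with the choice of `topPart`. -/
theorem Web.jetComp_toJet (hW : ∀ i, IsUnit (dy (W.fn i))) (T : Ambient n) {a b : ℕ}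
    (h1 : 1 ≤ a + b) (h2 : a + b ≤ n + 2) :
    jetComp (a, b) (W.toJet T) = pair (W.fullExt T) (W.jetSum a b) := by
  change (if h : (a, b) ∈ jetOrders n then W.toJet T ⟨(a, b), h⟩ else 0) = _
  split_ifs with h
  · rw [W.toJet_apply, W.pair_fullExt_low T (mem_jetOrders.1 h).2]
  · rw [W.pair_fullExt_top hW]
    rw [mem_jetOrders] at h
    dsimp only at h
    omega

/-- The ambient derivative is the dual derivative cut to the orders 1 to n + 1, where `q` is
supported. -/
theorem Web.pair_lowExt_ambient_nx (T : Ambient n) (q : Fin (n + 3) × ℕ →₀ 𝒪)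
    (hq : ∀ i m, n + 1 < m → q (i, m) = 0) (hq0 : ∀ i, q (i, 0) = 0) :
    pair (lowExt n (W.ambient.nx T)) q = pair (W.dualX (W.fullExt T)) q := by
  refine pair_congr fun ⟨i, m⟩ hs => ?_
  cases m with
  | zero => exact absurd (hq0 i) hs
  | succ m =>
    have hm : m < n + 1 := by
      by_contra hm
      exact hs (hq i _ (by omega))
    rw [lowExt_succ, dif_pos hm, W.ambient_nx]

theorem Web.pair_lowExt_ambient_ny (T : Ambient n) (q : Fin (n + 3) × ℕ →₀ 𝒪)
    (hq : ∀ i m, n + 1 < m → q (i, m) = 0) (hq0 : ∀ i, q (i, 0) = 0) :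
    pair (lowExt n (W.ambient.ny T)) q = pair (W.dualY (W.fullExt T)) q := by
  refine pair_congr fun ⟨i, m⟩ hs => ?_
  cases m with
  | zero => exact absurd (hq0 i) hs
  | succ m =>
    have hm : m < n + 1 := by
      by_contra hm
      exact hs (hq i _ (by omega))
    rw [lowExt_succ, dif_pos hm, W.ambient_ny]

/-- The Leibniz rule for the pairing, together with the fact that the derivative of `jetSum a b` is
the next `jetSum`. -/
theorem Web.toJet_nx (hW : ∀ i, IsUnit (dy (W.fn i))) (T : Ambient n) :
    W.toJet (W.ambient.nx T) = (jetConnection n).nx (W.toJet T) := by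
  funext α
  have hα := mem_jetOrders.1 α.2
  change _ = dx (W.toJet T α) - jetComp (α.1.1 + 1, α.1.2) (W.toJet T)
  rw [W.jetComp_toJet hW T (by omega) (by omega), W.toJet_apply, W.toJet_apply,
    ← W.pair_fullExt_low T hα.2, W.dx_pair, W.nx_jetSum, W.pair_lowExt_ambient_nx, add_sub_cancel_right]
  · exact fun i m hm => W.jetSum_apply_of_lt i _ _ m (by omega)
  · exact fun i => W.jetSum_apply_zero i (by omega)

theorem Web.toJet_ny (hW : ∀ i, IsUnit (dy (W.fn i))) (T : Ambient n) :
    W.toJet (W.ambient.ny T) = (jetConnection n).ny (W.toJet T) := by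
  funext α
  have hα := mem_jetOrders.1 α.2
  change _ = dy (W.toJet T α) - jetComp (α.1.1, α.1.2 + 1) (W.toJet T)
  rw [W.jetComp_toJet hW T (by omega) (by omega), W.toJet_apply, W.toJet_apply,
    ← W.pair_fullExt_low T hα.2, W.dy_pair, W.ny_jetSum, W.pair_lowExt_ambient_ny, add_sub_cancel_right]
  · exact fun i m hm => W.jetSum_apply_of_lt i _ _ m (by omega)
  · exact fun i => W.jetSum_apply_zero i (by omega)

/-- The jet is reached order by order. The components of level k + 1 are free to correct the
derivatives of order k + 1, and those of lower order do not involve them. -/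
theorem Web.toJet_surjective (hW : ∀ i, IsUnit (dy (W.fn i))) : Function.Surjective W.toJet := by
  intro U
  have key : ∀ k ≤ n + 1, ∃ T : Fin (n + 3) × ℕ → 𝒪,
      ∀ α (hα : α ∈ jetOrders n), α.1 + α.2 ≤ k → pair T (W.jetSum α.1 α.2) = U ⟨α, hα⟩ := by
    intro k
    induction k with
    | zero =>
      refine fun _ => ⟨0, fun α hα h => ?_⟩
      have := mem_jetOrders.1 hα
      omega
    | succ k ih =>
      intro hk
      obtain ⟨T, hT⟩ := ih (by omega)
      -- Only the equations with a ≤ k + 1 are meaningful. For larger `a` the subtraction truncates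
      -- and the right-hand side is arbitrary, serving only to complete the system to a square one.
      obtain ⟨t, ht⟩ := Web.exists_solution hW (k + 1)
        (fun a : Fin (n + 3) => jetComp ((a : ℕ), k + 1 - a) U - pair T (W.jetSum a (k + 1 - a)))
      refine ⟨T + fun s => if s.2 = k + 1 then t s.1 else 0, fun α hα h => ?_⟩
      rw [pair_add_left, pair_level]
      rcases Nat.lt_or_ge (α.1 + α.2) (k + 1) with hlt | hge
      · rw [hT α hα (by omega), Finset.sum_eq_zero, add_zero]
        intro i _
        rw [W.jetSum_apply_of_lt i _ _ _ hlt, zero_mul]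
      · obtain ⟨a, b⟩ := α
        dsimp only at h hge ⊢
        obtain rfl : b = k + 1 - a := by omega
        have h2 := ht ⟨a, by omega⟩
        have h3 : ∀ i, W.jetSum a (k + 1 - a) (i, k + 1) = dy (W.fn i) ^ (k + 1) * W.ratio i ^ a := by
          intro i
          have h1 := W.jetSum_apply_top i a (k + 1 - a)
          rwa [show a + (k + 1 - a) = k + 1 by omega, Web.dx_pow_mul hW i (by omega)] at h1
        simp only at h2
        simp only [h3, h2]
        have h4 : jetComp (a, k + 1 - a) U = U ⟨(a, k + 1 - a), hα⟩ := dif_pos hα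
        rw [h4]
        ring
  obtain ⟨T, hT⟩ := key (n + 1) le_rfl
  refine ⟨fun s => T (s.1, (s.2 : ℕ) + 1), ?_⟩
  funext α
  have hα := mem_jetOrders.1 α.2
  rw [W.toJet_apply, ← hT α.1 α.2 hα.2]
  refine pair_congr fun ⟨i, m⟩ hs => ?_
  cases m with
  | zero => exact absurd (W.jetSum_apply_zero i (by omega)) hs
  | succ m =>
    have hm : m < n + 1 := by
      by_contra hm
      exact hs (W.jetSum_apply_of_lt i _ _ _ (by omega))
    rw [lowExt_succ, dif_pos hm]

/-! ### The trace of the ambient connection -/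

/-- The coefficient of the trace of the ambient connection on the differential of `fn i`,
multiplied by two. -/
def Web.traceCoeff {d : ℕ} (W : Web d) (i : Fin d) : 𝒪 :=
  ∑ k ∈ Finset.univ.erase i, ∑ l ∈ (Finset.univ.erase i).erase k,
    slopeHess (W.fn i) (W.ratio k) (W.ratio l) *
      Ring.inverse (dx (W.fn i) - W.ratio k * dy (W.fn i)) *
      Ring.inverse (dx (W.fn i) - W.ratio l * dy (W.fn i))

/-- The Lagrange polynomial at node `i` is the frozen product over the other foliations. On the
basis vector of order n + 1 it picks out the subprincipal part of the derivatives of a function of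
`fn i`, and the normalising factor is the principal part. -/
theorem Web.two_mul_topPart_single (hW : ∀ i, IsUnit (dy (W.fn i))) (i : Fin (n + 3)) :
    2 * W.topPart (Pi.single (i, Fin.last n) 1) i = - W.traceCoeff i := by
  have hlow : ∀ (j : Fin (n + 3)) (m : ℕ), lowExt n (Pi.single (i, Fin.last n) 1) (j, m) =
      if (j, m) = (i, n + 1) then 1 else 0 := by
    intro j m
    cases m with
    | zero => rw [lowExt_zero, if_neg (by simp)]
    | succ m =>
      rw [lowExt_succ]
      by_cases h : m < n + 1
      · rw [dif_pos h, Pi.single_apply]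
        simp [Prod.ext_iff, Fin.ext_iff]
      · rw [dif_neg h, if_neg]
        simp
        omega
  have hpair : ∀ q : Fin (n + 3) × ℕ →₀ 𝒪,
      pair (lowExt n (Pi.single (i, Fin.last n) 1)) q = q (i, n + 1) := by
    intro q
    rw [pair_eq_sum (k := n + 1) (fun j m hm => by rw [hlow, if_neg (by simp [hm])])]
    simp [hlow]
  -- The functional reads the coefficient of order n + 1 of a derivative of order n + 2, that is,
  -- the subsymbol.
  have hfrozen : ∑ a : Fin (n + 3), (coNodal W.ratio i).coeff a *
      pair (lowExt n (Pi.single (i, Fin.last n) 1)) (W.jetSum a (n + 2 - a)) =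
      frozenOp W.ratio (Finset.univ.erase i) (W.subsymbol i) := by
    have hcard : (Finset.univ.erase i).card = n + 2 := by simp
    rw [frozenOp, hcard, Finset.sum_range]
    refine Finset.sum_congr rfl fun a _ => ?_
    have ha : (a : ℕ) + (n + 2 - a) = n + 2 := by have := a.2; omega
    rw [hpair, Web.subsymbol, ha, if_neg (by omega)]
    rfl
  have hs : ∀ j ∈ Finset.univ.erase i, IsUnit (dx (W.fn i) - W.ratio j * dy (W.fn i)) :=
    fun j hj => Web.isUnit_dx_sub hW (Finset.ne_of_mem_erase hj).symm
  have key := two_mul_frozenOp_subsymbol W.ratio (W.fn i) (Finset.univ.erase i) hs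
    (W.subsymbol i) (W.subsymbol_zero i) (W.subsymbol_succ_left i) (W.subsymbol_succ_right i)
  have hprod : ∏ j ∈ Finset.univ.erase i, (dx (W.fn i) - W.ratio j * dy (W.fn i)) =
      dy (W.fn i) ^ (n + 2) * (coNodal W.ratio i).eval (W.ratio i) := by
    have hcard : (Finset.univ.erase i).card = n + 2 := by simp
    rw [eval_coNodal_self, ← hcard, ← Finset.prod_const, ← Finset.prod_mul_distrib]
    refine Finset.prod_congr rfl fun j _ => ?_
    rw [mul_sub, mul_comm _ (W.ratio i), Web.ratio_mul hW]
    ring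
  change 2 * (- Ring.inverse (dy (W.fn i) ^ (n + 2) * (coNodal W.ratio i).eval (W.ratio i)) *
    ∑ a : Fin (n + 3), (coNodal W.ratio i).coeff a *
      pair (lowExt n (Pi.single (i, Fin.last n) 1)) (W.jetSum a (n + 2 - a))) = _
  rw [hfrozen]
  rw [hprod] at key
  have hu := Ring.inverse_mul_cancel _ (((hW i).pow (n + 2)).mul
    (isUnit_eval_coNodal (Web.isUnit_ratio_sub hW) i))
  unfold Web.traceCoeff
  linear_combination (-Ring.inverse (dy (W.fn i) ^ (n + 2) *
    (coNodal W.ratio i).eval (W.ratio i))) * key - (∑ k ∈ Finset.univ.erase i,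
    ∑ l ∈ (Finset.univ.erase i).erase k,
    slopeHess (W.fn i) (W.ratio k) (W.ratio l) *
      Ring.inverse (dx (W.fn i) - W.ratio k * dy (W.fn i)) *
      Ring.inverse (dx (W.fn i) - W.ratio l * dy (W.fn i))) * hu

/-- The index `m` stands for the order m + 1, so the next order is m + 2. It is occupied only when
it is the solved order n + 2. -/
theorem Web.fullExt_single (i : Fin (n + 3)) (m : Fin (n + 1)) :
    W.fullExt (Pi.single (i, m) 1) (i, (m : ℕ) + 1 + 1) =
      if m = Fin.last n then W.topPart (Pi.single (i, m) 1) i else 0 := by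
  have h1 : lowExt n (Pi.single (i, m) 1) (i, (m : ℕ) + 1 + 1) = 0 := by
    rw [lowExt_succ]
    split_ifs with h
    · rw [Pi.single_eq_of_ne]
      simp [Prod.ext_iff, Fin.ext_iff]
    · rfl
  rw [W.fullExt_apply, h1, zero_add]
  congr 1
  simp [Fin.ext_iff]

/-- The part Φ^{(m)} ↦ Φ^{(m+1)} of the connection is strictly triangular, so only the last order
has a diagonal entry, coming from the solved top component. -/
theorem Web.two_mul_basisTrace_nx (hW : ∀ i, IsUnit (dy (W.fn i))) :
    2 * basisTrace (Pi.basisFun 𝒪 (Fin (n + 3) × Fin (n + 1))) W.ambient.nx =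
      ∑ i, W.traceCoeff i * dx (W.fn i) := by
  unfold basisTrace
  rw [Fintype.sum_prod_type, Finset.mul_sum]
  refine Finset.sum_congr rfl fun i _ => ?_
  have h : ∀ m, (Pi.basisFun 𝒪 (Fin (n + 3) × Fin (n + 1))).repr
      (W.ambient.nx (Pi.basisFun 𝒪 (Fin (n + 3) × Fin (n + 1)) (i, m))) (i, m) =
      - dx (W.fn i) * if m = Fin.last n then W.topPart (Pi.single (i, m) 1) i else 0 := by
    intro m
    rw [Pi.basisFun_repr, Pi.basisFun_apply, W.ambient_nx, Web.dualX, W.fullExt_single,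
      W.fullExt_of_le _ _ (by have := m.2; omega), lowExt_succ, dif_pos m.2, Pi.single_eq_same, Derivation.map_one_eq_zero]
    ring
  simp only [h, ← Finset.mul_sum, Finset.sum_ite_eq', Finset.mem_univ, if_true]
  linear_combination (-dx (W.fn i)) * W.two_mul_topPart_single hW i

theorem Web.two_mul_basisTrace_ny (hW : ∀ i, IsUnit (dy (W.fn i))) :
    2 * basisTrace (Pi.basisFun 𝒪 (Fin (n + 3) × Fin (n + 1))) W.ambient.ny =
      ∑ i, W.traceCoeff i * dy (W.fn i) := by
  unfold basisTrace
  rw [Fintype.sum_prod_type, Finset.mul_sum]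
  refine Finset.sum_congr rfl fun i _ => ?_
  have h : ∀ m, (Pi.basisFun 𝒪 (Fin (n + 3) × Fin (n + 1))).repr
      (W.ambient.ny (Pi.basisFun 𝒪 (Fin (n + 3) × Fin (n + 1)) (i, m))) (i, m) =
      - dy (W.fn i) * if m = Fin.last n then W.topPart (Pi.single (i, m) 1) i else 0 := by
    intro m
    rw [Pi.basisFun_repr, Pi.basisFun_apply, W.ambient_ny, Web.dualY, W.fullExt_single,
      W.fullExt_of_le _ _ (by have := m.2; omega), lowExt_succ, dif_pos m.2, Pi.single_eq_same, Derivation.map_one_eq_zero]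
    ring
  simp only [h, ← Finset.mul_sum, Finset.sum_ite_eq', Finset.mem_univ, if_true]
  linear_combination (-dy (W.fn i)) * W.two_mul_topPart_single hW i

end Ambient

end WebGeometry

namespace WebGeometry

/-! ### Submodules spanned by derivatives -/

namespace Connection

variable {M N : Type} [AddCommGroup M] [Module 𝒪 M] [AddCommGroup N] [Module 𝒪 N] {ι : Type}

/-- The span of the derivatives of order less than `k` of a family of elements. -/
def derivSpan (D : Connection M) (v : ι → M) (k : ℕ) : Submodule 𝒪 M :=
  Submodule.span 𝒪 {x | ∃ i a b, a + b < k ∧ x = D.iter a b (v i)}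

theorem iter_mem_derivSpan (D : Connection M) (v : ι → M) {k a b : ℕ} (i : ι) (h : a + b < k) :
    D.iter a b (v i) ∈ D.derivSpan v k := Submodule.subset_span ⟨i, a, b, h, rfl⟩

theorem derivSpan_mono (D : Connection M) (v : ι → M) {k k' : ℕ} (h : k ≤ k') :
    D.derivSpan v k ≤ D.derivSpan v k' := by
  refine Submodule.span_mono ?_
  rintro _ ⟨i, a, b, hab, rfl⟩
  exact ⟨i, a, b, hab.trans_le h, rfl⟩

theorem nx_mem_derivSpan (D : Connection M) (v : ι → M) {k : ℕ} {x : M}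
    (hx : x ∈ D.derivSpan v k) : D.nx x ∈ D.derivSpan v (k + 1) := by
  induction hx using Submodule.span_induction with
  | mem x hx =>
    obtain ⟨i, a, b, hab, rfl⟩ := hx
    rw [nx_iter]
    exact iter_mem_derivSpan D v i (by omega)
  | zero => simp
  | add x y _ _ hx hy => rw [map_add]; exact add_mem hx hy
  | smul c x hx h =>
    rw [D.leibniz_x]
    exact add_mem (Submodule.smul_mem _ _ (derivSpan_mono D v (Nat.le_succ k) hx))
      (Submodule.smul_mem _ _ h)

theorem ny_mem_derivSpan {D : Connection M} (hD : D.Flat) (v : ι → M) {k : ℕ} {x : M}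
    (hx : x ∈ D.derivSpan v k) : D.ny x ∈ D.derivSpan v (k + 1) := by
  induction hx using Submodule.span_induction with
  | mem x hx =>
    obtain ⟨i, a, b, hab, rfl⟩ := hx
    rw [ny_iter hD]
    exact iter_mem_derivSpan D v i (by omega)
  | zero => simp
  | add x y _ _ hx hy => rw [map_add]; exact add_mem hx hy
  | smul c x hx h =>
    rw [D.leibniz_y]
    exact add_mem (Submodule.smul_mem _ _ (derivSpan_mono D v (Nat.le_succ k) hx))
      (Submodule.smul_mem _ _ h)

/-- The derivation with respect to `f`, along the curves `x = constant`. -/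
def transverse (D : Connection M) (f : 𝒪) : M →+ M :=
  (DistribSMul.toAddMonoidHom M (Ring.inverse (dy f))).comp D.ny

theorem transverse_apply (D : Connection M) (f : 𝒪) (s : M) :
    D.transverse f s = Ring.inverse (dy f) • D.ny s := rfl

theorem iterate_transverse_mem {D : Connection M} (hD : D.Flat) (v : ι → M) (f : 𝒪) {k : ℕ} {x : M}
    (hx : x ∈ D.derivSpan v k) (m : ℕ) : (D.transverse f)^[m] x ∈ D.derivSpan v (k + m) := by
  induction m with
  | zero => exact hx
  | succ m ih =>
    rw [Function.iterate_succ_apply', transverse_apply]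
    exact Submodule.smul_mem _ _ (ny_mem_derivSpan hD v ih)

theorem derivation_inverse (δ : Derivation ℤ 𝒪 𝒪) {f : 𝒪} (hf : IsUnit f) :
    δ (Ring.inverse f) = - (Ring.inverse f ^ 2 * δ f) := by
  have h1 := Ring.mul_inverse_cancel _ hf
  have h2 : δ (f * Ring.inverse f) = 0 := by rw [h1, Derivation.map_one_eq_zero]
  rw [Derivation.leibniz, smul_eq_mul, smul_eq_mul] at h2
  linear_combination Ring.inverse f * h2 - δ (Ring.inverse f) * h1

/-- In the coordinates (x, f) the operator `transverse f` is ∂/∂f and `nx - dx f • transverse f` is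
∂/∂x at constant f. These commute because the connection is flat. -/
theorem nx_iterate_transverse {D : Connection M} (hD : D.Flat) {f : 𝒪} (hf : IsUnit (dy f)) (s : M)
    (m : ℕ) : D.nx ((D.transverse f)^[m] s) = dx f • (D.transverse f)^[m + 1] s +
      (D.transverse f)^[m] (D.nx s - dx f • D.transverse f s) := by
  have hcomm : ∀ s, D.nx (D.transverse f s) - dx f • D.transverse f (D.transverse f s) =
      D.transverse f (D.nx s - dx f • D.transverse f s) := by
    intro s
    simp only [transverse_apply, D.leibniz_x, D.leibniz_y, map_sub, smul_add, smul_smul,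
      Derivation.leibniz, smul_eq_mul, derivation_inverse _ hf, hD s, dx_dy_comm]
    module
  induction m generalizing s with
  | zero => simp
  | succ m ih =>
    rw [Function.iterate_succ_apply, ih, hcomm, ← Function.iterate_succ_apply,
      ← Function.iterate_succ_apply]

theorem ny_iterate_transverse (D : Connection M) {f : 𝒪} (hf : IsUnit (dy f)) (s : M) (m : ℕ) :
    D.ny ((D.transverse f)^[m] s) = dy f • (D.transverse f)^[m + 1] s := by
  rw [Function.iterate_succ_apply', transverse_apply, smul_smul, Ring.mul_inverse_cancel _ hf,
    one_smul]

/-- The failure of a linear map to commute with the derivatives along `x` is linear. -/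
def commX (D : Connection M) (D' : Connection N) (φ : M →ₗ[𝒪] N) : M →ₗ[𝒪] N where
  toFun s := φ (D.nx s) - D'.nx (φ s)
  map_add' s t := by simp only [map_add]; abel
  map_smul' f s := by simp only [D.leibniz_x, D'.leibniz_x, map_add, map_smul, RingHom.id_apply]; module

/-- The failure of a linear map to commute with the derivatives along `y` is linear. -/
def commY (D : Connection M) (D' : Connection N) (φ : M →ₗ[𝒪] N) : M →ₗ[𝒪] N where
  toFun s := φ (D.ny s) - D'.ny (φ s)
  map_add' s t := by simp only [map_add]; abel
  map_smul' f s := by simp only [D.leibniz_y, D'.leibniz_y, map_add, map_smul, RingHom.id_apply]; module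

theorem map_mem_of_single {κ : Type} (φ : (κ →₀ 𝒪) →ₗ[𝒪] M) (S : Submodule 𝒪 M) (q : κ →₀ 𝒪)
    (h : ∀ s, q s ≠ 0 → φ (Finsupp.single s 1) ∈ S) : φ q ∈ S := by
  have : φ q = ∑ s ∈ q.support, q s • φ (Finsupp.single s 1) := by
    conv_lhs => rw [← Finsupp.sum_single q, Finsupp.sum, map_sum]
    refine Finset.sum_congr rfl fun s _ => ?_
    rw [← map_smul, Finsupp.smul_single, smul_eq_mul, mul_one]
  rw [this]
  exact Submodule.sum_mem _ fun s hs => Submodule.smul_mem _ _ (h s (Finsupp.mem_support_iff.1 hs))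

end Connection

/-! ### The free module on the derivatives of the unknowns -/

section JetDual

variable {r : ℕ}

/-- The free module on the derivatives of `r` unknowns, with its flat connection. -/
def jetDual (r : ℕ) : Connection (Fin r × ℕ × ℕ →₀ 𝒪) :=
  Connection.free (fun s => Finsupp.single (s.1, s.2.1 + 1, s.2.2) 1)
    (fun s => Finsupp.single (s.1, s.2.1, s.2.2 + 1) 1)

theorem jetDual_nx_single (l : Fin r) (a b : ℕ) : (jetDual r).nx (Finsupp.single (l, a, b) 1) =
    Finsupp.single (l, a + 1, b) 1 := Connection.free_nx_single _ _ _

theorem jetDual_ny_single (l : Fin r) (a b : ℕ) : (jetDual r).ny (Finsupp.single (l, a, b) 1) =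
    Finsupp.single (l, a, b + 1) 1 := Connection.free_ny_single _ _ _

theorem jetDual_flat (r : ℕ) : (jetDual r).Flat := by
  refine Connection.free_flat _ _ fun s => ?_
  change (jetDual r).nx _ = (jetDual r).ny _
  rw [jetDual_nx_single, jetDual_ny_single]

/-- The unknowns. -/
def unknown (l : Fin r) : Fin r × ℕ × ℕ →₀ 𝒪 := Finsupp.single (l, 0, 0) 1

theorem iter_unknown (l : Fin r) (a b : ℕ) :
    (jetDual r).iter a b (unknown l) = Finsupp.single (l, a, b) 1 := by
  revert a b
  refine orderInduction rfl (fun a b h => ?_) (fun a b h => ?_)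
  · rw [← Connection.nx_iter, h, jetDual_nx_single]
  · rw [← Connection.ny_iter (jetDual_flat r), h, jetDual_ny_single]

theorem apply_eq_zero_of_mem_derivSpan {k : ℕ} {q : Fin r × ℕ × ℕ →₀ 𝒪}
    (hq : q ∈ (jetDual r).derivSpan unknown k) {s : Fin r × ℕ × ℕ} (hs : k ≤ s.2.1 + s.2.2) :
    q s = 0 := by
  induction hq using Submodule.span_induction with
  | mem x hx =>
    obtain ⟨i, a, b, hab, rfl⟩ := hx
    rw [iter_unknown, Finsupp.single_eq_of_ne]
    rintro rfl
    dsimp only at hs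
    omega
  | zero => rfl
  | add x y _ _ hx hy => rw [Finsupp.add_apply, hx, hy, add_zero]
  | smul c x _ h => rw [Finsupp.smul_apply, h, smul_zero]

/-- The functional of a jet, extended by zero. -/
def jetFun {k : ℕ} : Jet k r →ₗ[𝒪] (Fin r × ℕ × ℕ → 𝒪) where
  toFun u s := if h : s.2.1 + s.2.2 ≤ k then u ⟨s.2, h⟩ s.1 else 0
  map_add' u v := by
    funext s
    simp only [Pi.add_apply]
    split_ifs <;> simp
  map_smul' c u := by
    funext s
    simp only [Pi.smul_apply, RingHom.id_apply]
    split_ifs <;> simp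

theorem jetFun_apply {k : ℕ} (u : Jet k r) (β : JetIndex k) (l : Fin r) :
    jetFun u (l, β.1.1, β.1.2) = u β l := dif_pos β.2

theorem pair_jetFun_iter {k : ℕ} (u : Jet k r) (β : JetIndex k) (l : Fin r) :
    u β l = pair (jetFun u) ((jetDual r).iter β.1.1 β.1.2 (unknown l)) := by
  rw [iter_unknown, pair, Finsupp.linearCombination_single, jetFun_apply, one_smul]

/-- The linear map that commutes with derivatives and has prescribed values on the unknowns. -/
def derivLift {M : Type} [AddCommGroup M] [Module 𝒪 M] (D : Connection M) (c : Fin r → M) :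
    (Fin r × ℕ × ℕ →₀ 𝒪) →ₗ[𝒪] M :=
  Finsupp.linearCombination 𝒪 fun s => D.iter s.2.1 s.2.2 (c s.1)

variable {M : Type} [AddCommGroup M] [Module 𝒪 M] {D : Connection M}

theorem derivLift_single (c : Fin r → M) (l : Fin r) (a b : ℕ) :
    derivLift D c (Finsupp.single (l, a, b) 1) = D.iter a b (c l) := by
  simp [derivLift]

theorem derivLift_ny (hD : D.Flat) (c : Fin r → M) (q : Fin r × ℕ × ℕ →₀ 𝒪) :
    derivLift D c ((jetDual r).ny q) = D.ny (derivLift D c q) := by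
  have : Connection.commY (jetDual r) D (derivLift D c) q ∈ (⊥ : Submodule 𝒪 M) := by
    refine Connection.map_mem_of_single _ _ _ fun ⟨l, a, b⟩ _ => ?_
    rw [Submodule.mem_bot]
    change derivLift D c ((jetDual r).ny _) - D.ny (derivLift D c _) = 0
    rw [jetDual_ny_single, derivLift_single, derivLift_single, Connection.ny_iter hD, sub_self]
  exact sub_eq_zero.1 ((Submodule.mem_bot 𝒪).1 this)

theorem derivLift_transverse (hD : D.Flat) (c : Fin r → M) (f : 𝒪) (q : Fin r × ℕ × ℕ →₀ 𝒪)
    (m : ℕ) : derivLift D c (((jetDual r).transverse f)^[m] q) =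
      (D.transverse f)^[m] (derivLift D c q) := by
  induction m with
  | zero => rfl
  | succ m ih =>
    rw [Function.iterate_succ_apply', Function.iterate_succ_apply', ← ih,
      Connection.transverse_apply, Connection.transverse_apply, map_smul, derivLift_ny hD]

end JetDual

/-! ### The slopes of a web -/

section Slopes

variable {n : ℕ} (W : Web (n + 3))

/-- The slope of a foliation of the web. -/
def Web.slope {d : ℕ} (W : Web d) (i : Fin d) : 𝒪 := - W.ratio i

/-- The inverse of the derivative at a root of the polynomial with the slopes as roots and
leading coefficient `a₀`. -/
def Web.weight {d : ℕ} (W : Web d) (a₀ : 𝒪) (i : Fin d) : 𝒪 :=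
  Ring.inverse (a₀ * (coNodal W.slope i).eval (W.slope i))

variable {W} {a₀ : 𝒪} (ha : IsUnit a₀) (hW : ∀ i, IsUnit (dy (W.fn i)))

include hW

theorem Web.isUnit_slope_sub (i j : Fin (n + 3)) (h : i ≠ j) : IsUnit (W.slope i - W.slope j) := by
  have : W.slope i - W.slope j = W.ratio j - W.ratio i := by
    simp only [Web.slope]
    ring
  rw [this]
  exact Web.isUnit_ratio_sub hW j i h.symm

theorem Web.slope_mul (i : Fin (n + 3)) : W.slope i * dy (W.fn i) = - dx (W.fn i) := by
  rw [Web.slope, neg_mul, Web.ratio_mul hW]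

include ha

theorem Web.isUnit_denominator (i : Fin (n + 3)) :
    IsUnit (a₀ * (coNodal W.slope i).eval (W.slope i)) :=
  ha.mul (isUnit_eval_coNodal (Web.isUnit_slope_sub hW) i)

theorem Web.sum_weight (a b : Fin (n + 3)) :
    ∑ i, a₀ * (coNodal W.slope i).coeff a * (W.slope i ^ (b : ℕ) * W.weight a₀ i) =
      if a = b then 1 else 0 := by
  rw [← lagrange_dual (Web.isUnit_slope_sub hW) a b]
  refine Finset.sum_congr rfl fun i _ => ?_
  have hc := Ring.mul_inverse_cancel _ ha
  rw [Web.weight, Ring.mul_inverse_rev]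
  linear_combination ((coNodal W.slope i).coeff a *
    Ring.inverse ((coNodal W.slope i).eval (W.slope i)) * W.slope i ^ (b : ℕ)) * hc

/-- The coefficient of top degree in Lagrange interpolation of a polynomial of degree less than n +
2 is zero. For the exponents `l` and `l + 1` this says that the forms on the sheets add up to zero.
-/
theorem Web.sum_pow_mul_weight {b : ℕ} (hb : b < n + 2) :
    ∑ i, W.slope i ^ b * W.weight a₀ i = 0 := by
  have h := Web.sum_weight ha hW (Fin.last (n + 2)) ⟨b, by omega⟩
  have hne : Fin.last (n + 2) ≠ ⟨b, by omega⟩ := by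
    intro h
    have := congrArg Fin.val h
    simp at this
    omega
  rw [if_neg hne] at h
  have hc : ∀ i, (coNodal W.slope i).coeff (Fin.last (n + 2) : Fin (n + 3)) = 1 :=
    fun i => coeff_coNodal_top W.slope i
  simp only [hc, mul_one, ← Finset.mul_sum] at h
  exact ha.mul_right_eq_zero.1 h

/-- Recovering the coefficients from the values at the slopes. -/
theorem Web.interpolation_left {M : Type} [AddCommGroup M] [Module 𝒪 M] {k : ℕ} (hk : k ≤ n + 3)
    (s : Fin k → M) (e : Fin k) :
    ∑ i, (a₀ * (coNodal W.slope i).coeff e) •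
      ∑ e' : Fin k, (W.slope i ^ (e' : ℕ) * W.weight a₀ i) • s e' = s e := by
  simp only [Finset.smul_sum, smul_smul]
  rw [Finset.sum_comm]
  simp only [← Finset.sum_smul]
  have h := fun e' : Fin k => Web.sum_weight ha hW (Fin.castLE hk e) (Fin.castLE hk e')
  simp only [Fin.val_castLE, Fin.castLE_inj] at h
  simp [h]

/-- Interpolation at the slopes. -/
theorem Web.interpolation_right (i k : Fin (n + 3)) :
    ∑ a : Fin (n + 3), W.slope i ^ (a : ℕ) * W.weight a₀ i * (a₀ * (coNodal W.slope k).coeff a) =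
      if i = k then 1 else 0 := by
  have h : ∑ a : Fin (n + 3), W.slope i ^ (a : ℕ) * W.weight a₀ i *
      (a₀ * (coNodal W.slope k).coeff a) =
      W.weight a₀ i * (a₀ * (coNodal W.slope k).eval (W.slope i)) := by
    rw [← sum_coeff_coNodal, Finset.mul_sum, Finset.mul_sum]
    exact Finset.sum_congr rfl fun _ _ => by ring
  rw [h]
  split_ifs with hik
  · subst hik
    exact Ring.inverse_mul_cancel _ (Web.isUnit_denominator ha hW i)
  · rw [eval_coNodal_of_ne _ hik, mul_zero, mul_zero]

end Slopes

/-! ### The system of a web -/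

section System

variable {n : ℕ} (W : Web (n + 3)) (a₀ : 𝒪)

/-- The coefficients of the unknowns in the form on the sheet `i`. -/
def Web.sheetCoeff (i : Fin (n + 3)) (l : ℕ) : 𝒪 := W.slope i ^ l * W.weight a₀ i

/-- The matrix `A` is that of the system of the web. -/
def Web.HasMatrix (A : Matrix (Fin (n + 2)) (Fin (n + 1)) 𝒪) : Prop :=
  ∀ i (l : Fin (n + 1)), ∑ e : Fin (n + 2), W.sheetCoeff a₀ i e * A e l =
    dx (W.sheetCoeff a₀ i l) + dy (W.slope i * W.sheetCoeff a₀ i l)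

variable {W a₀} {A : Matrix (Fin (n + 2)) (Fin (n + 1)) 𝒪}

/-- This is dω on the sheet `i`, written as ∂_x(w) + ∂_y(p w) for ω = w(dy - p dx), with values in
an arbitrary module with connection: the powers of the slope absorb the shift of index in the ∂_y
terms, and `A` absorbs the derivatives of the coefficients. -/
theorem Web.HasMatrix.sum_system (hA : W.HasMatrix a₀ A) {M : Type} [AddCommGroup M] [Module 𝒪 M]
    (D : Connection M) (c : Fin (n + 1) → M) (i : Fin (n + 3)) :
    ∑ e : Fin (n + 2), W.sheetCoeff a₀ i e • D.system A c e =
      D.nx (∑ l : Fin (n + 1), W.sheetCoeff a₀ i l • c l) + 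
        D.ny (W.slope i • ∑ l : Fin (n + 1), W.sheetCoeff a₀ i l • c l) := by
  have h1 : ∑ e : Fin (n + 2), W.sheetCoeff a₀ i e •
      (Fin.snoc (fun l => D.nx (c l)) 0 : Fin (n + 2) → M) e =
      ∑ l : Fin (n + 1), W.sheetCoeff a₀ i l • D.nx (c l) := by
    rw [Fin.sum_univ_castSucc]
    simp
  have h2 : ∑ e : Fin (n + 2), W.sheetCoeff a₀ i e •
      (Fin.cons 0 (fun l => D.ny (c l)) : Fin (n + 2) → M) e =
      ∑ l : Fin (n + 1), (W.slope i * W.sheetCoeff a₀ i l) • D.ny (c l) := by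
    rw [Fin.sum_univ_succ]
    simp only [Fin.cons_zero, smul_zero, Fin.cons_succ, zero_add, Fin.val_succ]
    refine Finset.sum_congr rfl fun l _ => ?_
    congr 1
    simp only [Web.sheetCoeff]
    ring
  have h3 : ∑ e : Fin (n + 2), W.sheetCoeff a₀ i e • ∑ l, A e l • c l =
      ∑ l : Fin (n + 1), (dx (W.sheetCoeff a₀ i l) + dy (W.slope i * W.sheetCoeff a₀ i l)) • c l := by
    simp only [Finset.smul_sum, smul_smul]
    rw [Finset.sum_comm]
    refine Finset.sum_congr rfl fun l _ => ?_
    rw [← Finset.sum_smul, hA i l]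
  simp only [Connection.system, smul_add, Finset.sum_add_distrib, h1, h2, h3]
  simp only [Finset.smul_sum, map_sum, smul_smul, D.leibniz_x, D.leibniz_y, add_smul,
    Finset.sum_add_distrib]
  abel

variable (W a₀) in
/-- The combination of the unknowns in the form on the sheet `i`, divided by `∂_y(fn i)`. -/
def Web.sheetUnknown (i : Fin (n + 3)) : Fin (n + 1) × ℕ × ℕ →₀ 𝒪 :=
  Ring.inverse (dy (W.fn i)) • ∑ l : Fin (n + 1), W.sheetCoeff a₀ i l • unknown l

variable (W a₀) in
/-- The images of the derivatives of the primitives. -/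
def Web.primLift : (Fin (n + 3) × ℕ →₀ 𝒪) →ₗ[𝒪] (Fin (n + 1) × ℕ × ℕ →₀ 𝒪) :=
  Finsupp.linearCombination 𝒪 fun s => match s with
    | (_, 0) => 0
    | (i, m + 1) => ((jetDual (n + 1)).transverse (W.fn i))^[m] (W.sheetUnknown a₀ i)

theorem Web.primLift_zero (i : Fin (n + 3)) :
    W.primLift a₀ (Finsupp.single (i, 0) 1) = 0 := by
  rw [Web.primLift, Finsupp.linearCombination_single, one_smul]

theorem Web.primLift_succ (i : Fin (n + 3)) (m : ℕ) : W.primLift a₀ (Finsupp.single (i, m + 1) 1) =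
    ((jetDual (n + 1)).transverse (W.fn i))^[m] (W.sheetUnknown a₀ i) := by
  rw [Web.primLift, Finsupp.linearCombination_single, one_smul]

variable (A) in
/-- The equations of the system. -/
def equation : Fin (n + 2) → (Fin (n + 1) × ℕ × ℕ →₀ 𝒪) :=
  (jetDual (n + 1)).system A unknown

theorem Web.sheetUnknown_mem (i : Fin (n + 3)) :
    W.sheetUnknown a₀ i ∈ (jetDual (n + 1)).derivSpan unknown 1 :=
  Submodule.smul_mem _ _ (Submodule.sum_mem _ fun l _ => Submodule.smul_mem _ _
    (Connection.iter_mem_derivSpan (jetDual (n + 1)) unknown (a := 0) (b := 0) l (by omega)))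

variable (hW : ∀ i, IsUnit (dy (W.fn i)))

include hW

theorem Web.smul_sheetUnknown (i : Fin (n + 3)) : dy (W.fn i) • W.sheetUnknown a₀ i =
    ∑ l : Fin (n + 1), W.sheetCoeff a₀ i l • unknown l := by
  rw [Web.sheetUnknown, smul_smul, Ring.mul_inverse_cancel _ (hW i), one_smul]

/-- The form ∂_y(F_i)(dy - p_i dx) is dF_i, which is closed, so d(x dF_i) = dx ∧ dF_i. -/
theorem nx_add_ny_slope {M : Type} [AddCommGroup M] [Module 𝒪 M] (D : Connection M) (i : Fin (n + 3))
    (x : M) : D.nx (dy (W.fn i) • x) + D.ny (W.slope i • dy (W.fn i) • x) =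
      dy (W.fn i) • D.nx x - dx (W.fn i) • D.ny x := by
  rw [smul_smul, Web.slope_mul hW, D.leibniz_x, D.leibniz_y, map_neg, dx_dy_comm]
  module

/-- Closedness of ω on the sheet says that w / ∂_yF_i is constant on the leaves. Modulo the
equations, its derivative along the leaf therefore vanishes. -/
theorem Web.longitudinal_sheetUnknown_mem (hA : W.HasMatrix a₀ A) (i : Fin (n + 3)) :
    (jetDual (n + 1)).nx (W.sheetUnknown a₀ i) -
      dx (W.fn i) • (jetDual (n + 1)).transverse (W.fn i) (W.sheetUnknown a₀ i) ∈
      (jetDual (n + 1)).derivSpan (equation A) 1 := by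
  have h1 := hA.sum_system (jetDual (n + 1)) unknown i
  rw [← Web.smul_sheetUnknown hW, nx_add_ny_slope hW] at h1
  have h2 : (jetDual (n + 1)).nx (W.sheetUnknown a₀ i) -
      dx (W.fn i) • (jetDual (n + 1)).transverse (W.fn i) (W.sheetUnknown a₀ i) =
      Ring.inverse (dy (W.fn i)) • ∑ e : Fin (n + 2), W.sheetCoeff a₀ i e •
        (jetDual (n + 1)).system A unknown e := by
    rw [h1, smul_sub, smul_smul, Ring.inverse_mul_cancel _ (hW i), one_smul,
      Connection.transverse_apply, smul_comm]
  rw [h2]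
  exact Submodule.smul_mem _ _ (Submodule.sum_mem _ fun e _ => Submodule.smul_mem _ _
    (Connection.iter_mem_derivSpan (jetDual (n + 1)) (equation A) (a := 0) (b := 0) e (by omega)))

/-- The defect of commutation is linear, so it can be tested on basis vectors. There it is a
transverse derivative of the longitudinal derivative, and the bound on the order of `q` bounds the
number of derivatives of the equations. -/
theorem Web.primLift_nx_mem (hA : W.HasMatrix a₀ A) {k : ℕ} (q : Fin (n + 3) × ℕ →₀ 𝒪)
    (h0 : ∀ i, q (i, 0) = 0) (hq : ∀ i m, k < m → q (i, m) = 0) :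
    W.primLift a₀ (W.prim.nx q) - (jetDual (n + 1)).nx (W.primLift a₀ q) ∈
      (jetDual (n + 1)).derivSpan (equation A) k := by
  refine Connection.map_mem_of_single (Connection.commX W.prim (jetDual (n + 1)) (W.primLift a₀))
    _ q fun ⟨i, m⟩ hs => ?_
  cases m with
  | zero => exact absurd (h0 i) hs
  | succ m =>
    have hm : m + 1 ≤ k := by
      by_contra h
      exact hs (hq i _ (by omega))
    change W.primLift a₀ (W.prim.nx _) - (jetDual (n + 1)).nx (W.primLift a₀ _) ∈ _
    have h1 : (Finsupp.single (i, m + 1 + 1) (dx (W.fn i)) : Fin (n + 3) × ℕ →₀ 𝒪) =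
        dx (W.fn i) • Finsupp.single (i, m + 1 + 1) 1 := by simp
    rw [W.prim_nx_single, h1, map_smul, Web.primLift_succ, Web.primLift_succ,
      Connection.nx_iterate_transverse (jetDual_flat _) (hW i), sub_add_cancel_left]
    have := Connection.iterate_transverse_mem (jetDual_flat _) _ (W.fn i)
      (Web.longitudinal_sheetUnknown_mem hW hA i) m
    exact Submodule.neg_mem _ (Connection.derivSpan_mono _ _ (by omega) this)

/-- Here the commutation is exact and not only modulo the equations, since transverse derivatives
are multiples of ∂_y. Order zero is excluded because `primLift` sends it to zero. -/
theorem Web.primLift_ny (q : Fin (n + 3) × ℕ →₀ 𝒪)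
    (h0 : ∀ i, q (i, 0) = 0) :
    W.primLift a₀ (W.prim.ny q) = (jetDual (n + 1)).ny (W.primLift a₀ q) := by
  have : Connection.commY W.prim (jetDual (n + 1)) (W.primLift a₀) q ∈
      (⊥ : Submodule 𝒪 (Fin (n + 1) × ℕ × ℕ →₀ 𝒪)) := by
    refine Connection.map_mem_of_single _ _ q fun ⟨i, m⟩ hs => ?_
    cases m with
    | zero => exact absurd (h0 i) hs
    | succ m =>
      rw [Submodule.mem_bot]
      change W.primLift a₀ (W.prim.ny _) - (jetDual (n + 1)).ny (W.primLift a₀ _) = 0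
      have h1 : (Finsupp.single (i, m + 1 + 1) (dy (W.fn i)) : Fin (n + 3) × ℕ →₀ 𝒪) =
          dy (W.fn i) • Finsupp.single (i, m + 1 + 1) 1 := by simp
      rw [W.prim_ny_single, h1, map_smul, Web.primLift_succ, Web.primLift_succ,
        Connection.ny_iterate_transverse _ (hW i), sub_self]
  exact sub_eq_zero.1 ((Submodule.mem_bot 𝒪).1 this)

end System

end WebGeometry

namespace WebGeometry

/-! ### The relations between the first integrals -/

section Relations

variable {n : ℕ} (W : Web (n + 3)) (a₀ : 𝒪)

/-- The two relations of first order. -/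
def Web.relation : Fin 2 → (Fin (n + 3) × ℕ →₀ 𝒪) := fun i =>
  W.jetSum (1 - (i : ℕ)) i

/-- The coefficients of the interpolation polynomial of the first derivatives of the primitives. -/
def Web.primCoeff (l : ℕ) : Fin (n + 3) × ℕ →₀ 𝒪 :=
  ∑ j, (a₀ * (coNodal W.slope j).coeff l) • dy (W.fn j) • Finsupp.single (j, 1) 1

theorem Web.jetSum_one_zero : W.jetSum 1 0 = ∑ i, dx (W.fn i) • Finsupp.single (i, 1) 1 := by
  rw [← W.nx_jetSum]
  change W.prim.nx (∑ i, Finsupp.single (i, 0) 1) = _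
  rw [map_sum]
  exact Finset.sum_congr rfl fun i _ => by simp [W.prim_nx_single]

theorem Web.jetSum_zero_one : W.jetSum 0 1 = ∑ i, dy (W.fn i) • Finsupp.single (i, 1) 1 := by
  rw [← W.ny_jetSum]
  change W.prim.ny (∑ i, Finsupp.single (i, 0) 1) = _
  rw [map_sum]
  exact Finset.sum_congr rfl fun i _ => by simp [W.prim_ny_single]

theorem Web.jetSum_one_zero_mem : W.jetSum 1 0 ∈ W.prim.derivSpan W.relation 1 :=
  Connection.iter_mem_derivSpan W.prim W.relation (a := 0) (b := 0) 0 (by omega)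

theorem Web.jetSum_zero_one_mem : W.jetSum 0 1 ∈ W.prim.derivSpan W.relation 1 :=
  Connection.iter_mem_derivSpan W.prim W.relation (a := 0) (b := 0) 1 (by omega)

theorem Web.iter_jetSum (a b a' b' : ℕ) :
    W.prim.iter a b (W.jetSum a' b') = W.jetSum (a + a') (b + b') := by
  revert a b
  refine orderInduction ?_ (fun a b h => ?_) (fun a b h => ?_)
  · rw [Connection.iter_zero, zero_add, zero_add]
  · rw [← Connection.nx_iter, h, W.nx_jetSum, add_right_comm]
  · rw [← Connection.ny_iter W.prim_flat, h, W.ny_jetSum, add_right_comm]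

theorem Web.iter_relation (i : Fin 2) (a b : ℕ) :
    W.prim.iter a b (W.relation i) = W.jetSum (a + (1 - (i : ℕ))) (b + i) :=
  W.iter_jetSum a b _ _

variable {W a₀}

/-- Fewer than n + 2 derivatives of the first-order relations are derivatives of orders 1 to n + 2
of the sum. The last order is killed by the choice of `topPart`, the others by `hT`. -/
theorem Web.pair_fullExt_eq_zero (hW : ∀ i, IsUnit (dy (W.fn i))) {T : Ambient n}
    (hT : W.toJet T = 0) {q : Fin (n + 3) × ℕ →₀ 𝒪}
    (hq : q ∈ W.prim.derivSpan W.relation (n + 2)) : pair (W.fullExt T) q = 0 := by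
  induction hq using Submodule.span_induction with
  | mem x hx =>
    obtain ⟨i, a, b, hab, rfl⟩ := hx
    have hi := i.2
    rw [W.iter_relation, ← W.jetComp_toJet hW T (by omega) (by omega), hT, map_zero]
  | zero => simp
  | add x y _ _ hx hy => rw [pair, map_add]; exact (congrArg₂ (· + ·) hx hy).trans (add_zero 0)
  | smul c x _ h => rw [pair, map_smul]; exact (congrArg (c • ·) h).trans (smul_zero c)

theorem Web.prim_iter_apply_zero (q : Fin (n + 3) × ℕ →₀ 𝒪) (h0 : ∀ i, q (i, 0) = 0)
    (i : Fin (n + 3)) : ∀ a b, W.prim.iter a b q (i, 0) = 0 := by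
  refine orderInduction (h0 i) (fun a b h => ?_) (fun a b h => ?_)
  · rw [← Connection.nx_iter, W.prim_nx_zero, h, map_zero]
  · rw [← Connection.ny_iter W.prim_flat, W.prim_ny_zero, h, map_zero]

theorem Web.prim_iter_apply_of_lt {k : ℕ} (q : Fin (n + 3) × ℕ →₀ 𝒪)
    (hq : ∀ i m, k < m → q (i, m) = 0) (i : Fin (n + 3)) :
    ∀ a b m, k + a + b < m → W.prim.iter a b q (i, m) = 0 := by
  refine orderInduction (fun m hm => hq i m (by omega)) (fun a b h m hm => ?_)
    (fun a b h m hm => ?_)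
  · obtain ⟨m, rfl⟩ : ∃ k, m = k + 1 := ⟨m - 1, by omega⟩
    rw [← Connection.nx_iter, W.prim_nx_succ, h _ (by omega), h _ (by omega)]
    simp
  · obtain ⟨m, rfl⟩ : ∃ k, m = k + 1 := ⟨m - 1, by omega⟩
    rw [← Connection.ny_iter W.prim_flat, W.prim_ny_succ, h _ (by omega), h _ (by omega)]
    simp

theorem Web.primCoeff_apply_of_ne (l : ℕ) (i : Fin (n + 3)) {m : ℕ} (hm : m ≠ 1) :
    W.primCoeff a₀ l (i, m) = 0 := by
  rw [Web.primCoeff, Finsupp.finsetSum_apply]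
  refine Finset.sum_eq_zero fun j _ => ?_
  have h : (Finsupp.single (j, 1) (1 : 𝒪) : Fin (n + 3) × ℕ →₀ 𝒪) (i, m) = 0 :=
    Finsupp.single_eq_of_ne (by simp [Prod.ext_iff, hm])
  rw [Finsupp.smul_apply, Finsupp.smul_apply, h, smul_zero, smul_zero]

theorem Web.iter_primCoeff_zero (l a b : ℕ) (i : Fin (n + 3)) :
    W.prim.iter a b (W.primCoeff a₀ l) (i, 0) = 0 :=
  Web.prim_iter_apply_zero _ (fun _ => Web.primCoeff_apply_of_ne l _ (by omega)) i a b

theorem Web.iter_primCoeff_of_lt (l a b : ℕ) (i : Fin (n + 3)) {m : ℕ} (hm : a + b + 1 < m) :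
    W.prim.iter a b (W.primCoeff a₀ l) (i, m) = 0 :=
  Web.prim_iter_apply_of_lt (k := 1) _ (fun _ _ _ => Web.primCoeff_apply_of_ne l _ (by omega)) i a b m
    (by omega)

variable (ha : IsUnit a₀) (hW : ∀ i, IsUnit (dy (W.fn i)))

include hW

theorem Web.primLift_single_one (i : Fin (n + 3)) :
    dy (W.fn i) • W.primLift a₀ (Finsupp.single (i, 1) 1) =
      ∑ l : Fin (n + 1), W.sheetCoeff a₀ i l • unknown l := by
  rw [Web.primLift_succ (m := 0), Function.iterate_zero, id, Web.smul_sheetUnknown hW]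

include ha

theorem Web.primLift_jetSum_zero_one : W.primLift a₀ (W.jetSum 0 1) = 0 := by
  rw [W.jetSum_zero_one, map_sum]
  simp only [map_smul, Web.primLift_single_one hW]
  rw [Finset.sum_comm]
  simp only [← Finset.sum_smul]
  refine Finset.sum_eq_zero fun l _ => ?_
  have h := Web.sum_pow_mul_weight ha hW (b := (l : ℕ)) (by have := l.2; omega)
  change (∑ i, W.slope i ^ (l : ℕ) * W.weight a₀ i) • _ = _
  rw [h, zero_smul]

theorem Web.primLift_jetSum_one_zero : W.primLift a₀ (W.jetSum 1 0) = 0 := by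
  have h1 : ∀ i, dx (W.fn i) = (- W.slope i) * dy (W.fn i) := by
    intro i
    rw [neg_mul, Web.slope_mul hW, neg_neg]
  rw [W.jetSum_one_zero, map_sum]
  simp only [map_smul, h1, mul_smul, Web.primLift_single_one hW, Finset.smul_sum]
  rw [Finset.sum_comm]
  refine Finset.sum_eq_zero fun l _ => ?_
  have h := Web.sum_pow_mul_weight ha hW (b := (l : ℕ) + 1) (by have := l.2; omega)
  simp only [smul_smul, ← Finset.sum_smul]
  have h2 : ∑ i, -W.slope i * W.sheetCoeff a₀ i l = -∑ i, W.slope i ^ ((l : ℕ) + 1) * W.weight a₀ i := by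
    rw [← Finset.sum_neg_distrib]
    refine Finset.sum_congr rfl fun i _ => ?_
    rw [Web.sheetCoeff]
    ring
  rw [h2, h, neg_zero, zero_smul]

/-- In order one the images vanish identically, by the Lagrange identities; the span is then that of
an empty set. Each further derivative costs one derivative of the equations, so order n + 2 needs
exactly the equations differentiated at most n times, which E satisfies. -/
theorem Web.primLift_jetSum_mem {A : Matrix (Fin (n + 2)) (Fin (n + 1)) 𝒪}
    (hA : W.HasMatrix a₀ A) : ∀ a b : ℕ, 1 ≤ a + b →
    W.primLift a₀ (W.jetSum a b) ∈ (jetDual (n + 1)).derivSpan (equation A) (a + b - 1) := by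
  refine orderInduction (by simp) (fun a b h _ => ?_) (fun a b h _ => ?_)
  · rcases Nat.eq_zero_or_pos (a + b) with h0 | h0
    · obtain rfl : a = 0 := by omega
      obtain rfl : b = 0 := by omega
      rw [Web.primLift_jetSum_one_zero ha hW]
      exact zero_mem _
    · have h1 := Web.primLift_nx_mem hW hA (k := a + b) (W.jetSum a b)
        (fun i => W.jetSum_apply_zero i h0) (fun i m => W.jetSum_apply_of_lt i a b m)
      have h2 := Connection.nx_mem_derivSpan _ _ (h h0)
      have h3 : a + b - 1 + 1 = a + b := by omega
      have h4 : a + 1 + b - 1 = a + b := by omega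
      rw [h3] at h2
      rw [h4]
      have := add_mem h1 h2
      rwa [sub_add_cancel, W.nx_jetSum] at this
  · rcases Nat.eq_zero_or_pos (a + b) with h0 | h0
    · obtain rfl : a = 0 := by omega
      obtain rfl : b = 0 := by omega
      rw [Web.primLift_jetSum_zero_one ha hW]
      exact zero_mem _
    · have h2 := Connection.ny_mem_derivSpan (jetDual_flat _) _ (h h0)
      have h3 : a + b - 1 + 1 = a + (b + 1) - 1 := by omega
      rw [h3] at h2
      rwa [← W.ny_jetSum, Web.primLift_ny hW _ (fun i => W.jetSum_apply_zero i h0)]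

/-- Passing from the unknowns to their values on the sheets and interpolating back recovers the
unknowns. -/
theorem Web.primLift_primCoeff (l : Fin (n + 1)) : W.primLift a₀ (W.primCoeff a₀ l) = unknown l := by
  rw [Web.primCoeff, map_sum]
  simp only [map_smul, Web.primLift_single_one hW]
  exact Web.interpolation_left ha hW (by omega) unknown l

theorem Web.primLift_iter_primCoeff_mem {A : Matrix (Fin (n + 2)) (Fin (n + 1)) 𝒪}
    (hA : W.HasMatrix a₀ A) (l : Fin (n + 1)) : ∀ a b : ℕ,
    W.primLift a₀ (W.prim.iter a b (W.primCoeff a₀ l)) - Finsupp.single (l, a, b) 1 ∈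
      (jetDual (n + 1)).derivSpan (equation A) (a + b) := by
  refine orderInduction ?_ (fun a b h => ?_) (fun a b h => ?_)
  · rw [Connection.iter_zero, Web.primLift_primCoeff ha hW, unknown, sub_self]
    exact zero_mem _
  · have h1 := Web.primLift_nx_mem hW hA (k := a + b + 1) (W.prim.iter a b (W.primCoeff a₀ l))
      (fun i => Web.iter_primCoeff_zero l a b i) (fun i m => Web.iter_primCoeff_of_lt l a b i)
    have h2 := Connection.nx_mem_derivSpan _ _ h
    rw [map_sub, jetDual_nx_single] at h2
    have := add_mem h1 h2
    rwa [sub_add_sub_cancel, Connection.nx_iter, add_right_comm a b 1] at this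
  · have h2 := Connection.ny_mem_derivSpan (jetDual_flat _) _ h
    rw [map_sub, jetDual_ny_single, ← Web.primLift_ny hW _
      (fun i => Web.iter_primCoeff_zero l a b i), Connection.ny_iter W.prim_flat] at h2
    exact h2

/-- Interpolation at all n + 3 slopes is exact. The two coefficients of degree n + 1 and n + 2 that
the sum omits are combinations of the two first-order relations. -/
theorem Web.sum_sheetCoeff_primCoeff_mem (i : Fin (n + 3)) :
    ∑ l : Fin (n + 1), W.sheetCoeff a₀ i l • W.primCoeff a₀ l -
      dy (W.fn i) • Finsupp.single (i, 1) 1 ∈ W.prim.derivSpan W.relation 1 := by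
  have h1 : ∑ l : Fin (n + 3), W.sheetCoeff a₀ i l • W.primCoeff a₀ l =
      dy (W.fn i) • Finsupp.single (i, 1) 1 := by
    simp only [Web.primCoeff, Finset.smul_sum]
    rw [Finset.sum_comm]
    simp only [smul_smul (W.sheetCoeff a₀ _ _), ← Finset.sum_smul]
    have h := fun k => Web.interpolation_right ha hW i k
    simp only [Web.sheetCoeff, h]
    simp
  have h2 : W.primCoeff a₀ (n + 2) = a₀ • W.jetSum 0 1 := by
    rw [W.jetSum_zero_one, Web.primCoeff, Finset.smul_sum]
    refine Finset.sum_congr rfl fun j _ => ?_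
    rw [coeff_coNodal_top W.slope j, mul_one]
  -- The subleading coefficient of the co-nodal polynomial at `j` is p_j minus the sum of all
  -- slopes, and p_j ∂_yF_j = -∂_xF_j.
  have h3 : W.primCoeff a₀ (n + 1) =
      -(a₀ • W.jetSum 1 0) - (a₀ * ∑ j, W.slope j) • W.jetSum 0 1 := by
    rw [W.jetSum_zero_one, W.jetSum_one_zero, Web.primCoeff, Finset.smul_sum, Finset.smul_sum,
      ← Finset.sum_neg_distrib, ← Finset.sum_sub_distrib]
    refine Finset.sum_congr rfl fun j _ => ?_
    have hs := Web.slope_mul hW j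
    rw [coeff_coNodal_pred W.slope j]
    have hdx : dx (W.fn j) = -(W.slope j * dy (W.fn j)) := by rw [hs, neg_neg]
    rw [hdx]
    module
  rw [Fin.sum_univ_castSucc, Fin.sum_univ_castSucc] at h1
  simp only [Fin.val_castSucc, Fin.val_last, h2, h3] at h1
  rw [← h1]
  have hx := W.jetSum_one_zero_mem
  have hy := W.jetSum_zero_one_mem
  rw [add_assoc, sub_add_cancel_left]
  refine Submodule.neg_mem _ (add_mem (Submodule.smul_mem _ _ (sub_mem (Submodule.neg_mem _ ?_) ?_))
    (Submodule.smul_mem _ _ ?_))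
  · exact Submodule.smul_mem _ _ hx
  · exact Submodule.smul_mem _ _ hy
  · exact Submodule.smul_mem _ _ hy

/-- On each sheet the system is the derivative of the interpolated form. Modulo the relations that
form is Φ_i' dF_i, which is closed; one differentiation takes the span from order less than 1 to
order less than 2. -/
theorem Web.system_primCoeff_mem {A : Matrix (Fin (n + 2)) (Fin (n + 1)) 𝒪}
    (hA : W.HasMatrix a₀ A) (e : Fin (n + 2)) :
    W.prim.system A (fun l : Fin (n + 1) => W.primCoeff a₀ l) e ∈
      W.prim.derivSpan W.relation 2 := by
  rw [← Web.interpolation_left ha hW (by omega)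
    (W.prim.system A (fun l : Fin (n + 1) => W.primCoeff a₀ l)) e]
  refine Submodule.sum_mem _ fun i _ => Submodule.smul_mem _ _ ?_
  have h1 := hA.sum_system W.prim (fun l : Fin (n + 1) => W.primCoeff a₀ l) i
  simp only [Web.sheetCoeff] at h1
  rw [h1]
  have hmem := Web.sum_sheetCoeff_primCoeff_mem ha hW i
  simp only [Web.sheetCoeff] at hmem
  set x := ∑ l : Fin (n + 1), (W.slope i ^ (l : ℕ) * W.weight a₀ i) • W.primCoeff a₀ l with hx
  have h2 := nx_add_ny_slope hW W.prim i (Finsupp.single (i, 1) 1)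
  have h3 : dy (W.fn i) • W.prim.nx (Finsupp.single (i, 1) 1) -
      dx (W.fn i) • W.prim.ny (Finsupp.single (i, 1) 1) = 0 := by
    rw [W.prim_nx_single, W.prim_ny_single]
    simp [mul_comm]
  rw [h3] at h2
  have h4 : W.prim.nx x + W.prim.ny (W.slope i • x) =
      W.prim.nx (x - dy (W.fn i) • Finsupp.single (i, 1) 1) +
      W.prim.ny (W.slope i • (x - dy (W.fn i) • Finsupp.single (i, 1) 1)) := by
    rw [smul_sub, map_sub, map_sub, sub_add_sub_comm, h2, sub_zero]
  rw [h4]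
  exact add_mem (Connection.nx_mem_derivSpan _ _ hmem)
    (Connection.ny_mem_derivSpan W.prim_flat _ (Submodule.smul_mem _ _ hmem))

theorem Web.iter_system_primCoeff_mem {A : Matrix (Fin (n + 2)) (Fin (n + 1)) 𝒪}
    (hA : W.HasMatrix a₀ A) (e : Fin (n + 2)) : ∀ a b : ℕ,
    W.prim.iter a b (W.prim.system A (fun l : Fin (n + 1) => W.primCoeff a₀ l) e) ∈
      W.prim.derivSpan W.relation (a + b + 2) := by
  refine orderInduction (Web.system_primCoeff_mem ha hW hA e) (fun a b h => ?_) (fun a b h => ?_)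
  · rw [← Connection.nx_iter, add_right_comm a 1 b]
    exact Connection.nx_mem_derivSpan _ _ h
  · rw [← Connection.ny_iter W.prim_flat]
    exact Connection.ny_mem_derivSpan W.prim_flat _ h

end Relations

/-! ### The jet bundle in the ambient bundle -/

section Embedding

variable {n : ℕ} (W : Web (n + 3)) (a₀ : 𝒪) (A : Matrix (Fin (n + 2)) (Fin (n + 1)) 𝒪)

/-- The jet bundle of the system, as a subbundle of the ambient bundle. -/
def Web.toAmbient : jetBundle A →ₗ[𝒪] Ambient n where
  toFun u s := pair (jetFun (u : Jet (n + 1) (n + 1)))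
    (((jetDual (n + 1)).transverse (W.fn s.1))^[s.2] (W.sheetUnknown a₀ s.1))
  map_add' u v := by
    funext s
    simp only [Submodule.coe_add, map_add, pair_add_left, Pi.add_apply]
  map_smul' c u := by
    funext s
    simp only [Submodule.coe_smul, map_smul, pair_smul_left, Pi.smul_apply, RingHom.id_apply,
      smul_eq_mul]

variable {W a₀ A}

theorem Web.toAmbient_apply (u : jetBundle A) (i : Fin (n + 3)) (m : Fin (n + 1)) :
    W.toAmbient a₀ A u (i, m) = pair (jetFun (u : Jet (n + 1) (n + 1)))
      (((jetDual (n + 1)).transverse (W.fn i))^[m] (W.sheetUnknown a₀ i)) := rfl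

/-- Membership in ker p_n says precisely that the functional of the jet kills the derivatives of
order at most n of the equations. -/
theorem pair_jetFun_eq_zero (u : jetBundle A) {q : Fin (n + 1) × ℕ × ℕ →₀ 𝒪}
    (hq : q ∈ (jetDual (n + 1)).derivSpan (equation A) (n + 1)) :
    pair (jetFun (u : Jet (n + 1) (n + 1))) q = 0 := by
  induction hq using Submodule.span_induction with
  | mem x hx =>
    obtain ⟨e, a, b, hab, rfl⟩ := hx
    have h := Connection.prolongation_eq (jetDual_flat (n + 1)) A unknown
      (Finsupp.linearCombination 𝒪 (jetFun (u : Jet (n + 1) (n + 1)))) (u : Jet (n + 1) (n + 1))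
      (fun β l => pair_jetFun_iter _ β l) ⟨(a, b), by dsimp only; omega⟩ e
    have hu : prolongation A n (u : Jet (n + 1) (n + 1)) = 0 := u.2
    rw [hu] at h
    exact h.symm
  | zero => simp
  | add x y _ _ hx hy => rw [pair, map_add]; exact (congrArg₂ (· + ·) hx hy).trans (add_zero 0)
  | smul c x _ h => rw [pair, map_smul]; exact (congrArg (c • ·) h).trans (smul_zero c)

theorem Web.pair_primLift (u : jetBundle A) (q : Fin (n + 3) × ℕ →₀ 𝒪) :
    pair (fun s => pair (jetFun (u : Jet (n + 1) (n + 1))) (W.primLift a₀ (Finsupp.single s 1))) q =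
      pair (jetFun (u : Jet (n + 1) (n + 1))) (W.primLift a₀ q) := by
  induction q using Finsupp.induction_linear with
  | zero => simp
  | add p q hp hq => simp only [pair, map_add] at *; rw [hp, hq]
  | single s a =>
    have h : Finsupp.single s a = a • (Finsupp.single s 1 : Fin (n + 3) × ℕ →₀ 𝒪) := by simp
    rw [h]
    simp only [pair, map_smul, Finsupp.linearCombination_single, one_smul]

variable (ha : IsUnit a₀) (hW : ∀ i, IsUnit (dy (W.fn i))) (hA : W.HasMatrix a₀ A)

include ha hW hA

theorem Web.pair_jetFun_primLift_jetSum (u : jetBundle A) {a b : ℕ} (h1 : 1 ≤ a + b)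
    (h2 : a + b ≤ n + 2) :
    pair (jetFun (u : Jet (n + 1) (n + 1))) (W.primLift a₀ (W.jetSum a b)) = 0 :=
  pair_jetFun_eq_zero u
    (Connection.derivSpan_mono _ _ (by omega) (Web.primLift_jetSum_mem ha hW hA a b h1))

/-- The functional of `u` composed with `primLift` kills the derivatives of order n + 2 of the sum,
so `Web.eq_fullExt` identifies it with the extension of its lower part. -/
theorem Web.pair_fullExt_toAmbient (u : jetBundle A) (q : Fin (n + 3) × ℕ →₀ 𝒪)
    (hq : ∀ i m, n + 2 < m → q (i, m) = 0) :
    pair (W.fullExt (W.toAmbient a₀ A u)) q =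
      pair (jetFun (u : Jet (n + 1) (n + 1))) (W.primLift a₀ q) := by
  rw [← Web.pair_primLift]
  refine pair_congr fun ⟨i, m⟩ hs => ?_
  refine (W.eq_fullExt hW (W.toAmbient a₀ A u)
    (fun s => pair (jetFun (u : Jet (n + 1) (n + 1))) (W.primLift a₀ (Finsupp.single s 1)))
    (fun i => ?_) (fun i m => ?_) (fun a b hab => ?_) i ?_).symm
  · rw [Web.primLift_zero, pair, map_zero]
  · rw [Web.primLift_succ, Web.toAmbient_apply]
  · rw [Web.pair_primLift, Web.pair_jetFun_primLift_jetSum ha hW hA u (by omega) (by omega)]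
  · by_contra h
    exact hs (hq i m (by omega))

theorem Web.toJet_toAmbient (u : jetBundle A) : W.toJet (W.toAmbient a₀ A u) = 0 := by
  funext α
  have hα := mem_jetOrders.1 α.2
  rw [W.toJet_apply, ← W.pair_fullExt_low _ hα.2, Web.pair_fullExt_toAmbient ha hW hA u,
    Web.pair_jetFun_primLift_jetSum ha hW hA u hα.1 (by omega)]
  · rfl
  · exact fun i m hm => W.jetSum_apply_of_lt i _ _ m (by omega)

/-- A jet in the bundle is recovered from its image in the ambient bundle. -/
theorem Web.jet_eq_pair (u : jetBundle A) (β : JetIndex (n + 1)) (l : Fin (n + 1)) :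
    (u : Jet (n + 1) (n + 1)) β l =
      pair (W.fullExt (W.toAmbient a₀ A u)) (W.prim.iter β.1.1 β.1.2 (W.primCoeff a₀ l)) := by
  have hβ := β.2
  rw [Web.pair_fullExt_toAmbient ha hW hA u _
    (fun i m hm => Web.iter_primCoeff_of_lt l _ _ i (by omega)),
    pair_jetFun_iter (u : Jet (n + 1) (n + 1)) β l, iter_unknown]
  have h := pair_jetFun_eq_zero u (Connection.derivSpan_mono _ _ (by omega)
    (Web.primLift_iter_primCoeff_mem ha hW hA l β.1.1 β.1.2))
  rw [pair, map_sub] at h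
  exact (sub_eq_zero.1 h).symm

theorem Web.toAmbient_injective : Function.Injective (W.toAmbient a₀ A) := by
  rw [injective_iff_map_eq_zero]
  intro u hu
  apply Subtype.ext
  funext β l
  rw [Web.jet_eq_pair ha hW hA u β l, hu, map_zero]
  simp [pair]

/-- Given values that satisfy the relations, the coefficients b_l are recovered by interpolation of
the first derivatives of the primitives, and their jet solves the prolonged system. -/
theorem Web.mem_range_toAmbient (T : Ambient n) :
    W.toJet T = 0 ↔ T ∈ Set.range (W.toAmbient a₀ A) := by
  constructor
  swap
  · rintro ⟨u, rfl⟩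
    exact Web.toJet_toAmbient ha hW hA u
  intro hT
  -- A derivative of order n + 1 of `primCoeff` reaches the level n + 2, so the full extension of
  -- `T` is needed here.
  let u : Jet (n + 1) (n + 1) := fun β l =>
    pair (W.fullExt T) (W.prim.iter β.1.1 β.1.2 (W.primCoeff a₀ l))
  have hu : u ∈ jetBundle A := by
    rw [LinearMap.mem_ker]
    funext α e
    rw [Connection.prolongation_eq W.prim_flat A (fun l : Fin (n + 1) => W.primCoeff a₀ l)
      (Finsupp.linearCombination 𝒪 (W.fullExt T)) u (fun β l => rfl) α e]
    have hα := α.2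
    exact Web.pair_fullExt_eq_zero hW hT (Connection.derivSpan_mono _ _ (by omega)
      (Web.iter_system_primCoeff_mem ha hW hA e α.1.1 α.1.2))
  refine ⟨⟨u, hu⟩, ?_⟩
  funext ⟨i, m⟩
  rw [Web.toAmbient_apply]
  have hm := m.2
  set q := ((jetDual (n + 1)).transverse (W.fn i))^[m] (W.sheetUnknown a₀ i) with hq
  have hqmem : q ∈ (jetDual (n + 1)).derivSpan unknown (n + 2) :=
    Connection.derivSpan_mono _ _ (by omega) (Connection.iterate_transverse_mem (jetDual_flat _) _
      (W.fn i) (Web.sheetUnknown_mem i) m)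
  let c := derivLift W.prim (fun l : Fin (n + 1) => W.primCoeff a₀ l)
  have h1 : pair (jetFun u) q = pair (W.fullExt T) (c q) := by
    have h2 : ∀ q', pair (fun s => pair (W.fullExt T) (c (Finsupp.single s 1))) q' =
        pair (W.fullExt T) (c q') := by
      intro q'
      induction q' using Finsupp.induction_linear with
      | zero => simp
      | add p q hp hq => simp only [pair, map_add] at *; rw [hp, hq]
      | single s a =>
        have h : Finsupp.single s a = a • (Finsupp.single s 1 : Fin (n + 1) × ℕ × ℕ →₀ 𝒪) := by simp
        rw [h]
        simp only [pair, map_smul, Finsupp.linearCombination_single, one_smul]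
    rw [← h2]
    refine pair_congr fun ⟨l, a, b⟩ hs => ?_
    have hab : a + b ≤ n + 1 := by
      by_contra h
      exact hs (apply_eq_zero_of_mem_derivSpan hqmem (by dsimp only; omega))
    rw [derivLift_single]
    exact jetFun_apply u ⟨(a, b), hab⟩ l
  have h3 : c q = (W.prim.transverse (W.fn i))^[m] (c (W.sheetUnknown a₀ i)) :=
    derivLift_transverse W.prim_flat _ _ _ _
  -- The two substitutions, primitives by unknowns and unknowns by primitives, are inverse to each
  -- other modulo the relations.
  have h4 : c (W.sheetUnknown a₀ i) - Finsupp.single (i, 1) 1 ∈ W.prim.derivSpan W.relation 1 := by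
    have h5 : c (W.sheetUnknown a₀ i) - Finsupp.single (i, 1) 1 = Ring.inverse (dy (W.fn i)) •
        (∑ l : Fin (n + 1), W.sheetCoeff a₀ i l • W.primCoeff a₀ l -
          dy (W.fn i) • Finsupp.single (i, 1) 1) := by
      have h6 : ∀ l : Fin (n + 1), c (unknown l) = W.primCoeff a₀ l := fun l =>
        derivLift_single _ l 0 0
      rw [smul_sub, smul_smul, Ring.inverse_mul_cancel _ (hW i), one_smul, Web.sheetUnknown,
        map_smul, map_sum]
      simp only [map_smul, h6]
    rw [h5]
    exact Submodule.smul_mem _ _ (Web.sum_sheetCoeff_primCoeff_mem ha hW i)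
  have h7 : ∀ k : ℕ, (W.prim.transverse (W.fn i))^[k] (Finsupp.single (i, 1) 1) =
      Finsupp.single (i, k + 1) 1 := by
    intro k
    induction k with
    | zero => rfl
    | succ k ih =>
      rw [Function.iterate_succ_apply', ih, Connection.transverse_apply, W.prim_ny_single]
      simp [Ring.inverse_mul_cancel _ (hW i)]
  have h8 := Connection.iterate_transverse_mem W.prim_flat W.relation (W.fn i) h4 m
  rw [iterate_map_sub, h7, ← h3] at h8
  have h9 := Web.pair_fullExt_eq_zero hW hT (Connection.derivSpan_mono _ _ (by omega) h8)
  rw [pair, map_sub, sub_eq_zero] at h9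
  change pair (jetFun u) q = _
  rw [h1]
  refine h9.trans ?_
  rw [Finsupp.linearCombination_single, one_smul, W.fullExt_of_le _ _ (by omega), lowExt_succ,
    dif_pos hm]

/-- A section of the bundle is determined by its jet of one order less. -/
theorem eq_of_truncate_eq (u v : jetBundle A)
    (h : truncate (u : Jet (n + 1) (n + 1)) = truncate (v : Jet (n + 1) (n + 1))) : u = v := by
  apply Web.toAmbient_injective ha hW hA
  funext ⟨i, m⟩
  rw [Web.toAmbient_apply, Web.toAmbient_apply]
  have hm := m.2
  -- At most n transverse derivatives are applied to an element of order zero, so the top order n +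
  -- 1 of a jet never enters the embedding.
  have hqmem := Connection.derivSpan_mono _ _ (show 1 + (m : ℕ) ≤ n + 1 by omega)
    (Connection.iterate_transverse_mem (jetDual_flat (n + 1)) _
      (W.fn i) (Web.sheetUnknown_mem (W := W) (a₀ := a₀) i) m)
  refine pair_congr fun ⟨l, a, b⟩ hs => ?_
  have hab : a + b ≤ n := by
    by_contra hcon
    exact hs (apply_eq_zero_of_mem_derivSpan hqmem (by dsimp only; omega))
  have h1 := congrFun (congrFun h ⟨(a, b), hab⟩) l
  have h2 := fun w : Jet (n + 1) (n + 1) => jetFun_apply w (JetIndex.lift ⟨(a, b), hab⟩) l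
  exact (h2 _).trans (h1.trans (h2 _).symm)

/-- The connection induced on the jet bundle. -/
theorem Web.exists_connection : ∃ D : Connection (jetBundle A),
    (∀ s, W.toAmbient a₀ A (D.nx s) = W.ambient.nx (W.toAmbient a₀ A s)) ∧
    (∀ s, W.toAmbient a₀ A (D.ny s) = W.ambient.ny (W.toAmbient a₀ A s)) := by
  have hinj := Web.toAmbient_injective ha hW hA
  -- The kernel of a map that commutes with the connections is stable under them.
  have hx : ∀ s, ∃ t, W.toAmbient a₀ A t = W.ambient.nx (W.toAmbient a₀ A s) := fun s =>
    (Web.mem_range_toAmbient ha hW hA _).1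
      (by rw [W.toJet_nx hW, Web.toJet_toAmbient ha hW hA, map_zero])
  have hy : ∀ s, ∃ t, W.toAmbient a₀ A t = W.ambient.ny (W.toAmbient a₀ A s) := fun s =>
    (Web.mem_range_toAmbient ha hW hA _).1
      (by rw [W.toJet_ny hW, Web.toJet_toAmbient ha hW hA, map_zero])
  choose X hX using hx
  choose Y hY using hy
  exact ⟨
    { nx := AddMonoidHom.mk' X fun s t => hinj (by simp only [map_add, hX])
      ny := AddMonoidHom.mk' Y fun s t => hinj (by simp only [map_add, hY])
      leibniz_x := fun f s => hinj (by simp [hX, W.ambient.leibniz_x])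
      leibniz_y := fun f s => hinj (by simp [hY, W.ambient.leibniz_y]) }, hX, hY⟩

/-- By the Leibniz rule for the pairing, ∂_x of a jet component is the shifted component plus the
pairing with the dual derivative. The Spencer operator subtracts the shifted component and leaves
the ambient connection. -/
theorem Web.truncate_of_toAmbient_nx {s t : jetBundle A}
    (h : W.toAmbient a₀ A t = W.ambient.nx (W.toAmbient a₀ A s)) :
    truncate (t : Jet (n + 1) (n + 1)) = spencerX s := by
  funext α l
  have hα := α.2
  have hdeg : ∀ i m, n + 1 < m → W.prim.iter α.1.1 α.1.2 (W.primCoeff a₀ l) (i, m) = 0 :=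
    fun i m hm => Web.iter_primCoeff_of_lt l _ _ i (by omega)
  change (t : Jet (n + 1) (n + 1)) α.lift l =
    dx ((s : Jet (n + 1) (n + 1)) α.lift l) - (s : Jet (n + 1) (n + 1)) α.sx l
  rw [Web.jet_eq_pair ha hW hA t, Web.jet_eq_pair ha hW hA s, Web.jet_eq_pair ha hW hA s, h, W.dx_pair,
    Connection.nx_iter]
  change pair (W.fullExt (W.ambient.nx (W.toAmbient a₀ A s)))
    (W.prim.iter α.1.1 α.1.2 (W.primCoeff a₀ l)) = pair (W.dualX (W.fullExt (W.toAmbient a₀ A s)))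
      (W.prim.iter α.1.1 α.1.2 (W.primCoeff a₀ l)) +
      pair (W.fullExt (W.toAmbient a₀ A s)) (W.prim.iter (α.1.1 + 1) α.1.2 (W.primCoeff a₀ l)) -
      pair (W.fullExt (W.toAmbient a₀ A s)) (W.prim.iter (α.1.1 + 1) α.1.2 (W.primCoeff a₀ l))
  rw [add_sub_cancel_right, ← W.pair_lowExt_ambient_nx _ _ hdeg
    (fun i => Web.iter_primCoeff_zero l _ _ i)]
  refine pair_congr fun ⟨i, m⟩ hs => W.fullExt_of_le _ _ ?_
  by_contra hm
  exact hs (hdeg i m (by omega))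

theorem Web.truncate_of_toAmbient_ny {s t : jetBundle A}
    (h : W.toAmbient a₀ A t = W.ambient.ny (W.toAmbient a₀ A s)) :
    truncate (t : Jet (n + 1) (n + 1)) = spencerY s := by
  funext α l
  have hα := α.2
  have hdeg : ∀ i m, n + 1 < m → W.prim.iter α.1.1 α.1.2 (W.primCoeff a₀ l) (i, m) = 0 :=
    fun i m hm => Web.iter_primCoeff_of_lt l _ _ i (by omega)
  change (t : Jet (n + 1) (n + 1)) α.lift l =
    dy ((s : Jet (n + 1) (n + 1)) α.lift l) - (s : Jet (n + 1) (n + 1)) α.sy l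
  rw [Web.jet_eq_pair ha hW hA t, Web.jet_eq_pair ha hW hA s, Web.jet_eq_pair ha hW hA s, h, W.dy_pair,
    Connection.ny_iter W.prim_flat]
  change pair (W.fullExt (W.ambient.ny (W.toAmbient a₀ A s)))
    (W.prim.iter α.1.1 α.1.2 (W.primCoeff a₀ l)) = pair (W.dualY (W.fullExt (W.toAmbient a₀ A s)))
      (W.prim.iter α.1.1 α.1.2 (W.primCoeff a₀ l)) +
      pair (W.fullExt (W.toAmbient a₀ A s)) (W.prim.iter α.1.1 (α.1.2 + 1) (W.primCoeff a₀ l)) -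
      pair (W.fullExt (W.toAmbient a₀ A s)) (W.prim.iter α.1.1 (α.1.2 + 1) (W.primCoeff a₀ l))
  rw [add_sub_cancel_right, ← W.pair_lowExt_ambient_ny _ _ hdeg
    (fun i => Web.iter_primCoeff_zero l _ _ i)]
  refine pair_congr fun ⟨i, m⟩ hs => W.fullExt_of_le _ _ ?_
  by_contra hm
  exact hs (hdeg i m (by omega))

/-- A connection on the jet bundle that projects to the Spencer operator is induced by the ambient
connection. -/
theorem Web.toAmbient_nabla (D : Connection (jetBundle A))
    (hx : ∀ s, truncate (D.nx s : Jet (n + 1) (n + 1)) = spencerX s)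
    (hy : ∀ s, truncate (D.ny s : Jet (n + 1) (n + 1)) = spencerY s) :
    (∀ s, W.toAmbient a₀ A (D.nx s) = W.ambient.nx (W.toAmbient a₀ A s)) ∧
    (∀ s, W.toAmbient a₀ A (D.ny s) = W.ambient.ny (W.toAmbient a₀ A s)) := by
  obtain ⟨D', h1, h2⟩ := Web.exists_connection ha hW hA
  constructor
  · intro s
    rw [← h1 s, eq_of_truncate_eq ha hW hA (D.nx s) (D'.nx s)
      ((hx s).trans (Web.truncate_of_toAmbient_nx ha hW hA (h1 s)).symm)]
  · intro s
    rw [← h2 s, eq_of_truncate_eq ha hW hA (D.ny s) (D'.ny s)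
      ((hy s).trans (Web.truncate_of_toAmbient_ny ha hW hA (h2 s)).symm)]

end Embedding

end WebGeometry

namespace WebGeometry

/-! ### Implicit presentations -/

section Presentation

variable {n : ℕ} {W : Web (n + 3)} {F : 𝒪[X]}

/-- A resultant of nonzero value forces an invertible leading coefficient, and the latter is a unit
times the product of the ∂_y(F_i). In particular no leaf through the origin is vertical. -/
theorem Web.Presents.isUnit_dy (hF : W.Presents F) (i : Fin (n + 3)) : IsUnit (dy (W.fn i)) := by
  obtain ⟨hdeg, hres, u, hu, hfac⟩ := hF
  have hlead : F.coeff (n + 3) = u * ∏ i, dy (W.fn i) := by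
    rw [hfac, coeff_C_mul]
    congr 1
    have h := coeff_prod_of_natDegree_le Finset.univ
      (fun i => C (dy (W.fn i)) * X + C (dx (W.fn i))) 1 (fun i _ => natDegree_linear_le)
    simp only [Finset.card_univ, Fintype.card_fin, mul_one] at h
    rw [h]
    simp
  suffices h : IsUnit (F.coeff (n + 3)) by
    rw [hlead] at h
    exact IsUnit.prod_univ_iff.1 (isUnit_of_mul_isUnit_right h) i
  rw [isUnit_iff_value_ne_zero]
  intro h0
  apply hres
  have hcd : (derivative F).coeff (n + 2) = F.coeff (n + 3) * ((n + 3 : ℕ) : 𝒪) := by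
    rw [coeff_derivative]
    push_cast
    ring
  have hne : F.coeff (n + 3) ≠ 0 := by
    rw [← hdeg]
    intro h
    have hF0 : F = 0 := leadingCoeff_eq_zero.1 h
    rw [hF0] at hdeg
    simp at hdeg
  have hdd : (derivative F).natDegree = n + 2 := by
    apply le_antisymm
    · have := natDegree_derivative_le F
      omega
    · apply le_natDegree_of_ne_zero
      rw [hcd]
      intro h
      exact hne ((isUnit_natCast (Nat.succ_ne_zero (n + 2))).mul_left_eq_zero.1 h)
  have h1 : valueHom (Polynomial.resultant F (derivative F)) = 0 := by
    rw [← resultant_map_map, hdeg, hdd]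
    have hlt : ∀ (p : ℂ[X]) (m : ℕ), 0 < m → p.natDegree ≤ m → p.coeff m = 0 → p.natDegree < m := by
      intro p m hm hle hc
      rcases hle.lt_or_eq with h | h
      · exact h
      · rw [← h] at hc
        have : p = 0 := leadingCoeff_eq_zero.1 hc
        rw [this]
        simpa using hm
    -- If the leading coefficient vanishes at the origin, the values of both polynomials drop in
    -- degree, and a resultant taken with the original degrees is zero.
    apply resultant_eq_zero_of_lt_lt
    · refine hlt _ _ (by omega) (hdeg ▸ natDegree_map_le) ?_
      rw [coeff_map]
      exact h0
    · refine hlt _ _ (by omega) (hdd ▸ natDegree_map_le) ?_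
      rw [coeff_map, hcd, map_mul]
      change value _ * _ = 0
      rw [h0, zero_mul]
  exact h1

theorem Web.prod_linear_eq (hW : ∀ i, IsUnit (dy (W.fn i))) :
    ∏ i, (C (dy (W.fn i)) * X + C (dx (W.fn i))) =
      C (∏ i, dy (W.fn i)) * ∏ i, (X - C (W.slope i)) := by
  rw [map_prod, ← Finset.prod_mul_distrib]
  refine Finset.prod_congr rfl fun i _ => ?_
  rw [mul_sub, ← C_mul, mul_comm (dy _), Web.slope_mul hW, C_neg, sub_neg_eq_add]

theorem Web.Presents.exists_eq (hF : W.Presents F) :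
    ∃ a₀ : 𝒪, IsUnit a₀ ∧ F = C a₀ * ∏ i, (X - C (W.slope i)) := by
  obtain ⟨u, hu, hfac⟩ := hF.factor
  refine ⟨u * ∏ i, dy (W.fn i), hu.mul (IsUnit.prod_univ_iff.2 hF.isUnit_dy), ?_⟩
  rw [hfac, Web.prod_linear_eq hF.isUnit_dy, ← mul_assoc, ← C_mul]

/-- The slopes have invertible differences, so the product of the X - p_i is separable and its
resultant with its derivative is a unit. -/
theorem Web.exists_presents (hW : ∀ i, IsUnit (dy (W.fn i))) : ∃ G : 𝒪[X], W.Presents G := by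
  set M : 𝒪[X] := ∏ i, (X - C (W.slope i)) with hM
  have hmonic : M.Monic := monic_prod_of_monic _ _ fun _ _ => monic_X_sub_C _
  have hMdeg : M.natDegree = n + 3 := by
    rw [hM, natDegree_prod_of_monic _ _ fun _ _ => monic_X_sub_C _]
    simp
  set a : 𝒪 := ∏ i, dy (W.fn i) with ha_def
  have ha : IsUnit a := IsUnit.prod_univ_iff.2 hW
  have hdeg : ∀ p : 𝒪[X], (C a * p).natDegree = p.natDegree := by
    intro p
    refine le_antisymm (natDegree_C_mul_le a p) ?_
    rcases eq_or_ne p 0 with rfl | hp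
    · simp
    apply le_natDegree_of_ne_zero
    rw [coeff_C_mul]
    intro h
    exact hp (leadingCoeff_eq_zero.1 (ha.mul_right_eq_zero.1 h))
  have hsep : M.Separable := by
    refine separable_prod' (fun i _ j _ hij => ?_) (fun i _ => separable_X_sub_C)
    exact isCoprime_X_sub_C_of_isUnit_sub (Web.isUnit_slope_sub hW i j hij)
  refine ⟨C a * M, ?_, ?_, 1, isUnit_one, ?_⟩
  · rw [hdeg, hMdeg]
  · rw [← isUnit_iff_value_ne_zero, derivative_C_mul, hdeg, hdeg, resultant_C_mul_left,
      resultant_C_mul_right]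
    exact (ha.pow _).mul ((ha.pow _).mul ((isUnit_resultant_iff_isCoprime hmonic).2 hsep))
  · rw [Web.prod_linear_eq hW, C_1, one_mul]

variable {a₀ : 𝒪}

theorem Web.eval_derivative (F : 𝒪[X]) (hF : F = C a₀ * ∏ i, (X - C (W.slope i)))
    (i : Fin (n + 3)) :
    (derivative F).eval (W.slope i) = a₀ * (coNodal W.slope i).eval (W.slope i) := by
  have h : F = C a₀ * ((X - C (W.slope i)) * coNodal W.slope i) := by
    rw [hF, coNodal, Finset.mul_prod_erase _ (fun j => X - C (W.slope j)) (Finset.mem_univ i)]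
  rw [h, derivative_C_mul, derivative_mul]
  simp

/-- In a local ring some factor p - p_i is not a unit. All the others then are, because they differ
from it by units, so that factor must vanish. -/
theorem Web.isRoot_iff (ha : IsUnit a₀) (hW : ∀ i, IsUnit (dy (W.fn i))) (p : 𝒪) :
    (C a₀ * ∏ i, (X - C (W.slope i))).IsRoot p ↔ ∃ i, p = W.slope i := by
  rw [IsRoot.def, eval_mul, eval_C, eval_prod, ha.mul_right_eq_zero]
  simp only [eval_sub, eval_X, eval_C]
  constructor
  · intro h
    have hex : ∃ i, ¬ IsUnit (p - W.slope i) := by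
      by_contra! hcon
      have : IsUnit (∏ i, (p - W.slope i)) := IsUnit.prod_univ_iff.2 hcon
      rw [h] at this
      exact not_isUnit_zero this
    obtain ⟨i, hi⟩ := hex
    refine ⟨i, ?_⟩
    have hother : ∀ j ∈ Finset.univ.erase i, IsUnit (p - W.slope j) := by
      intro j hj
      by_contra hcon
      have hsub : (p - W.slope j) - (p - W.slope i) = W.slope i - W.slope j := by ring
      have hu := Web.isUnit_slope_sub hW i j (Finset.ne_of_mem_erase hj).symm
      rw [← hsub] at hu
      exact (IsLocalRing.nonunits_add hcon (show -(p - W.slope i) ∈ nonunits 𝒪 by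
        rw [mem_nonunits_iff, IsUnit.neg_iff]; exact hi)) (by rwa [← sub_eq_add_neg])
    rw [← Finset.mul_prod_erase _ _ (Finset.mem_univ i),
      ((IsUnit.prod_iff).2 hother).mul_left_eq_zero] at h
    exact sub_eq_zero.1 h
  · rintro ⟨i, rfl⟩
    exact Finset.prod_eq_zero (Finset.mem_univ i) (sub_self _)

/-! ### The system matrix: characterisation, existence, uniqueness -/

variable {A : Matrix (Fin (n + 2)) (Fin (n + 1)) 𝒪}

theorem sheetForm_extDeriv (F : 𝒪[X]) (c : Fin (n + 1) → 𝒪) (p : 𝒪) :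
    (sheetForm F c p).extDeriv =
      dx ((∑ l, c l * p ^ (l : ℕ)) * Ring.inverse ((derivative F).eval p)) +
      dy (p * ((∑ l, c l * p ^ (l : ℕ)) * Ring.inverse ((derivative F).eval p))) := by
  simp only [sheetForm, OneForm.mulFun, OneForm.extDeriv, mul_one, mul_neg, map_neg,
    sub_neg_eq_add]
  rw [mul_comm p]

/-- Testing on the monomials r = p^l, whose coefficients are constant, leaves only the matrix in the
operator; conversely `sum_system` over `𝒪` reassembles an arbitrary r. -/
theorem Web.isSystemMatrix_iff (ha : IsUnit a₀) (hW : ∀ i, IsUnit (dy (W.fn i)))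
    (hF : F = C a₀ * ∏ i, (X - C (W.slope i))) : IsSystemMatrix F A ↔ W.HasMatrix a₀ A := by
  have hinv : ∀ i, Ring.inverse ((derivative F).eval (W.slope i)) = W.weight a₀ i := by
    intro i
    rw [Web.eval_derivative F hF, Web.weight]
  have hunit : ∀ i, W.weight a₀ i * (derivative F).eval (W.slope i) = 1 := by
    intro i
    rw [Web.eval_derivative F hF]
    exact Ring.inverse_mul_cancel _ (Web.isUnit_denominator ha hW i)
  constructor
  · intro h i l
    have h1 := h (Pi.single l 1) (W.slope i) (by
      rw [hF]
      exact (Web.isRoot_iff ha hW _).2 ⟨i, rfl⟩)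
    rw [sheetForm_extDeriv, hinv] at h1
    have h2 : ∑ k : Fin (n + 1), (Pi.single l 1 : Fin (n + 1) → 𝒪) k * W.slope i ^ (k : ℕ) =
        W.slope i ^ (l : ℕ) := by
      rw [Finset.sum_eq_single l]
      · simp
      · intro k _ hk
        rw [Pi.single_eq_of_ne hk, zero_mul]
      · simp
    have h3 : ∀ e, systemOp A (Pi.single l 1) e = A e l := by
      intro e
      have hz : ∀ (δ : Derivation ℤ 𝒪 𝒪) k, δ ((Pi.single l 1 : Fin (n + 1) → 𝒪) k) = 0 := by
        intro δ k
        rw [Pi.single_apply]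
        split_ifs <;> simp
      have h4 : (Fin.snoc (fun k => dx ((Pi.single l 1 : Fin (n + 1) → 𝒪) k)) 0 :
          Fin (n + 2) → 𝒪) e = 0 := by
        refine Fin.lastCases ?_ (fun k => ?_) e <;> simp [hz]
      have h5 : (Fin.cons 0 (fun k => dy ((Pi.single l 1 : Fin (n + 1) → 𝒪) k)) :
          Fin (n + 2) → 𝒪) e = 0 := by
        refine Fin.cases ?_ (fun k => ?_) e <;> simp [hz]
      rw [systemOp, h4, h5, zero_add, zero_add, Finset.sum_eq_single l]
      · simp
      · intro k _ hk
        rw [Pi.single_eq_of_ne hk, mul_zero]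
      · simp
    rw [h2] at h1
    simp only [h3] at h1
    change _ = dx (W.slope i ^ (l : ℕ) * W.weight a₀ i) +
      dy (W.slope i * (W.slope i ^ (l : ℕ) * W.weight a₀ i))
    have h6 : ∑ e : Fin (n + 2), W.sheetCoeff a₀ i e * A e l =
        W.weight a₀ i * ∑ e : Fin (n + 2), A e l * W.slope i ^ (e : ℕ) := by
      rw [Finset.mul_sum]
      exact Finset.sum_congr rfl fun e _ => by rw [Web.sheetCoeff]; ring
    rw [h6, ← h1, ← mul_assoc, hunit, one_mul]
  · intro h c p hp
    rw [hF] at hp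
    obtain ⟨i, rfl⟩ := (Web.isRoot_iff ha hW p).1 hp
    rw [sheetForm_extDeriv, hinv]
    have h1 := h.sum_system (Connection.line ⟨0, 0⟩) c i
    have hnx : ∀ f, (Connection.line ⟨0, 0⟩).nx f = dx f := fun f => by
      rw [Connection.line_nx, zero_mul, add_zero]
    have hny : ∀ f, (Connection.line ⟨0, 0⟩).ny f = dy f := fun f => by
      rw [Connection.line_ny, zero_mul, add_zero]
    have hsys : (Connection.line ⟨0, 0⟩).system A c = systemOp A c := by
      funext e
      simp only [Connection.system, systemOp, hnx, hny, smul_eq_mul]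
    have h2 : ∑ l : Fin (n + 1), W.sheetCoeff a₀ i l • c l =
        (∑ l, c l * W.slope i ^ (l : ℕ)) * W.weight a₀ i := by
      rw [Finset.sum_mul]
      exact Finset.sum_congr rfl fun l _ => by rw [Web.sheetCoeff, smul_eq_mul]; ring
    rw [hsys, h2, hnx, hny, smul_eq_mul] at h1
    rw [← h1]
    have h3 : ∑ e : Fin (n + 2), W.sheetCoeff a₀ i e • systemOp A c e =
        W.weight a₀ i * ∑ e : Fin (n + 2), systemOp A c e * W.slope i ^ (e : ℕ) := by
      rw [Finset.mul_sum]
      exact Finset.sum_congr rfl fun e _ => by rw [Web.sheetCoeff, smul_eq_mul]; ring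
    rw [h3, ← mul_assoc, mul_comm _ (W.weight a₀ i), hunit, one_mul]

/-- The columns are obtained by interpolation of the values of dω on the sheets. The n + 3 nodes
allow degree n + 2, while the matrix has rows only up to degree n + 1. -/
theorem Web.exists_hasMatrix (ha : IsUnit a₀) (hW : ∀ i, IsUnit (dy (W.fn i))) :
    ∃ A : Matrix (Fin (n + 2)) (Fin (n + 1)) 𝒪, W.HasMatrix a₀ A := by
  let g : Fin (n + 3) → Fin (n + 1) → 𝒪 := fun k l =>
    dx (W.sheetCoeff a₀ k l) + dy (W.slope k * W.sheetCoeff a₀ k l)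
  have hg : ∀ l, ∑ k, g k l = 0 := by
    intro l
    have hl := l.2
    have h1 : ∑ k, W.sheetCoeff a₀ k l = 0 := Web.sum_pow_mul_weight ha hW (by omega)
    have h2 : ∑ k, W.slope k * W.sheetCoeff a₀ k l = 0 := by
      rw [← Web.sum_pow_mul_weight ha hW (b := (l : ℕ) + 1) (by omega)]
      exact Finset.sum_congr rfl fun k _ => by rw [Web.sheetCoeff]; ring
    simp only [g]
    rw [Finset.sum_add_distrib, ← map_sum, ← map_sum, h1, h2, map_zero, map_zero, add_zero]
  refine ⟨fun e l => ∑ k, a₀ * (coNodal W.slope k).coeff e * g k l, fun i l => ?_⟩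
  have h1 : ∑ a : Fin (n + 3), W.sheetCoeff a₀ i a *
      ∑ k, a₀ * (coNodal W.slope k).coeff a * g k l = g i l := by
    simp only [Finset.mul_sum]
    rw [Finset.sum_comm]
    have h := Web.interpolation_right ha hW i
    have h2 : ∀ k, ∑ a : Fin (n + 3), W.sheetCoeff a₀ i a *
        (a₀ * (coNodal W.slope k).coeff a * g k l) = (if i = k then 1 else 0) * g k l := by
      intro k
      rw [← h k, Finset.sum_mul]
      exact Finset.sum_congr rfl fun a _ => by rw [Web.sheetCoeff]; ring
    simp [h2]
  rw [Fin.sum_univ_castSucc] at h1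
  -- The coefficient of degree n + 2 is the sum of the dω over the sheets, which vanishes since the
  -- ω themselves add up to zero.
  have h2 : ∑ k, a₀ * (coNodal W.slope k).coeff (Fin.last (n + 2) : Fin (n + 3)) * g k l = 0 := by
    have hc : ∀ k, (coNodal W.slope k).coeff (Fin.last (n + 2) : Fin (n + 3)) = 1 :=
      fun k => coeff_coNodal_top W.slope k
    simp only [hc, mul_one, ← Finset.mul_sum, hg, mul_zero]
  rw [h2, mul_zero, add_zero] at h1
  exact h1

theorem Web.HasMatrix.unique {A' : Matrix (Fin (n + 2)) (Fin (n + 1)) 𝒪} (ha : IsUnit a₀)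
    (hW : ∀ i, IsUnit (dy (W.fn i))) (hA : W.HasMatrix a₀ A) (hA' : W.HasMatrix a₀ A') : A = A' := by
  ext1 e l
  have h1 := Web.interpolation_left ha hW (by omega) (fun e => A e l) e
  have h2 := Web.interpolation_left ha hW (by omega) (fun e => A' e l) e
  have h3 := fun i => (hA i l).trans (hA' i l).symm
  simp only [Web.sheetCoeff] at h3
  simp only [smul_eq_mul] at h1 h2
  rw [← h1, ← h2]
  simp only [h3]

/-- The matrix is unique by interpolation, and a connection that projects to the Spencer operator is
forced by the ambient one through the injective embedding. -/
theorem Web.Presents.unique_associatedConnection (hF : W.Presents F) :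
    Nonempty (Unique (AssociatedConnection n F)) := by
  have hW := hF.isUnit_dy
  obtain ⟨a₀, ha, hfac⟩ := hF.exists_eq
  obtain ⟨A, hA⟩ := Web.exists_hasMatrix ha hW
  obtain ⟨D, hx, hy⟩ := Web.exists_connection ha hW hA
  refine ⟨⟨⟨⟨A, (Web.isSystemMatrix_iff ha hW hfac).2 hA, D,
    fun s => Web.truncate_of_toAmbient_nx ha hW hA (hx s),
    fun s => Web.truncate_of_toAmbient_ny ha hW hA (hy s)⟩⟩, ?_⟩⟩
  rintro ⟨A', hA', D', hx', hy'⟩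
  obtain rfl : A' = A := Web.HasMatrix.unique ha hW ((Web.isSystemMatrix_iff ha hW hfac).1 hA') hA
  have hD : D' = D := by
    obtain ⟨h1, h2⟩ := Web.toAmbient_nabla ha hW hA D' hx' hy'
    have hinj := Web.toAmbient_injective ha hW hA
    apply Connection.ext
    · ext1 s
      exact hinj ((h1 s).trans (hx s).symm)
    · ext1 s
      exact hinj ((h2 s).trans (hy s).symm)
  subst hD
  rfl

/-- The rank of the bundle of a web, and the trace of its connection. -/
theorem Web.Presents.rank_and_trace (hF : W.Presents F) (C : AssociatedConnection n F) :
    Module.Free 𝒪 C.E ∧ Module.Finite 𝒪 C.E ∧ Module.finrank 𝒪 C.E = (n + 2) * (n + 1) / 2 ∧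
    ∀ {r : ℕ} (b : Module.Basis (Fin r) 𝒪 C.E), ∃ g : 𝒪ˣ,
      2 * basisTrace b C.nabla.nx * g = 2 * dx (g : 𝒪) + (∑ i, W.traceCoeff i * dx (W.fn i)) * g ∧
      2 * basisTrace b C.nabla.ny * g = 2 * dy (g : 𝒪) + (∑ i, W.traceCoeff i * dy (W.fn i)) * g := by
  have hW := hF.isUnit_dy
  obtain ⟨a₀, ha, hfac⟩ := hF.exists_eq
  have hA := (Web.isSystemMatrix_iff ha hW hfac).1 C.isSystemMatrix
  obtain ⟨h1, h2⟩ := Web.toAmbient_nabla ha hW hA C.nabla C.truncate_nx C.truncate_ny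
  have hinj := Web.toAmbient_injective ha hW hA
  have hsurj := W.toJet_surjective hW
  have hex := Web.mem_range_toAmbient ha hW hA
  obtain ⟨hfree, hfin, hrank⟩ := free_of_exact (Pi.basisFun 𝒪 (Fin (n + 3) × Fin (n + 1)))
    (Pi.basisFun 𝒪 {α // α ∈ jetOrders n}) (W.toAmbient a₀ C.matrix) W.toJet hinj hsurj hex
  refine ⟨hfree, hfin, ?_, fun b => ?_⟩
  · have hcard := two_mul_card_jetOrders n
    rw [Fintype.card_coe, Fintype.card_prod, Fintype.card_fin, Fintype.card_fin] at hrank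
    have h3 : 2 * Module.finrank 𝒪 C.E = (n + 2) * (n + 1) := by
      have h4 : 2 * Module.finrank 𝒪 C.E + (n + 1) * (n + 4) = 2 * ((n + 3) * (n + 1)) := by
        rw [← hcard, ← mul_add, hrank]
      have h5 : 2 * ((n + 3) * (n + 1)) = (n + 2) * (n + 1) + (n + 1) * (n + 4) := by ring
      omega
    omega
  · obtain ⟨g, hgx, hgy⟩ := exists_unit_trace_exact (Pi.basisFun 𝒪 (Fin (n + 3) × Fin (n + 1)))
      (Pi.basisFun 𝒪 {α // α ∈ jetOrders n}) (W.toAmbient a₀ C.matrix) W.toJet hinj hsurj hex b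
      C.nabla W.ambient (jetConnection n) h1 h2 (W.toJet_nx hW) (W.toJet_ny hW)
    rw [basisTrace_jetConnection_nx, add_zero] at hgx
    rw [basisTrace_jetConnection_ny, add_zero] at hgy
    refine ⟨g, ?_, ?_⟩
    · linear_combination 2 * hgx + (g : 𝒪) * W.two_mul_basisTrace_nx hW
    · linear_combination 2 * hgy + (g : 𝒪) * W.two_mul_basisTrace_ny hW

end Presentation

end WebGeometry

namespace WebGeometry

/-! ### Gauge equivalent 1-forms -/

/-- Two 1-forms are gauge equivalent if their difference is the logarithmic differential of an
invertible function. -/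
def OneForm.GaugeEquiv (θ θ' : OneForm) : Prop :=
  ∃ g : 𝒪ˣ, θ.cx * g = dx (g : 𝒪) + θ'.cx * g ∧ θ.cy * g = dy (g : 𝒪) + θ'.cy * g

/-- A logarithmic differential is closed. -/
theorem OneForm.GaugeEquiv.extDeriv_eq {θ θ' : OneForm} (h : θ.GaugeEquiv θ') :
    θ.extDeriv = θ'.extDeriv := by
  obtain ⟨g, hx, hy⟩ := h
  apply (Units.isUnit g).mul_left_cancel
  have h1 := congrArg dy hx
  have h2 := congrArg dx hy
  simp only [map_add, Derivation.leibniz, smul_eq_mul] at h1 h2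
  have h3 := dx_dy_comm (g : 𝒪)
  simp only [OneForm.extDeriv]
  have h4 : dx (g : 𝒪) = θ.cx * g - θ'.cx * g := by rw [hx]; ring
  have h5 : dy (g : 𝒪) = θ.cy * g - θ'.cy * g := by rw [hy]; ring
  linear_combination h2 - h1 + h3 + (θ'.cy - θ.cy) * h4 - (θ'.cx - θ.cx) * h5

theorem OneForm.GaugeEquiv.symm {θ θ' : OneForm} (h : θ.GaugeEquiv θ') : θ'.GaugeEquiv θ := by
  obtain ⟨g, hx, hy⟩ := h
  have key : ∀ (δ : Derivation ℤ 𝒪 𝒪) (a b : 𝒪), a * g = δ (g : 𝒪) + b * g →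
      b * (g⁻¹ : 𝒪ˣ) = δ ((g⁻¹ : 𝒪ˣ) : 𝒪) + a * (g⁻¹ : 𝒪ˣ) := by
    intro δ a b h
    have h1 : (g : 𝒪) * (g⁻¹ : 𝒪ˣ) = 1 := Units.mul_inv g
    have h2 := congrArg δ h1
    rw [Derivation.leibniz, Derivation.map_one_eq_zero, smul_eq_mul, smul_eq_mul] at h2
    apply (Units.isUnit g).mul_left_cancel
    linear_combination (b - a) * h1 - h2 - (g⁻¹ : 𝒪ˣ) * h + (a - b) * h1
  exact ⟨g⁻¹, key _ _ _ hx, key _ _ _ hy⟩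

theorem OneForm.GaugeEquiv.trans {θ θ' θ'' : OneForm} (h : θ.GaugeEquiv θ')
    (h' : θ'.GaugeEquiv θ'') : θ.GaugeEquiv θ'' := by
  obtain ⟨g, hx, hy⟩ := h
  obtain ⟨g', hx', hy'⟩ := h'
  refine ⟨g * g', ?_, ?_⟩ <;> rw [Units.val_mul, Derivation.leibniz, smul_eq_mul, smul_eq_mul]
  · linear_combination (g' : 𝒪) * hx + (g : 𝒪) * hx'
  · linear_combination (g' : 𝒪) * hy + (g : 𝒪) * hy'

theorem OneForm.GaugeEquiv.sum {ι : Type} (s : Finset ι) {θ θ' : ι → OneForm}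
    (h : ∀ i, (θ i).GaugeEquiv (θ' i)) :
    OneForm.GaugeEquiv ⟨∑ i ∈ s, (θ i).cx, ∑ i ∈ s, (θ i).cy⟩
      ⟨∑ i ∈ s, (θ' i).cx, ∑ i ∈ s, (θ' i).cy⟩ := by
  classical
  induction s using Finset.induction_on with
  | empty => exact ⟨1, by simp, by simp⟩
  | insert k s hk ih =>
    obtain ⟨g, hx, hy⟩ := ih
    obtain ⟨g', hx', hy'⟩ := h k
    dsimp only at hx hy
    refine ⟨g * g', ?_, ?_⟩ <;>
      simp only [Finset.sum_insert hk, Units.val_mul, Derivation.leibniz, smul_eq_mul]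
    · linear_combination (g' : 𝒪) * hx + (g : 𝒪) * hx'
    · linear_combination (g' : 𝒪) * hy + (g : 𝒪) * hy'

/-! ### The Blaschke curvature of a 3-web -/

section Blaschke

variable {d : ℕ} (W : Web d)

/-- The contribution of an ordered triple of foliations to the trace of the connection. -/
def Web.hessCoeff (i k l : Fin d) : 𝒪 :=
  slopeHess (W.fn i) (W.ratio k) (W.ratio l) *
    Ring.inverse (dx (W.fn i) - W.ratio k * dy (W.fn i)) *
    Ring.inverse (dx (W.fn i) - W.ratio l * dy (W.fn i))

theorem Web.hessCoeff_comm (i k l : Fin d) : W.hessCoeff i k l = W.hessCoeff i l k := by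
  simp only [Web.hessCoeff, slopeHess]
  ring

/-- The coefficient on `dx ∧ dy` of the wedge product of the differentials of two of the
functions defining a web. -/
def Web.wedgeCoeff (i k : Fin d) : 𝒪 := (diff (W.fn i)).wedge (diff (W.fn k))

theorem Web.wedgeCoeff_eq (i k : Fin d) :
    W.wedgeCoeff i k = dx (W.fn i) * dy (W.fn k) - dy (W.fn i) * dx (W.fn k) := rfl

theorem Web.isUnit_wedgeCoeff {i k : Fin d} (h : i ≠ k) : IsUnit (W.wedgeCoeff i k) :=
  Web.isUnit_wedge h

variable {W}

/-- Clears the denominators, with X_k F_i · ∂_y F_k equal to the wedge coefficient, so that later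
identities become polynomial in the derivatives. -/
theorem Web.hessCoeff_mul (hW : ∀ i, IsUnit (dy (W.fn i))) {i k l : Fin d} (hk : i ≠ k)
    (hl : i ≠ l) : W.hessCoeff i k l * (W.wedgeCoeff i k * W.wedgeCoeff i l) =
      dx (dx (W.fn i)) * dy (W.fn k) * dy (W.fn l) -
      dx (dy (W.fn i)) * (dx (W.fn k) * dy (W.fn l) + dy (W.fn k) * dx (W.fn l)) +
      dy (dy (W.fn i)) * dx (W.fn k) * dx (W.fn l) := by
  have hw : ∀ j, W.wedgeCoeff i j = (dx (W.fn i) - W.ratio j * dy (W.fn i)) * dy (W.fn j) := by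
    intro j
    rw [Web.wedgeCoeff_eq, ← Web.ratio_mul hW j]
    ring
  have h1 := Ring.inverse_mul_cancel _ (Web.isUnit_dx_sub hW hk)
  have h2 := Ring.inverse_mul_cancel _ (Web.isUnit_dx_sub hW hl)
  rw [hw, hw, Web.hessCoeff, ← Web.ratio_mul hW k, ← Web.ratio_mul hW l]
  generalize Ring.inverse (dx (W.fn i) - W.ratio k * dy (W.fn i)) = a at *
  generalize Ring.inverse (dx (W.fn i) - W.ratio l * dy (W.fn i)) = b at *
  generalize dx (W.fn i) - W.ratio k * dy (W.fn i) = a' at *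
  generalize dx (W.fn i) - W.ratio l * dy (W.fn i) = b' at *
  rw [slopeHess]
  generalize dx (dx (W.fn i)) = p
  generalize dx (dy (W.fn i)) = q
  generalize dy (dy (W.fn i)) = r
  linear_combination (p - (W.ratio k + W.ratio l) * q + W.ratio k * W.ratio l * r) *
    dy (W.fn k) * dy (W.fn l) * (b * b' * h1 + h2)

/-- After clearing denominators, the second derivatives of F_k and F_l on the left are those
produced by differentiating dF_k ∧ dF_l. -/
theorem Web.hessCoeff_structure (hW : ∀ i, IsUnit (dy (W.fn i))) {i k l : Fin d} (hik : i ≠ k)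
    (hil : i ≠ l) (hkl : k ≠ l) :
    (W.hessCoeff k l i * W.wedgeCoeff k i + W.hessCoeff l i k * W.wedgeCoeff l i) *
      W.wedgeCoeff k l =
    dx (W.wedgeCoeff k l) * dy (W.fn i) - dy (W.wedgeCoeff k l) * dx (W.fn i) := by
  have h1 := Web.hessCoeff_mul hW hkl hik.symm
  have h2 := Web.hessCoeff_mul hW hil.symm hkl.symm
  have h3 : W.wedgeCoeff l k = - W.wedgeCoeff k l := by simp only [Web.wedgeCoeff_eq]; ring
  rw [h3] at h2
  have h4 : dx (W.wedgeCoeff k l) * dy (W.fn i) - dy (W.wedgeCoeff k l) * dx (W.fn i) =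
      (dx (dx (W.fn k)) * dy (W.fn l) + dx (W.fn k) * dx (dy (W.fn l)) -
        dx (dy (W.fn k)) * dx (W.fn l) - dy (W.fn k) * dx (dx (W.fn l))) * dy (W.fn i) -
      (dx (dy (W.fn k)) * dy (W.fn l) + dx (W.fn k) * dy (dy (W.fn l)) -
        dy (dy (W.fn k)) * dx (W.fn l) - dy (W.fn k) * dx (dy (W.fn l))) * dx (W.fn i) := by
    simp only [Web.wedgeCoeff_eq, map_sub, Derivation.leibniz, smul_eq_mul, dx_dy_comm]
    ring
  rw [h4]
  linear_combination h1 - h2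

/-- The structure form of a 3-web, for the normalisation of its defining forms by the wedge
products of their differentials. -/
def Web.structureForm (V : Web 3) : OneForm :=
  ⟨V.hessCoeff 0 1 2 * dx (V.fn 0) + V.hessCoeff 1 2 0 * dx (V.fn 1) +
      V.hessCoeff 2 0 1 * dx (V.fn 2),
    V.hessCoeff 0 1 2 * dy (V.fn 0) + V.hessCoeff 1 2 0 * dy (V.fn 1) +
      V.hessCoeff 2 0 1 * dy (V.fn 2)⟩

variable {V : Web 3}

/-- These are the structure equations for the normalisation ρ_i = dF_k ∧ dF_l with i, k, l in cyclic
order. The third term of the structure form is proportional to dF_i and drops out of the wedge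
product. -/
theorem Web.structureForm_wedge (hV : ∀ i, IsUnit (dy (V.fn i))) :
    (V.structureForm.wedge (diff (V.fn 0)) * V.wedgeCoeff 1 2 =
      dx (V.wedgeCoeff 1 2) * dy (V.fn 0) - dy (V.wedgeCoeff 1 2) * dx (V.fn 0)) ∧
    (V.structureForm.wedge (diff (V.fn 1)) * V.wedgeCoeff 2 0 =
      dx (V.wedgeCoeff 2 0) * dy (V.fn 1) - dy (V.wedgeCoeff 2 0) * dx (V.fn 1)) ∧
    (V.structureForm.wedge (diff (V.fn 2)) * V.wedgeCoeff 0 1 =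
      dx (V.wedgeCoeff 0 1) * dy (V.fn 2) - dy (V.wedgeCoeff 0 1) * dx (V.fn 2)) := by
  refine ⟨?_, ?_, ?_⟩
  · rw [← Web.hessCoeff_structure hV (i := 0) (k := 1) (l := 2) (by decide) (by decide)
      (by decide)]
    simp only [Web.structureForm, OneForm.wedge, diff, Web.wedgeCoeff_eq]
    ring
  · rw [← Web.hessCoeff_structure hV (i := 1) (k := 2) (l := 0) (by decide) (by decide)
      (by decide)]
    simp only [Web.structureForm, OneForm.wedge, diff, Web.wedgeCoeff_eq]
    ring
  · rw [← Web.hessCoeff_structure hV (i := 2) (k := 0) (l := 1) (by decide) (by decide)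
      (by decide)]
    simp only [Web.structureForm, OneForm.wedge, diff, Web.wedgeCoeff_eq]
    ring

theorem extDeriv_mulFun_diff (ρ f : 𝒪) :
    ((diff f).mulFun ρ).extDeriv = dx ρ * dy f - dy ρ * dx f := by
  simp only [diff, OneForm.mulFun, OneForm.extDeriv, Derivation.leibniz, smul_eq_mul, dx_dy_comm]
  ring

theorem wedge_mulFun_diff (γ : OneForm) (ρ f : 𝒪) :
    γ.wedge ((diff f).mulFun ρ) = γ.wedge (diff f) * ρ := by
  simp only [OneForm.mulFun, OneForm.wedge]
  ring

theorem Web.isBlaschkeCurvature_structureForm (hV : ∀ i, IsUnit (dy (V.fn i))) :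
    V.IsBlaschkeCurvature V.structureForm.extDeriv := by
  obtain ⟨h0, h1, h2⟩ := Web.structureForm_wedge hV
  refine ⟨![V.wedgeCoeff 1 2, V.wedgeCoeff 2 0, V.wedgeCoeff 0 1], V.structureForm, ?_, ⟨?_, ?_⟩,
    ?_, rfl⟩
  · intro i
    fin_cases i <;> exact Web.isUnit_wedgeCoeff V (by decide)
  · simp only [Fin.sum_univ_three, OneForm.mulFun, diff, Matrix.cons_val, Web.wedgeCoeff_eq]
    ring
  · simp only [Fin.sum_univ_three, OneForm.mulFun, diff, Matrix.cons_val, Web.wedgeCoeff_eq]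
    ring
  · intro i
    rw [extDeriv_mulFun_diff, wedge_mulFun_diff]
    fin_cases i
    · exact h0.symm
    · exact h1.symm
    · exact h2.symm

/-- The linear relation between three covectors in the plane is unique up to a factor, so any
normalisation is `g` times the cyclic one. Its form γ then differs from the structure form by dg /
g. -/
theorem Web.IsBlaschkeCurvature.eq (hV : ∀ i, IsUnit (dy (V.fn i))) {κ : 𝒪}
    (h : V.IsBlaschkeCurvature κ) : κ = V.structureForm.extDeriv := by
  obtain ⟨ρ, γ, hρ, ⟨hsx, hsy⟩, hd, rfl⟩ := h
  obtain ⟨h0, h1, -⟩ := Web.structureForm_wedge hV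
  have hw12 := Web.isUnit_wedgeCoeff V (i := 1) (k := 2) (by decide)
  have hw20 := Web.isUnit_wedgeCoeff V (i := 2) (k := 0) (by decide)
  have hw01 := Web.isUnit_wedgeCoeff V (i := 0) (k := 1) (by decide)
  simp only [Fin.sum_univ_three, OneForm.mulFun, diff] at hsx hsy
  obtain ⟨g, hg⟩ := (hρ 0).mul hw12.ringInverse
  have hρ0 : ρ 0 = g * V.wedgeCoeff 1 2 := by
    rw [hg, mul_assoc, Ring.inverse_mul_cancel _ hw12, mul_one]
  have hρ1 : ρ 1 = g * V.wedgeCoeff 2 0 := by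
    apply hw12.mul_left_cancel
    have : V.wedgeCoeff 1 2 * ρ 1 = ρ 0 * V.wedgeCoeff 2 0 := by
      simp only [Web.wedgeCoeff_eq]
      linear_combination dy (V.fn 2) * hsx - dx (V.fn 2) * hsy
    rw [this, hρ0]
    ring
  have hd0 := hd 0
  have hd1 := hd 1
  rw [extDeriv_mulFun_diff, wedge_mulFun_diff, hρ0] at hd0
  rw [extDeriv_mulFun_diff, wedge_mulFun_diff, hρ1] at hd1
  simp only [Derivation.leibniz, smul_eq_mul] at hd0 hd1
  -- The form X dx + Y dy has zero wedge product with dF_0 and with dF_1, which are independent,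
  -- hence it is zero.
  set X := dx (g : 𝒪) + V.structureForm.cx * g - γ.cx * g with hX
  set Y := dy (g : 𝒪) + V.structureForm.cy * g - γ.cy * g with hY
  have e0 : X * dy (V.fn 0) - Y * dx (V.fn 0) = 0 := by
    apply hw12.mul_left_cancel
    rw [hX, hY]
    simp only [OneForm.wedge, diff] at hd0 h0
    linear_combination hd0 + (g : 𝒪) * h0
  have e1 : X * dy (V.fn 1) - Y * dx (V.fn 1) = 0 := by
    apply hw20.mul_left_cancel
    rw [hX, hY]
    simp only [OneForm.wedge, diff] at hd1 h1
    linear_combination hd1 + (g : 𝒪) * h1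
  refine OneForm.GaugeEquiv.extDeriv_eq ⟨g, ?_, ?_⟩
  · have : X = 0 := by
      apply hw01.mul_left_cancel
      rw [Web.wedgeCoeff_eq]
      linear_combination dx (V.fn 0) * e1 - dx (V.fn 1) * e0
    linear_combination -this
  · have : Y = 0 := by
      apply hw01.mul_left_cancel
      rw [Web.wedgeCoeff_eq]
      linear_combination dy (V.fn 0) * e1 - dy (V.fn 1) * e0
    linear_combination -this

/-- The two remaining foliations give one unordered pair, counted in both orders. -/
theorem Web.traceCoeff_three (V : Web 3) (i k l : Fin 3) (hik : i ≠ k) (hil : i ≠ l)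
    (hkl : k ≠ l) : V.traceCoeff i = 2 * V.hessCoeff i k l := by
  have h1 : Finset.univ.erase i = {k, l} := by decide +revert
  have h2 : (Finset.univ.erase i).erase k = {l} := by decide +revert
  have h3 : (Finset.univ.erase i).erase l = {k} := by decide +revert
  change ∑ k ∈ Finset.univ.erase i, ∑ l ∈ (Finset.univ.erase i).erase k, V.hessCoeff i k l = _
  rw [h1, Finset.sum_pair hkl, ← h1, h2, h3, Finset.sum_singleton, Finset.sum_singleton,
    V.hessCoeff_comm i l k]
  ring

theorem Web.sum_traceCoeff_three (V : Web 3) (f : Fin 3 → 𝒪) :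
    ∑ i, V.traceCoeff i * f i =
      2 * (V.hessCoeff 0 1 2 * f 0 + V.hessCoeff 1 2 0 * f 1 + V.hessCoeff 2 0 1 * f 2) := by
  rw [Fin.sum_univ_three,
    V.traceCoeff_three 0 1 2 (by decide) (by decide) (by decide),
    V.traceCoeff_three 1 2 0 (by decide) (by decide) (by decide),
    V.traceCoeff_three 2 0 1 (by decide) (by decide) (by decide)]
  ring

end Blaschke

/-! ### Sums over triples -/

section Triples

theorem sum_erase_erase {d : ℕ} (Q : Fin d → Fin d → Fin d → 𝒪) (i : Fin d) :
    ∑ k ∈ Finset.univ.erase i, ∑ l ∈ (Finset.univ.erase i).erase k, Q i k l =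
      ∑ k, ∑ l, if i ≠ k ∧ i ≠ l ∧ k ≠ l then Q i k l else 0 := by
  have h1 : ∀ k, (Finset.univ.erase i).erase k =
      Finset.univ.filter (fun l : Fin d => i ≠ l ∧ k ≠ l) := by
    intro k
    ext l
    simp only [Finset.mem_erase, Finset.mem_univ, Finset.mem_filter, and_true, true_and]
    tauto
  have h2 : Finset.univ.erase i = Finset.univ.filter (fun k : Fin d => i ≠ k) := by
    ext k
    simp [eq_comm]
  simp only [h1]
  rw [h2, Finset.sum_filter]
  refine Finset.sum_congr rfl fun k _ => ?_
  rw [Finset.sum_filter]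
  split_ifs with h
  · simp only [h, ne_eq, not_false_eq_true, true_and]
  · simp [h]

/-- Three distinct indices lie in exactly one three-element set. -/
theorem sum_triple {d : ℕ} (Q : Fin d → Fin d → Fin d → 𝒪) :
    ∑ i, ∑ k, ∑ l, (if i ≠ k ∧ i ≠ l ∧ k ≠ l then Q i k l else 0) =
      ∑ T : Triple d, ∑ i ∈ T.1, ∑ k ∈ T.1, ∑ l ∈ T.1,
        (if i ≠ k ∧ i ≠ l ∧ k ≠ l then Q i k l else 0) := by
  set P : Fin d → Fin d → Fin d → 𝒪 := fun i k l =>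
    if i ≠ k ∧ i ≠ l ∧ k ≠ l then Q i k l else 0 with hP
  have h1 : ∀ T : Triple d, ∑ i ∈ T.1, ∑ k ∈ T.1, ∑ l ∈ T.1, P i k l =
      ∑ i, ∑ k, ∑ l, if i ∈ T.1 ∧ k ∈ T.1 ∧ l ∈ T.1 then P i k l else 0 := by
    intro T
    have h2 : ∀ f : Fin d → 𝒪, ∑ i ∈ T.1, f i = ∑ i, if i ∈ T.1 then f i else 0 := by
      intro f
      simp
    rw [h2]
    refine Finset.sum_congr rfl fun i _ => ?_
    by_cases hi : i ∈ T.1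
    · simp only [hi, true_and, if_true]
      rw [h2]
      refine Finset.sum_congr rfl fun k _ => ?_
      by_cases hk : k ∈ T.1
      · simp only [hk, true_and, if_true]
        rw [h2]
      · simp [hk]
    · simp [hi]
  change ∑ i, ∑ k, ∑ l, P i k l = ∑ T : Triple d, ∑ i ∈ T.1, ∑ k ∈ T.1, ∑ l ∈ T.1, P i k l
  simp only [h1]
  refine (Finset.sum_congr rfl fun i _ => ?_).trans Finset.sum_comm
  refine (Finset.sum_congr rfl fun k _ => ?_).trans Finset.sum_comm
  refine (Finset.sum_congr rfl fun l _ => ?_).trans Finset.sum_comm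
  by_cases h : i ≠ k ∧ i ≠ l ∧ k ≠ l
  · have hcard : ({i, k, l} : Finset (Fin d)).card = 3 :=
      Finset.card_eq_three.2 ⟨i, k, l, h.1, h.2.1, h.2.2, rfl⟩
    rw [Finset.sum_eq_single (⟨{i, k, l}, hcard⟩ : Triple d)]
    · rw [if_pos (by simp)]
    · intro T _ hT
      rw [if_neg]
      rintro ⟨hi, hk, hl⟩
      apply hT
      apply Subtype.ext
      symm
      apply Finset.eq_of_subset_of_card_le
      · intro a ha
        simp only [Finset.mem_insert, Finset.mem_singleton] at ha
        rcases ha with rfl | rfl | rfl <;> assumption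
      · rw [hcard, T.2]
    · simp
  · simp [hP, h]

theorem sum_extract {d : ℕ} (Q : Fin d → Fin d → Fin d → 𝒪) :
    ∑ i, ∑ k ∈ Finset.univ.erase i, ∑ l ∈ (Finset.univ.erase i).erase k, Q i k l =
      ∑ T : Triple d, ∑ i, ∑ k ∈ Finset.univ.erase i, ∑ l ∈ (Finset.univ.erase i).erase k,
        Q (T.1.orderEmbOfFin T.2 i) (T.1.orderEmbOfFin T.2 k) (T.1.orderEmbOfFin T.2 l) := by
  simp only [sum_erase_erase]
  rw [sum_triple]
  refine Finset.sum_congr rfl fun T _ => ?_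
  have h : ∀ f : Fin d → 𝒪, ∑ i ∈ T.1, f i = ∑ a, f (T.1.orderEmbOfFin T.2 a) := by
    intro f
    conv_lhs => rw [← Finset.map_orderEmbOfFin_univ T.1 T.2]
    rw [Finset.sum_map]
    rfl
  simp only [h]
  have := (sum_erase_erase fun i k l => Q (T.1.orderEmbOfFin T.2 i) (T.1.orderEmbOfFin T.2 k)
    (T.1.orderEmbOfFin T.2 l))
  simp only [this, ne_eq, EmbeddingLike.apply_eq_iff_eq]

/-- The Hessian coefficient of (i, k, l) uses only these three foliations, so it is the same in the
web and in the extracted 3-web. -/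
theorem Web.sum_traceCoeff {d : ℕ} (W : Web d) (f : Fin d → 𝒪) :
    ∑ i, W.traceCoeff i * f i =
      ∑ T : Triple d, ∑ i, (W.extract T).traceCoeff i * f (T.1.orderEmbOfFin T.2 i) := by
  have h := sum_extract fun i k l => W.hessCoeff i k l * f i
  simp only [← Finset.sum_mul] at h
  exact h

end Triples

/-! ### The trace of the connection of a web -/

section Main

variable {n : ℕ} {W : Web (n + 3)} {F : 𝒪[X]}

/-- The sum of the structure forms of the extracted 3-webs. -/
def Web.totalForm {d : ℕ} (W : Web d) : OneForm :=
  ⟨∑ T : Triple d, (W.extract T).structureForm.cx, ∑ T : Triple d, (W.extract T).structureForm.cy⟩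

theorem Web.Presents.gaugeEquiv_traceForm (hF : W.Presents F) (C : AssociatedConnection n F)
    {r : ℕ} (b : Module.Basis (Fin r) 𝒪 C.E) {θ : OneForm}
    (hx : ∑ i, W.traceCoeff i * dx (W.fn i) = 2 * θ.cx)
    (hy : ∑ i, W.traceCoeff i * dy (W.fn i) = 2 * θ.cy) :
    (C.nabla.traceForm b).GaugeEquiv θ := by
  obtain ⟨g, h1, h2⟩ := (hF.rank_and_trace C).2.2.2 b
  have two : IsUnit (2 : 𝒪) := by exact_mod_cast isUnit_natCast two_ne_zero
  rw [hx] at h1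
  rw [hy] at h2
  refine ⟨g, two.mul_left_cancel ?_, two.mul_left_cancel ?_⟩ <;> rw [Connection.traceForm]
  · linear_combination h1
  · linear_combination h2

theorem Web.Presents.gaugeEquiv_totalForm (hF : W.Presents F) (C : AssociatedConnection n F)
    {r : ℕ} (b : Module.Basis (Fin r) 𝒪 C.E) : (C.nabla.traceForm b).GaugeEquiv W.totalForm := by
  have key : ∀ f : Fin (n + 3) → 𝒪, ∑ i, W.traceCoeff i * f i = 2 * ∑ T : Triple (n + 3),
      ((W.extract T).hessCoeff 0 1 2 * f (T.1.orderEmbOfFin T.2 0) +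
        (W.extract T).hessCoeff 1 2 0 * f (T.1.orderEmbOfFin T.2 1) +
        (W.extract T).hessCoeff 2 0 1 * f (T.1.orderEmbOfFin T.2 2)) := by
    intro f
    rw [Web.sum_traceCoeff, Finset.mul_sum]
    exact Finset.sum_congr rfl fun T _ =>
      (W.extract T).sum_traceCoeff_three fun i => f (T.1.orderEmbOfFin T.2 i)
  exact hF.gaugeEquiv_traceForm C b (key fun i => dx (W.fn i)) (key fun i => dy (W.fn i))

theorem Web.Presents.gaugeEquiv_structureForm {V : Web 3} {G : 𝒪[X]} (hG : V.Presents G)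
    (C : AssociatedConnection 0 G) {r : ℕ} (b : Module.Basis (Fin r) 𝒪 C.E) :
    (C.nabla.traceForm b).GaugeEquiv V.structureForm :=
  Web.Presents.gaugeEquiv_traceForm (n := 0) hG C b (V.sum_traceCoeff_three fun i => dx (V.fn i))
    (V.sum_traceCoeff_three fun i => dy (V.fn i))

theorem Web.totalForm_extDeriv {d : ℕ} (W : Web d) :
    W.totalForm.extDeriv = ∑ T : Triple d, (W.extract T).structureForm.extDeriv := by
  simp only [Web.totalForm, OneForm.extDeriv, map_sum, Finset.sum_sub_distrib]

end Main

end WebGeometry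

end

/-- With `d = n + 3 ∈ {4, 5, 6}`. -/
theorem mainTheorem2 (n : ℕ) (hd : n + 3 = 4 ∨ n + 3 = 5 ∨ n + 3 = 6)
    (W : Web (n + 3)) (F : 𝒪[X]) (hF : W.Presents F) :
    -- the associated connection exists and is unique
    Nonempty (Unique (AssociatedConnection n F)) ∧
    -- the extracted 3-webs have well-defined Blaschke curvatures
    (∀ T : Triple (n + 3), ∃! κ : 𝒪, (W.extract T).IsBlaschkeCurvature κ) ∧
    -- the extracted 3-webs are presented by some equation, and the associated connections
    -- exist and are unique
    (∀ T : Triple (n + 3), ∃ G : 𝒪[X], (W.extract T).Presents G) ∧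
    (∀ (T : Triple (n + 3)) (G : 𝒪[X]), (W.extract T).Presents G →
      Nonempty (Unique (AssociatedConnection 0 G))) ∧
    ∀ C : AssociatedConnection n F,
      -- `E` is a vector bundle of rank `(d - 1)(d - 2) / 2`
      Module.Free 𝒪 C.E ∧ Module.Finite 𝒪 C.E ∧
      Module.finrank 𝒪 C.E = (n + 2) * (n + 1) / 2 ∧
      -- the trace formula
      (∀ κ : Triple (n + 3) → 𝒪, (∀ T, (W.extract T).IsBlaschkeCurvature (κ T)) →
        LinearMap.trace 𝒪 C.E C.nabla.curvature = ∑ T, κ T) ∧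
      -- the determinant of `(E, ∇)` is the tensor product of the line bundles with connection
      -- associated to the extracted 3-webs
      (∀ (G : Triple (n + 3) → 𝒪[X]), (∀ T, (W.extract T).Presents (G T)) →
        ∀ L : ∀ T, AssociatedConnection 0 (G T),
        (∀ T, Module.Free 𝒪 (L T).E ∧ Module.Finite 𝒪 (L T).E ∧
          Module.finrank 𝒪 (L T).E = 1) ∧
        ∃ (detNabla : Connection (⋀[𝒪]^((n + 2) * (n + 1) / 2) C.E))
          (tensorNabla : Connection (⨂[𝒪] T, (L T).E)),
          C.nabla.IsExteriorPower ((n + 2) * (n + 1) / 2) detNabla ∧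
          Connection.IsTensorProduct (fun T => (L T).nabla) tensorNabla ∧
          detNabla.Isomorphic tensorNabla) := by
  have hV : ∀ (T : Triple (n + 3)) i, IsUnit (dy ((W.extract T).fn i)) :=
    fun T i => hF.isUnit_dy _
  refine ⟨hF.unique_associatedConnection,
    fun T => ⟨_, Web.isBlaschkeCurvature_structureForm (hV T), fun κ hκ => hκ.eq (hV T)⟩,
    fun T => Web.exists_presents (n := 0) (hV T),
    fun T G hG => Web.Presents.unique_associatedConnection (n := 0) hG, fun C => ?_⟩
  obtain ⟨hfree, hfin, hrank, -⟩ := hF.rank_and_trace C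
  let b := Module.finBasisOfFinrankEq 𝒪 C.E hrank
  refine ⟨hfree, hfin, hrank, fun κ hκ => ?_, fun G hG L => ?_⟩
  · rw [Connection.trace_curvature C.nabla b]
    change (C.nabla.traceForm b).extDeriv = _
    rw [(hF.gaugeEquiv_totalForm C b).extDeriv_eq, Web.totalForm_extDeriv]
    exact Finset.sum_congr rfl fun T _ => ((hκ T).eq (hV T)).symm
  · have hL : ∀ T, Module.Free 𝒪 (L T).E ∧ Module.Finite 𝒪 (L T).E ∧
        Module.finrank 𝒪 (L T).E = 1 := by
      intro T
      obtain ⟨h1, h2, h3, -⟩ := Web.Presents.rank_and_trace (n := 0) (hG T) (L T)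
      exact ⟨h1, h2, h3⟩
    let c : ∀ T, Module.Basis (Fin 1) 𝒪 (L T).E := fun T =>
      haveI := (hL T).1
      haveI := (hL T).2.1
      Module.finBasisOfFinrankEq 𝒪 (L T).E (hL T).2.2
    -- The comparison passes through the sum of the structure forms: for the whole web by the trace
    -- computation, for each 3-web by the same computation with n = 0.
    have hgauge := (hF.gaugeEquiv_totalForm C b).trans (OneForm.GaugeEquiv.sum Finset.univ fun T =>
      (hG T).gaugeEquiv_structureForm (L T) (c T)).symm
    obtain ⟨g, hgx, hgy⟩ := hgauge
    exact ⟨hL, _, _, Connection.isExteriorPower_transport_line C.nabla b,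
      Connection.isTensorProduct_transport_line (fun T => (L T).nabla) c,
      Connection.isomorphic_transport_line _ _ g hgx hgy⟩
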